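/- Let $\mathbb K$ be a field of characteristic zero and let $L=\bigoplus_{k\in\mathbb Z}L^k$ be a complete $L_\infty$ algebra over $\mathbb K$: a graded space with a descending filtration by graded subspaces $L=F^1L\supseteq F^2L\supseteq\cdots$ such that $L^k\to\varprojlim_p L^k/F^pL^k$ is bijective for every $k$, and with degree one maps $q_m:L[1]^{\odot m}\to L[1]$, $m\ge1$ (where $L[1]^k=L^{k+1}$ and $\odot$ is the graded symmetric product), such that the coderivation of the reduced symmetric coalgebra $\overline S(L[1])$ with Taylor coefficients $q_m$ squares to zero and $q_m(F^{p_1}L\odot\cdots\odot F^{p_m}L)\subseteq F^{p_1+\cdots+p_m}L$ for all $p_j\ge1$. Its Maurer–Cartan set is $\operatorname{MC}(L)=\{x\in L^1:\sum_{m\ge1}\frac1{m!}q_m(x\odot\cdots\odot x)=0\}$. For $n\ge0$ let $C^*(\Delta_n;L)$ be the non-degenerate simplicial cochains on the $n$-simplex with coefficients in $L$; a cochain $\alpha\in C^p(\Delta_n;L)$ has a value $\alpha_{i_0\cdots i_k}\in L^{p-k}$ on each face $i_0<\cdots<i_k$ of $\Delta_n$. It carries the filtration $F^pC^*(\Delta_n;L)=C^*(\Delta_n;F^pL)$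 and the complete $L_\infty$ structure induced, by homotopy transfer along Dupont's contraction (inclusion of cochains by Whitney's elementary forms, integration of forms over faces, and Dupont's homotopy), from the $L_\infty$ structure on the polynomial differential forms on $\Delta_n$ with coefficients in $L$ which is obtained by extension of scalars. The $n$-simplices of the Deligne–Getzler $\infty$-groupoid of $L$ are the Maurer–Cartan cochains, $\operatorname{Del}_\infty(L)_n=\operatorname{MC}(C^*(\Delta_n;L))$. For $0\le i\le n$ let $e_i:\Delta_0\to\Delta_n$ be the inclusion of the $i$-th vertex, so that $e_i^*\alpha=\alpha_i$, let $\partial_i:\Delta_{n-1}\to\Delta_n$ be the inclusion of the face opposite to it ($\Delta_{-1}=\emptyset$, $C^0(\emptyset;L)=0$), and let $h^i:C^*(\Delta_n;L)\to C^{*-1}(\Delta_n;L)$ be given by $h^i(\alpha)_{i_0\cdots i_k}=0$ if $i\in\{i_0,\dots,i_k\}$ and by $h^i(\alpha)_{i_0\cdots i_k}=(-1)^j\alpha_{i_0\cdots i_{j-1}\,i\,i_j\cdots i_k}$ if $i_0<\cdots<i_{j-1}<i<i_j<\cdots<i_k$. **Proposition.** For every complete $L_\infty$ algebra $L$, every $n\ge0$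 and every $0\le i\le n$, the map $$\rho^i:\operatorname{Del}_\infty(L)_n\longrightarrow\operatorname{MC}(L)\times C^0(\Delta_{n-1};L),\qquad \alpha\longmapsto(e_i^*\alpha,\ \partial_i^*h^i\alpha),$$ is well defined and bijective. Equivalently, a Maurer–Cartan cochain is uniquely determined by its values on the open star of the vertex $i$, and these can be prescribed freely: given $a_i\in\operatorname{MC}(L)$ and $a_\sigma\in L^{1-\dim\sigma}$ for every face $\sigma$ of $\Delta_n$ of positive dimension which contains the vertex $i$, there is exactly one $\alpha\in\operatorname{Del}_\infty(L)_n$ with $\alpha_\sigma=a_\sigma$ for all faces $\sigma$ containing $i$. -/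

import Mathlib

open scoped TensorProduct

namespace DelGetzler

noncomputable section

/-! ### Koszul signs and graded-symmetric operations -/

/-- The Koszul sign of the reordering of a word `v₀ ⊙ ⋯ ⊙ vₙ₋₁` of homogeneous elements of degrees
`d 0, …, d (n-1)` which sorts the letters by the key `c`, keeping the order of letters with the
same key: each pair of letters which is interchanged contributes `(-1) ^ (d a * d b)`. -/
def koszulSign {n : ℕ} (d : Fin n → ℤ) (c : Fin n → ℕ) : ℤˣ :=
  ∏ a, ∏ b, if a < b ∧ c b < c a then (d a * d b).negOnePow else 1

/-- The increasing enumeration of a finite set of letters. -/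
def sub {n : ℕ} (S : Finset (Fin n)) : Fin S.card → Fin n := S.orderEmbOfFin rfl

/-- The letters with key `j`. -/
def block {n k : ℕ} (c : Fin n → Fin k) (j : Fin k) : Finset (Fin n) :=
  Finset.univ.filter fun a => c a = j

/-- Families of operations `(v₁, …, vₙ) ↦ qₙ(v₁ ⊙ ⋯ ⊙ vₙ)` on homogeneous elements: `q n d v` is
the value on letters `v a` which have degree `d a` in the shifted space `V[1]`. -/
abbrev Ops (V : Type*) := (n : ℕ) → (Fin n → ℤ) → (Fin n → V) → V

/-! ### Complete `L_∞` algebras -/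

/-- Convergence of the series `∑ a i` to `s` in the topology of the filtration `fil`. -/
def HasFilSum {𝕜 V : Type*} [Field 𝕜] [AddCommGroup V] [Module 𝕜 V]
    (fil : ℕ → Submodule 𝕜 V) (a : ℕ → V) (s : V) : Prop :=
  ∀ p, ∃ N, ∀ m, N ≤ m → (∑ i ∈ Finset.range m, a i) - s ∈ fil p

/-- A complete `L_∞` algebra `V = ⨁ₖ Vᵏ` over `𝕜`. The degree `d` part of the shifted space
`V[1]` is `V^{d+1} = gr (d + 1)`. The filtration is indexed by `p ≥ 1`, and
`V = F¹V ⊇ F²V ⊇ ⋯` (so `fil 0` is the whole space too). -/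
structure CompleteLInftyAlgebra (𝕜 V : Type*) [Field 𝕜] [AddCommGroup V] [Module 𝕜 V] where
  /-- the homogeneous components `Vᵏ` -/
  gr : ℤ → Submodule 𝕜 V
  gr_internal : DirectSum.IsInternal gr
  /-- the filtration `FᵖV` -/
  fil : ℕ → Submodule 𝕜 V
  fil_one : fil 1 = ⊤
  fil_antitone : Antitone fil
  /-- each `FᵖV` is a graded subspace -/
  fil_graded : ∀ p, fil p ≤ ⨆ k, gr k ⊓ fil p
  /-- in each degree `Vᵏ → lim Vᵏ / FᵖVᵏ` is bijective -/
  complete : ∀ (k : ℤ) (x : ℕ → V), (∀ p, x p ∈ gr k) → (∀ p, x (p + 1) - x p ∈ fil p) →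
    ∃! y, y ∈ gr k ∧ ∀ p, y - x p ∈ fil p
  /-- the Taylor coefficients `qₙ`, `n ≥ 1`, extended multilinearly from homogeneous elements -/
  q : (n : ℕ) → MultilinearMap 𝕜 (fun _ : Fin n => V) V
  q_zero : q 0 = 0
  /-- `qₙ` has degree one on `V[1]` -/
  q_degree : ∀ (n : ℕ) (d : Fin n → ℤ) (v : Fin n → V), (∀ a, v a ∈ gr (d a + 1)) →
    q n v ∈ gr ((∑ a, d a) + 1 + 1)
  /-- `qₙ` is graded symmetric on `V[1]` -/
  q_symm : ∀ (n : ℕ) (d : Fin n → ℤ) (v : Fin n → V), (∀ a, v a ∈ gr (d a + 1)) →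
    ∀ σ : Equiv.Perm (Fin n),
      q n v = koszulSign d (fun a => (σ.symm a : ℕ)) • q n (fun a => v (σ a))
  /-- the coderivation with Taylor coefficients `qₙ` squares to zero; `S` is the set of letters
  which an unshuffle puts in front -/
  q_square : ∀ (n : ℕ) (d : Fin n → ℤ) (v : Fin n → V), (∀ a, v a ∈ gr (d a + 1)) →
    ∑ S : Finset (Fin n) with S.Nonempty,
      koszulSign d (fun a => if a ∈ S then 0 else 1) •
        q (Sᶜ.card + 1)
          (Fin.cons (q S.card (fun a => v (sub S a))) (fun a => v (sub Sᶜ a)) :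
            Fin (Sᶜ.card + 1) → V) = 0
  /-- the Taylor coefficients are continuous -/
  q_continuous : ∀ (n : ℕ) (p : Fin n → ℕ) (v : Fin n → V), 1 ≤ n → (∀ a, 1 ≤ p a) →
    (∀ a, v a ∈ fil (p a)) → q n v ∈ fil (∑ a, p a)

/-- The Maurer-Cartan set: the elements `x` of degree one, hence of degree zero in the shifted
space, such that `∑_{i ≥ 1} (1 / i!) qᵢ(x ⊙ ⋯ ⊙ x)` converges to zero. -/
def maurerCartan {𝕜 V : Type*} [Field 𝕜] [AddCommGroup V] [Module 𝕜 V]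
    (gr : ℤ → Submodule 𝕜 V) (fil : ℕ → Submodule 𝕜 V) (q : Ops V) : Set V :=
  {x | x ∈ gr 1 ∧
    HasFilSum fil (fun i => ((i + 1).factorial : 𝕜)⁻¹ • q (i + 1) (fun _ => 0) (fun _ => x)) 0}

/-- `MC(L)`. -/
def CompleteLInftyAlgebra.MC {𝕜 V : Type*} [Field 𝕜] [AddCommGroup V] [Module 𝕜 V]
    (L : CompleteLInftyAlgebra 𝕜 V) : Set V :=
  maurerCartan L.gr L.fil (fun n _ v => L.q n v)

/-! ### Homotopy transfer -/

lemma card_block_lt {n k : ℕ} (c : {c : Fin n → Fin (k + 2) // Function.Surjective c})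
    (j : Fin (k + 2)) : (block c.1 j).card < n := by
  obtain ⟨j', hj'⟩ := exists_ne j
  obtain ⟨a, ha⟩ := c.2 j'
  have h : (block c.1 j) ⊂ Finset.univ :=
    (Finset.ssubset_univ_iff).2 fun h => by
      have : a ∈ block c.1 j := h ▸ Finset.mem_univ a
      simp only [block, Finset.mem_filter] at this
      exact hj' (ha ▸ this.2)
  simpa using Finset.card_lt_card h

section Transfer

variable {𝕜 W V : Type*} [Field 𝕜] [AddCommGroup W] [Module 𝕜 W] [AddCommGroup V] [Module 𝕜 V]

/-- The Taylor coefficients `fₙ : W[1]^{⊙ n} → V[1]` of the morphism from the transferred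
structure: `f₁` is given and, for `n ≥ 2`, `fₙ = ∑_{k=2}^n K qₖ Fᵏₙ`, where
`Fᵏₙ(w₁ ⊙ ⋯ ⊙ wₙ) = (1 / k!) ∑ ± f_{i₁}(⋯) ⊙ ⋯ ⊙ f_{iₖ}(⋯)` is the sum over all
`(i₁, …, iₖ)`-unshuffles with `i₁ + ⋯ + iₖ = n` and all `iⱼ ≥ 1`. Such an unshuffle is the
same thing as a surjection `c` from the letters onto the `k` factors. -/
def transferMor (f₁ : W →ₗ[𝕜] V) (K : V →ₗ[𝕜] V) (q : Ops V) :
    (n : ℕ) → (Fin n → ℤ) → (Fin n → W) → V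
  | 0, _, _ => 0
  | 1, _, w => f₁ (w 0)
  | n + 2, d, w =>
    ∑ k ∈ Finset.range (n + 1), ((k + 2).factorial : 𝕜)⁻¹ •
      ∑ c : {c : Fin (n + 2) → Fin (k + 2) // Function.Surjective c},
        koszulSign d (fun a => (c.1 a : ℕ)) •
          K (q (k + 2) (fun j => ∑ a ∈ block c.1 j, d a)
            (fun j => transferMor f₁ K q (block c.1 j).card
              (fun a => d (sub (block c.1 j) a)) (fun a => w (sub (block c.1 j) a))))
termination_by n => n
decreasing_by exact card_block_lt c j

/-- The transferred Taylor coefficients `rₙ : W[1]^{⊙ n} → W[1]`: the linear part `r₁` is the given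
differential of `W[1]` and `rₙ = ∑_{k=2}^n g₁ qₖ Fᵏₙ` for `n ≥ 2`. -/
def transferOps (f₁ : W →ₗ[𝕜] V) (g₁ : V →ₗ[𝕜] W) (K : V →ₗ[𝕜] V) (r₁ : W →ₗ[𝕜] W)
    (q : Ops V) : Ops W
  | 0, _, _ => 0
  | 1, _, w => r₁ (w 0)
  | n + 2, d, w =>
    ∑ k ∈ Finset.range (n + 1), ((k + 2).factorial : 𝕜)⁻¹ •
      ∑ c : {c : Fin (n + 2) → Fin (k + 2) // Function.Surjective c},
        koszulSign d (fun a => (c.1 a : ℕ)) •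
          g₁ (q (k + 2) (fun j => ∑ a ∈ block c.1 j, d a)
            (fun j => transferMor f₁ K q (block c.1 j).card
              (fun a => d (sub (block c.1 j) a)) (fun a => w (sub (block c.1 j) a))))

end Transfer

/-! ### Polynomial differential forms on the simplex -/

section Forms

variable (𝕜 : Type*) [Field 𝕜] (n : ℕ)

/-- Polynomial differential forms on `Δₙ`, in the affine coordinates `t₁, …, tₙ` (so
`t₀ = 1 - t₁ - ⋯ - tₙ` and `dt₀ = - dt₁ - ⋯ - dtₙ`): `𝕜[t₁, …, tₙ] ⊗ Λ(dt₁, …, dtₙ)`. The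
coordinate `t_{j+1}` has the index `j : Fin n`. -/
def PolyForm := MvPolynomial (Fin n) 𝕜 ⊗[𝕜] ExteriorAlgebra 𝕜 (Fin n → 𝕜)

instance : Ring (PolyForm 𝕜 n) :=
  inferInstanceAs (Ring (MvPolynomial (Fin n) 𝕜 ⊗[𝕜] ExteriorAlgebra 𝕜 (Fin n → 𝕜)))

instance : Algebra 𝕜 (PolyForm 𝕜 n) :=
  inferInstanceAs (Algebra 𝕜 (MvPolynomial (Fin n) 𝕜 ⊗[𝕜] ExteriorAlgebra 𝕜 (Fin n → 𝕜)))

variable {𝕜 n} in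
/-- The form `p w`, for a polynomial `p` and a form `w` with constant coefficients. -/
def PolyForm.mk (p : MvPolynomial (Fin n) 𝕜) (w : ExteriorAlgebra 𝕜 (Fin n → 𝕜)) :
    PolyForm 𝕜 n := p ⊗ₜ[𝕜] w

variable {𝕜 n} in
/-- The linear map `p w ↦ f(p) g(w)`. -/
def PolyForm.map {k : ℕ} (f : MvPolynomial (Fin n) 𝕜 →ₗ[𝕜] MvPolynomial (Fin k) 𝕜)
    (g : ExteriorAlgebra 𝕜 (Fin n → 𝕜) →ₗ[𝕜] ExteriorAlgebra 𝕜 (Fin k → 𝕜)) :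
    PolyForm 𝕜 n →ₗ[𝕜] PolyForm 𝕜 k := TensorProduct.map f g

variable {𝕜 n} in
/-- The linear functional `p w ↦ f(p) g(w)`. -/
def PolyForm.functional (f : MvPolynomial (Fin n) 𝕜 →ₗ[𝕜] 𝕜)
    (g : ExteriorAlgebra 𝕜 (Fin n → 𝕜) →ₗ[𝕜] 𝕜) : PolyForm 𝕜 n →ₗ[𝕜] 𝕜 :=
  LinearMap.mul' 𝕜 𝕜 ∘ₗ TensorProduct.map f g

/-- The exterior differential `p ⊗ w ↦ ∑ⱼ ∂ⱼ p ⊗ (dtⱼ ∧ w)`. -/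
def extDeriv : PolyForm 𝕜 n →ₗ[𝕜] PolyForm 𝕜 n :=
  ∑ j : Fin n, PolyForm.map (MvPolynomial.pderiv j).toLinearMap
    (LinearMap.mulLeft 𝕜 (ExteriorAlgebra.ι 𝕜 (Pi.single j 1)))

/-- The projection of `Λ(dt₁, …, dtₙ)` onto its part of degree `k`. -/
def extProj (k : ℕ) :
    ExteriorAlgebra 𝕜 (Fin n → 𝕜) →ₗ[𝕜] ExteriorAlgebra 𝕜 (Fin n → 𝕜) :=
  GradedAlgebra.proj (fun i : ℕ => ⋀[𝕜]^i (Fin n → 𝕜)) k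

/-- The projection of the forms onto the `k`-forms. -/
def formProj (k : ℕ) : PolyForm 𝕜 n →ₗ[𝕜] PolyForm 𝕜 n :=
  PolyForm.map LinearMap.id (extProj 𝕜 n k)

variable {n}

/-- The barycentric coordinates `t₀, …, tₙ`. -/
def bary : Fin (n + 1) → MvPolynomial (Fin n) 𝕜 :=
  Fin.cons (1 - ∑ j, MvPolynomial.X j) MvPolynomial.X

/-- The differentials `dt₀, …, dtₙ`, as combinations of `dt₁, …, dtₙ`. -/
def dbary : Fin (n + 1) → (Fin n → 𝕜) :=
  Fin.cons (fun _ => -1) (fun j => Pi.single j 1)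

/-- The affine coordinates of the `i`-th vertex. -/
def vertex (i : Fin (n + 1)) : Fin n → 𝕜 := fun j => if i = j.succ then 1 else 0

/-- The nonempty faces of the simplex with vertex set `Fin m`, which is `Δ_{m-1}`. -/
abbrev Face (m : ℕ) := {σ : Finset (Fin m) // σ.Nonempty}

/-- Whitney's elementary form of the face with vertices `i₀ < ⋯ < iₖ`:
`k! ∑ⱼ (-1)ʲ t_{iⱼ} dt_{i₀} ∧ ⋯ (omit dt_{iⱼ}) ⋯ ∧ dt_{iₖ}`. -/
def whitney (σ : Face (n + 1)) : PolyForm 𝕜 n :=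
  ((σ.1.card - 1).factorial : 𝕜) • ∑ a ∈ σ.1,
    (-1 : 𝕜) ^ (σ.1.filter (· < a)).card •
      PolyForm.mk (bary 𝕜 a)
        (((σ.1.erase a).sort (· ≤ ·)).map fun b => ExteriorAlgebra.ι 𝕜 (dbary 𝕜 b)).prod

/-- Pull-back of forms along the affine map `Δₖ → Δₙ` which is `v` on vertices:
`t_j ↦ ∑_{v a = j} t_a`, `dt_j ↦ ∑_{v a = j} dt_a`. -/
def pullback {k : ℕ} (v : Fin (k + 1) → Fin (n + 1)) : PolyForm 𝕜 n →ₗ[𝕜] PolyForm 𝕜 k :=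
  PolyForm.map
    (MvPolynomial.aeval (R := 𝕜) fun j : Fin n =>
      ∑ a : Fin (k + 1) with v a = j.succ, bary 𝕜 a).toLinearMap
    (ExteriorAlgebra.map (Fintype.linearCombination 𝕜 fun j : Fin n =>
      ∑ a : Fin (k + 1) with v a = j.succ, dbary 𝕜 a)).toLinearMap

/-- Integration over `Δₖ`: `∫ t₁^{a₁} ⋯ tₖ^{aₖ} dt₁ ⋯ dtₖ = a₁! ⋯ aₖ! / (a₁ + ⋯ + aₖ + k)!`, and
forms of degree less than `k` have integral zero. -/
def simplexIntegral (k : ℕ) : PolyForm 𝕜 k →ₗ[𝕜] 𝕜 :=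
  PolyForm.functional
    ((MvPolynomial.basisMonomials (Fin k) 𝕜).constr 𝕜 fun a : Fin k →₀ ℕ =>
      (∏ j, ((a j).factorial : 𝕜)) * (((∑ j, a j) + k).factorial : 𝕜)⁻¹)
    (ExteriorAlgebra.liftAlternating (R := 𝕜) (M := Fin k → 𝕜) (N := 𝕜)
      (Pi.single k Matrix.detRowAlternating))

/-- Integration of forms on `Δₙ` over a face. -/
def faceIntegral (σ : Face (n + 1)) : PolyForm 𝕜 n →ₗ[𝕜] 𝕜 :=
  simplexIntegral 𝕜 (σ.1.card - 1) ∘ₗ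
    pullback 𝕜 (σ.1.orderEmbOfFin (k := σ.1.card - 1 + 1)
      (Nat.sub_add_cancel σ.2.card_pos).symm)

/-- Substitution of `u t + (1 - u) eᵢ` in a polynomial, with `u` the variable of `Polynomial`. -/
def dilation (i : Fin (n + 1)) :
    MvPolynomial (Fin n) 𝕜 →ₐ[𝕜] Polynomial (MvPolynomial (Fin n) 𝕜) :=
  MvPolynomial.aeval fun j =>
    Polynomial.X * Polynomial.C (MvPolynomial.X j) +
      (1 - Polynomial.X) * Polynomial.C (MvPolynomial.C (vertex 𝕜 i j))

/-- `∫₀¹ (-) du`. -/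
def unitIntegral {A : Type*} [CommRing A] [Algebra 𝕜 A] : Polynomial A →ₗ[𝕜] A :=
  Polynomial.lsum fun m => ((m + 1 : ℕ) : 𝕜)⁻¹ • (LinearMap.id : A →ₗ[𝕜] A)

/-- The homotopy `hⁱ` on forms: pull-back along the dilation
`[0, 1] × Δₙ → Δₙ, (u, t) ↦ u t + (1 - u) eᵢ`, followed by integration over `u ∈ [0, 1]`. On a
`(k+1)`-form `p w` the `du`-part of the pull-back is
`du ∧ ∑ⱼ uᵏ p(u t + (1 - u) eᵢ) (tⱼ - (eᵢ)ⱼ) ⬝ ι_{∂ⱼ} w`. -/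
def coneHomotopy (i : Fin (n + 1)) : PolyForm 𝕜 n →ₗ[𝕜] PolyForm 𝕜 n :=
  ∑ k ∈ Finset.range n, ∑ j : Fin n, PolyForm.map
    (LinearMap.mulLeft 𝕜 (MvPolynomial.X j - MvPolynomial.C (vertex 𝕜 i j)) ∘ₗ
      unitIntegral 𝕜 ∘ₗ LinearMap.mulLeft 𝕜 (Polynomial.X ^ k) ∘ₗ (dilation 𝕜 i).toLinearMap)
    (CliffordAlgebra.contractLeft (Q := (0 : QuadraticForm 𝕜 (Fin n → 𝕜)))
      (LinearMap.proj j : Module.Dual 𝕜 (Fin n → 𝕜)) ∘ₗ extProj 𝕜 n (k + 1))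

variable (n) in
/-- Dupont's homotopy `∑ₖ (-1)ᵏ ∑_{i₀ < ⋯ < iₖ} ω_{i₀⋯iₖ} ∧ h^{iₖ} ⋯ h^{i₀}` (so `h^{i₀}` is applied
first). With the present orientation of `hⁱ`, for which `d hⁱ + hⁱ d` is the identity minus
evaluation at the `i`-th vertex, the signs `(-1)ᵏ` make `d s + s d` the identity minus the
projection onto Whitney forms. The term of the top face is zero for degree reasons. -/
def dupont : PolyForm 𝕜 n →ₗ[𝕜] PolyForm 𝕜 n :=
  ∑ σ : Face (n + 1), (-1 : 𝕜) ^ (σ.1.card - 1) • (LinearMap.mulLeft 𝕜 (whitney 𝕜 σ) ∘ₗ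
    ((σ.1.sort (· ≤ ·)).reverse.map fun i =>
      (coneHomotopy 𝕜 i : Module.End 𝕜 (PolyForm 𝕜 n))).prod)

end Forms

/-! ### Forms and cochains with coefficients -/

section Coefficients

variable {𝕜 V : Type*} [Field 𝕜] [AddCommGroup V] [Module 𝕜 V]

/-- The linear functional on the tensor algebra which is `q` on words of length `k`. -/
def onWords {k : ℕ} (q : MultilinearMap 𝕜 (fun _ : Fin k => V) V) : TensorAlgebra 𝕜 V →ₗ[𝕜] V :=
  PiTensorProduct.lift q ∘ₗ DirectSum.component 𝕜 ℕ (fun k => ⨂[𝕜]^k V) k ∘ₗ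
    (TensorAlgebra.equivDirectSum (R := 𝕜) (M := V)).toLinearMap

/-- The extension of scalars without signs:
`(ω₁ ⊗ v₁, …, ωₖ ⊗ vₖ) ↦ (ω₁ ∧ ⋯ ∧ ωₖ) ⊗ q(v₁, …, vₖ)`. -/
def extendScalars (n : ℕ) {k : ℕ} (q : MultilinearMap 𝕜 (fun _ : Fin k => V) V) :
    MultilinearMap 𝕜 (fun _ : Fin k => PolyForm 𝕜 n ⊗[𝕜] V) (PolyForm 𝕜 n ⊗[𝕜] V) :=
  ((onWords q).lTensor (PolyForm 𝕜 n)).compMultilinearMap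
    ((MultilinearMap.mkPiAlgebraFin 𝕜 k (PolyForm 𝕜 n ⊗[𝕜] TensorAlgebra 𝕜 V)).compLinearMap
      fun _ => (TensorAlgebra.ι 𝕜).lTensor (PolyForm 𝕜 n))

namespace CompleteLInftyAlgebra

variable (L : CompleteLInftyAlgebra 𝕜 V) (n : ℕ)

/-- The `L_∞` structure on the forms `Ω(Δₙ; L)` by extension of scalars. The letter `x a` has degree
`d a` in the shifted space, so its component of form degree `e a` has coefficients of shifted degree
`d a - e a`, and the Koszul rule for moving `q_k` and the coefficients past the forms gives the
sign. The linear part is minus the total differential, hence contains `- d` on forms. -/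
def formOps : Ops (PolyForm 𝕜 n ⊗[𝕜] V) := fun k d x =>
  (∑ e : Fin k → Fin (n + 1),
    ((∑ a, (e a : ℤ)) +
      ∑ a, ∑ b, if a < b then (d a - (e a : ℤ)) * (e b : ℤ) else 0).negOnePow •
      extendScalars n (L.q k) (fun a => (formProj 𝕜 n (e a)).rTensor V (x a))) -
  (if h : k = 1 then (extDeriv 𝕜 n).rTensor V (x ⟨0, h ▸ Nat.one_pos⟩) else 0)

end CompleteLInftyAlgebra

/-- Inclusion of cochains by Whitney's elementary forms. -/
def whitneyMap (n : ℕ) : (Face (n + 1) → V) →ₗ[𝕜] PolyForm 𝕜 n ⊗[𝕜] V :=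
  ∑ σ : Face (n + 1), TensorProduct.mk 𝕜 (PolyForm 𝕜 n) V (whitney 𝕜 σ) ∘ₗ LinearMap.proj σ

/-- Integration of forms over faces. -/
def integrationMap (n : ℕ) : PolyForm 𝕜 n ⊗[𝕜] V →ₗ[𝕜] (Face (n + 1) → V) :=
  LinearMap.pi fun σ => (TensorProduct.lid 𝕜 V).toLinearMap ∘ₗ (faceIntegral 𝕜 σ).rTensor V

/-- The face opposite to the vertex `a` of `σ`. -/
def Face.opp {m : ℕ} (σ : Face m) (a : Fin m) (h : (σ.1.erase a).Nonempty) : Face m :=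
  ⟨σ.1.erase a, h⟩

namespace CompleteLInftyAlgebra

variable (L : CompleteLInftyAlgebra 𝕜 V)

/-- The nondegenerate cochains of degree `p` on the simplex with vertices `Fin m`, with coefficients
in `L`: the value on a `k`-dimensional face lies in `L^{p-k}`. -/
def cochains (m : ℕ) (p : ℤ) : Submodule 𝕜 (Face m → V) :=
  Submodule.pi Set.univ fun σ => L.gr (p - ((σ.1.card : ℤ) - 1))

/-- The filtration `FᵖC(Δ; L) = C(Δ; FᵖL)`. -/
def cochainFil (m : ℕ) (p : ℕ) : Submodule 𝕜 (Face m → V) :=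
  Submodule.pi Set.univ fun _ => L.fil p

/-- The linear part of the structure on cochains: minus the total differential, that is
`β ↦ - δβ ± q₁ β`, with `δ` the simplicial coboundary and the sign `(-1)ᵏ` on `k`-dimensional
faces. -/
def cochainDiff (m : ℕ) : (Face m → V) →ₗ[𝕜] (Face m → V) :=
  LinearMap.pi fun σ =>
    (-1 : 𝕜) ^ (σ.1.card - 1) •
      ((L.q 1).toLinearMap (fun _ => 0) 0 ∘ₗ LinearMap.proj σ) -
    ∑ a ∈ σ.1, (-1 : 𝕜) ^ (σ.1.filter (· < a)).card •
      (if h : (σ.1.erase a).Nonempty then LinearMap.proj (σ.opp a h) else 0)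

/-- The `L_∞` structure on `C(Δₙ; L)` obtained by homotopy transfer from `Ω(Δₙ; L)` along Dupont's
contraction. -/
def cochainOps (n : ℕ) : Ops (Face (n + 1) → V) :=
  transferOps (whitneyMap n) (integrationMap n) ((dupont 𝕜 n).rTensor V)
    (L.cochainDiff (n + 1)) (L.formOps n)

/-- The `n`-simplices of the Deligne-Getzler groupoid `Del_∞(L)`: the Maurer-Cartan cochains
on `Δₙ`. -/
def Del (n : ℕ) : Set (Face (n + 1) → V) :=
  maurerCartan (L.cochains (n + 1)) (L.cochainFil (n + 1)) (L.cochainOps n)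

end CompleteLInftyAlgebra

/-- The vertex `i` as a face. -/
def vertexFace {m : ℕ} (i : Fin m) : Face m := ⟨{i}, Finset.singleton_nonempty i⟩

/-- The pull-back along the inclusion of the `i`-th vertex, `C(Δₙ; L) → C(Δ₀; L) = L`. -/
def evalVertex {m : ℕ} (i : Fin m) (β : Face m → V) : V := β (vertexFace i)

/-- The pull-back along the inclusion `Δ_{n-1} → Δₙ` of the face opposite to the vertex `i`. -/
def faceRestrict {n : ℕ} (i : Fin (n + 1)) (β : Face (n + 1) → V) : Face n → V := fun τ =>
  β ⟨τ.1.map i.succAboveEmb, τ.2.map⟩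

/-- The homotopy `hⁱ` on cochains: zero on faces containing `i`, and otherwise
`(-1)ʲ` times the value on the face with `i` inserted, where `j` is the position of `i`. -/
def cochainHomotopy {m : ℕ} (i : Fin m) (β : Face m → V) : Face m → V := fun σ =>
  if i ∈ σ.1 then 0
  else (-1 : ℤ) ^ (σ.1.filter (· < i)).card • β ⟨insert i σ.1, Finset.insert_nonempty i σ.1⟩

end Coefficients

end

end DelGetzler

/-!
Maurer-Cartan cochains are found as fixed points of an iteration built from `hⁱ`. On cochains
`r₁ hⁱ + hⁱ r₁ = εᵢ - 1`, where `εᵢ` evaluates at the vertex `i` (`cochainDiff_cochainHomotopy`).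
Write `R(α) = ∑ rₘ(α, …, α) / m!` for the curvature of a cochain `α` of degree one. The map
`α ↦ α + hⁱ R(α)` does not change the values of `α` on the open star of `i`, and it is a
contraction for the filtration on the cochains with given values there: the linear part cancels on
differences, since `hⁱ r₁ δ = - δ` if `δ` vanishes on the star (`cochainHomotopy_cochainDiff`), and
the nonlinear terms raise the filtration (`cochainCurv_sub_mem`). By completeness there is exactly
one `α` with the given values and `hⁱ R(α) = 0`. This gives uniqueness, and existence once
`hⁱ R(α) = 0` and `R(α)ᵢ = 0` imply `R(α) = 0` (`cochainCurv_mem`).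

The last implication is a Bianchi argument, which is carried out on forms. Let `f`, `g`, `K` be the
maps of Dupont's contraction and `D` the differential of `Ω(Δₙ; L)`, with
`D K + K D = f g - 1` (`formDiff_dupont`), `f r₁ = D f` (`whitneyMap_cochainDiff`) and `g D = r₁ g`
(`integrationMap_formDiff`). The form `x = ∑ fₘ(α, …, α) / m!` satisfies `x = f α + K Q(x)` and
`R(α) = r₁ α + g Q(x)`, where `Q` is the nonlinear part of the curvature of forms (`morSum_eq`,
`cochainCurv_eq`). The curvature `ρ = D x + Q(x)` satisfies the Bianchi identity `D ρ + B(ρ) = 0`,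
where `B` is linear and raises the filtration (`bianchi`). It follows that `ρ = f R(α) + K B(ρ)`
and `r₁ R(α) = - g B(ρ)`. If `hⁱ R(α) = 0` and `R(α)ᵢ = 0`, then `R(α) = - hⁱ r₁ R(α) = hⁱ g B(ρ)`;
hence if `ρ` lies in the `p`-th step of the filtration, then so do `B(ρ)`, `R(α)` and `ρ` with
`p + 1`, and `R(α) = 0`. Moreover `R(α)ᵢ` is the curvature of `αᵢ` in `L`
(`cochainCurv_vertexFace`), because Dupont's homotopy has values in the forms which vanish at the
vertices.

Since `Ω(Δₙ; L)` is not completed, all this is done for partial sums, modulo a step of the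
filtration which grows with the number of terms.

The facts on Dupont's contraction are proved from the homotopy formula `d hⁱ + hⁱ d = 1 - εᵢ` on
forms (`extDeriv_coneHomotopy`) alone: integration over the face `i₀ < ⋯ < iₖ` is
evaluation at `iₖ` after `h^{i₀}, …, h^{iₖ₋₁}` (`faceIntegral_eq_iterEval`), which makes Stokes'
theorem and Dupont's formula formal consequences.
-/

open scoped TensorProduct

namespace DelGetzler

noncomputable section

/-! ### The algebra of polynomial forms -/

section Exterior

variable {𝕜 : Type*} [Field 𝕜] {n : ℕ}

lemma extPower_induction {k : ℕ} {P : ExteriorAlgebra 𝕜 (Fin n → 𝕜) → Prop}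
    (hι : ∀ v : Fin k → Fin n → 𝕜, P (ExteriorAlgebra.ιMulti 𝕜 k v)) (h0 : P 0)
    (hadd : ∀ x y, P x → P y → P (x + y)) (hsmul : ∀ (c : 𝕜) x, P x → P (c • x))
    {w : ExteriorAlgebra 𝕜 (Fin n → 𝕜)} (hw : w ∈ ⋀[𝕜]^k (Fin n → 𝕜)) : P w := by
  rw [← ExteriorAlgebra.ιMulti_span_fixedDegree] at hw
  induction hw using Submodule.span_induction with
  | mem x hx => obtain ⟨v, rfl⟩ := hx; exact hι v
  | zero => exact h0
  | add x y _ _ hx hy => exact hadd x y hx hy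
  | smul c x _ hx => exact hsmul c x hx

lemma ιMulti_mem (k : ℕ) (v : Fin k → Fin n → 𝕜) :
    ExteriorAlgebra.ιMulti 𝕜 k v ∈ ⋀[𝕜]^k (Fin n → 𝕜) := by
  rw [← ExteriorAlgebra.ιMulti_span_fixedDegree]
  exact Submodule.subset_span ⟨v, rfl⟩

lemma extPower_mul {j k : ℕ} {w w' : ExteriorAlgebra 𝕜 (Fin n → 𝕜)}
    (hw : w ∈ ⋀[𝕜]^j (Fin n → 𝕜)) (hw' : w' ∈ ⋀[𝕜]^k (Fin n → 𝕜)) :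
    w * w' ∈ ⋀[𝕜]^(j + k) (Fin n → 𝕜) :=
  SetLike.mul_mem_graded hw hw'

lemma ι_mem_extPower (v : Fin n → 𝕜) : ExteriorAlgebra.ι 𝕜 v ∈ ⋀[𝕜]^1 (Fin n → 𝕜) := by
  rw [ExteriorAlgebra.exteriorPower, pow_one]; exact LinearMap.mem_range_self _ _

lemma one_mem_extPower : (1 : ExteriorAlgebra 𝕜 (Fin n → 𝕜)) ∈ ⋀[𝕜]^0 (Fin n → 𝕜) :=
  SetLike.GradedOne.one_mem

lemma ι_mul_mem {k : ℕ} (v : Fin n → 𝕜) {w : ExteriorAlgebra 𝕜 (Fin n → 𝕜)}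
    (hw : w ∈ ⋀[𝕜]^k (Fin n → 𝕜)) : ExteriorAlgebra.ι 𝕜 v * w ∈ ⋀[𝕜]^(k + 1) (Fin n → 𝕜) := by
  rw [add_comm]; exact extPower_mul (ι_mem_extPower v) hw

lemma extPower_eq_zero {k : ℕ} (hk : n < k) {w : ExteriorAlgebra 𝕜 (Fin n → 𝕜)}
    (hw : w ∈ ⋀[𝕜]^k (Fin n → 𝕜)) : w = 0 := by
  have h0 : (0 : ExteriorAlgebra 𝕜 (Fin n → 𝕜)) = 0 := rfl
  refine extPower_induction (P := fun w => w = 0) (fun v => ?_) h0 ?_ ?_ hw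
  · refine AlternatingMap.map_linearDependent _ v fun h => ?_
    have := h.fintype_card_le_finrank
    simp at this; omega
  · rintro x y rfl rfl; simp
  · rintro c x rfl; simp

lemma mem_extPower_zero {w : ExteriorAlgebra 𝕜 (Fin n → 𝕜)} (hw : w ∈ ⋀[𝕜]^0 (Fin n → 𝕜)) :
    ∃ c : 𝕜, w = c • 1 := by
  rw [ExteriorAlgebra.exteriorPower, pow_zero] at hw
  obtain ⟨c, hc⟩ := Submodule.mem_one.1 hw
  exact ⟨c, by rw [← hc, Algebra.algebraMap_eq_smul_one]⟩

lemma ι_mul_comm_homogeneous {k : ℕ} (v : Fin n → 𝕜) {w : ExteriorAlgebra 𝕜 (Fin n → 𝕜)}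
    (hw : w ∈ ⋀[𝕜]^k (Fin n → 𝕜)) :
    ExteriorAlgebra.ι 𝕜 v * w = (-1 : 𝕜) ^ k • (w * ExteriorAlgebra.ι 𝕜 v) := by
  refine extPower_induction
    (P := fun w => ExteriorAlgebra.ι 𝕜 v * w = (-1 : 𝕜) ^ k • (w * ExteriorAlgebra.ι 𝕜 v))
    (fun u => ?_) (by simp) ?_ ?_ hw
  · clear hw
    induction k with
    | zero => simp
    | succ k ih =>
      rw [ExteriorAlgebra.ιMulti_succ_apply, ← mul_assoc,
        eq_neg_of_add_eq_zero_left (ExteriorAlgebra.ι_add_mul_swap v (u 0)), neg_mul, mul_assoc,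
        ih, pow_succ, mul_smul_comm, mul_assoc]
      simp
  · intro x y hx hy; rw [mul_add, hx, hy, add_mul, smul_add]
  · intro c x hx; rw [mul_smul_comm, hx, smul_mul_assoc, smul_comm]

lemma extPower_mul_comm {j k : ℕ} {w w' : ExteriorAlgebra 𝕜 (Fin n → 𝕜)}
    (hw : w ∈ ⋀[𝕜]^j (Fin n → 𝕜)) (hw' : w' ∈ ⋀[𝕜]^k (Fin n → 𝕜)) :
    w * w' = (-1 : 𝕜) ^ (j * k) • (w' * w) := by
  refine extPower_induction (P := fun w => w * w' = (-1 : 𝕜) ^ (j * k) • (w' * w))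
    (fun u => ?_) (by simp) ?_ ?_ hw
  · clear hw
    induction j with
    | zero => simp
    | succ j ih =>
      rw [ExteriorAlgebra.ιMulti_succ_apply, mul_assoc, ih, mul_smul_comm, ← mul_assoc,
        ι_mul_comm_homogeneous _ hw', smul_mul_assoc, smul_smul, mul_assoc, add_mul, pow_add,
        one_mul]
  · intro x y hx hy; rw [add_mul, hx, hy, mul_add, smul_add]
  · intro c x hx; rw [smul_mul_assoc, hx, mul_smul_comm, smul_comm]

lemma extProj_of_mem {j k : ℕ} {w : ExteriorAlgebra 𝕜 (Fin n → 𝕜)}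
    (hw : w ∈ ⋀[𝕜]^k (Fin n → 𝕜)) : extProj 𝕜 n j w = if j = k then w else 0 := by
  unfold extProj
  rw [GradedAlgebra.proj_apply]
  split_ifs with h
  · subst h; exact DirectSum.decompose_of_mem_same _ hw
  · exact DirectSum.decompose_of_mem_ne _ hw (Ne.symm h)

/-- Contraction with the covector `d` in the exterior algebra. -/
abbrev contract (d : Module.Dual 𝕜 (Fin n → 𝕜)) :
    ExteriorAlgebra 𝕜 (Fin n → 𝕜) →ₗ[𝕜] ExteriorAlgebra 𝕜 (Fin n → 𝕜) :=
  CliffordAlgebra.contractLeft (Q := (0 : QuadraticForm 𝕜 (Fin n → 𝕜))) d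

lemma contract_ι_mul (d : Module.Dual 𝕜 (Fin n → 𝕜)) (v : Fin n → 𝕜)
    (w : ExteriorAlgebra 𝕜 (Fin n → 𝕜)) :
    contract d (ExteriorAlgebra.ι 𝕜 v * w) = d v • w - ExteriorAlgebra.ι 𝕜 v * contract d w :=
  CliffordAlgebra.contractLeft_ι_mul _ v w

lemma contract_one (d : Module.Dual 𝕜 (Fin n → 𝕜)) :
    contract d (1 : ExteriorAlgebra 𝕜 (Fin n → 𝕜)) = 0 :=
  CliffordAlgebra.contractLeft_one _ d

lemma contract_mem {k : ℕ} (d : Module.Dual 𝕜 (Fin n → 𝕜)) {w : ExteriorAlgebra 𝕜 (Fin n → 𝕜)}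
    (hw : w ∈ ⋀[𝕜]^(k + 1) (Fin n → 𝕜)) : contract d w ∈ ⋀[𝕜]^k (Fin n → 𝕜) := by
  refine extPower_induction (P := fun w => contract d w ∈ ⋀[𝕜]^k (Fin n → 𝕜))
    (fun u => ?_) (by simp) ?_ ?_ hw
  · clear hw
    induction k with
    | zero =>
      rw [ExteriorAlgebra.ιMulti_succ_apply, contract_ι_mul, ExteriorAlgebra.ιMulti_zero_apply,
        contract_one, mul_zero, sub_zero]
      exact Submodule.smul_mem _ _ one_mem_extPower
    | succ k ih =>
      rw [ExteriorAlgebra.ιMulti_succ_apply, contract_ι_mul]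
      exact Submodule.sub_mem _ (Submodule.smul_mem _ _ (ιMulti_mem _ _)) (ι_mul_mem _ (ih _))
  · intro x y hx hy; rw [map_add]; exact Submodule.add_mem _ hx hy
  · intro c x hx; rw [map_smul]; exact Submodule.smul_mem _ _ hx

lemma contract_eq_zero (d : Module.Dual 𝕜 (Fin n → 𝕜)) {w : ExteriorAlgebra 𝕜 (Fin n → 𝕜)}
    (hw : w ∈ ⋀[𝕜]^0 (Fin n → 𝕜)) : contract d w = 0 := by
  obtain ⟨c, rfl⟩ := mem_extPower_zero hw
  rw [map_smul, contract_one, smul_zero]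

lemma exterior_left_induction {P : ExteriorAlgebra 𝕜 (Fin n → 𝕜) → Prop}
    (h1 : P 1) (hadd : ∀ x y, P x → P y → P (x + y)) (hsmul : ∀ (c : 𝕜) x, P x → P (c • x))
    (hmul : ∀ v w, P w → P (ExteriorAlgebra.ι 𝕜 v * w)) (w) : P w :=
  CliffordAlgebra.left_induction (Q := (0 : QuadraticForm 𝕜 (Fin n → 𝕜)))
    (fun r => by rw [Algebra.algebraMap_eq_smul_one]; exact hsmul _ _ h1) hadd
    (fun w v hw => hmul v w hw) w

/-- Contractions are compatible with the functoriality of the exterior algebra. -/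
lemma contract_map {k : ℕ} (f : (Fin n → 𝕜) →ₗ[𝕜] (Fin k → 𝕜)) (d : Module.Dual 𝕜 (Fin k → 𝕜))
    (w : ExteriorAlgebra 𝕜 (Fin n → 𝕜)) :
    contract d (ExteriorAlgebra.map f w) = ExteriorAlgebra.map f (contract (d ∘ₗ f) w) := by
  induction w using exterior_left_induction with
  | h1 => rw [map_one, contract_one, contract_one, map_zero]
  | hadd x y hx hy => simp only [map_add, hx, hy]
  | hsmul c x hx => simp only [map_smul, hx]
  | hmul v w hw =>
    rw [map_mul, ExteriorAlgebra.map_apply_ι, contract_ι_mul, contract_ι_mul, hw, map_sub,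
      map_mul, map_smul, ExteriorAlgebra.map_apply_ι]
    rfl

lemma map_mem_extPower {k m : ℕ} (f : (Fin n → 𝕜) →ₗ[𝕜] (Fin k → 𝕜))
    {w : ExteriorAlgebra 𝕜 (Fin n → 𝕜)} (hw : w ∈ ⋀[𝕜]^m (Fin n → 𝕜)) :
    ExteriorAlgebra.map f w ∈ ⋀[𝕜]^m (Fin k → 𝕜) := by
  refine extPower_induction (P := fun w => ExteriorAlgebra.map f w ∈ ⋀[𝕜]^m (Fin k → 𝕜))
    (fun u => ?_) (by simp) ?_ ?_ hw
  · rw [ExteriorAlgebra.map_apply_ιMulti]; exact ιMulti_mem _ _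
  · intro x y hx hy; rw [map_add]; exact Submodule.add_mem _ hx hy
  · intro c x hx; rw [map_smul]; exact Submodule.smul_mem _ _ hx

end Exterior

section PolyForms

variable {𝕜 : Type*} [Field 𝕜] {n : ℕ}

namespace PolyForm

lemma map_mk {k : ℕ} (f : MvPolynomial (Fin n) 𝕜 →ₗ[𝕜] MvPolynomial (Fin k) 𝕜)
    (g : ExteriorAlgebra 𝕜 (Fin n → 𝕜) →ₗ[𝕜] ExteriorAlgebra 𝕜 (Fin k → 𝕜))
    (p : MvPolynomial (Fin n) 𝕜) (w : ExteriorAlgebra 𝕜 (Fin n → 𝕜)) :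
    PolyForm.map f g (mk p w) = mk (f p) (g w) := rfl

lemma mk_mul_mk (p p' : MvPolynomial (Fin n) 𝕜) (w w' : ExteriorAlgebra 𝕜 (Fin n → 𝕜)) :
    mk p w * mk p' w' = mk (p * p') (w * w') :=
  Algebra.TensorProduct.tmul_mul_tmul _ _ _ _

lemma mk_one_one : mk (1 : MvPolynomial (Fin n) 𝕜) 1 = 1 := rfl

lemma mk_add (p : MvPolynomial (Fin n) 𝕜) (w w' : ExteriorAlgebra 𝕜 (Fin n → 𝕜)) :
    mk p (w + w') = mk p w + mk p w' := TensorProduct.tmul_add _ _ _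

lemma add_mk (p p' : MvPolynomial (Fin n) 𝕜) (w : ExteriorAlgebra 𝕜 (Fin n → 𝕜)) :
    mk (p + p') w = mk p w + mk p' w := TensorProduct.add_tmul _ _ _

lemma mk_smul (c : 𝕜) (p : MvPolynomial (Fin n) 𝕜) (w : ExteriorAlgebra 𝕜 (Fin n → 𝕜)) :
    mk p (c • w) = c • mk p w := TensorProduct.tmul_smul _ _ _

lemma smul_mk (c : 𝕜) (p : MvPolynomial (Fin n) 𝕜) (w : ExteriorAlgebra 𝕜 (Fin n → 𝕜)) :
    mk (c • p) w = c • mk p w := rfl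

lemma mk_zero (p : MvPolynomial (Fin n) 𝕜) :
    mk p (0 : ExteriorAlgebra 𝕜 (Fin n → 𝕜)) = 0 := TensorProduct.tmul_zero _ _

lemma zero_mk (w : ExteriorAlgebra 𝕜 (Fin n → 𝕜)) : mk 0 w = 0 := TensorProduct.zero_tmul _ _

lemma mk_neg (p : MvPolynomial (Fin n) 𝕜) (w : ExteriorAlgebra 𝕜 (Fin n → 𝕜)) :
    mk p (-w) = -mk p w := TensorProduct.tmul_neg _ _

lemma mk_sub (p : MvPolynomial (Fin n) 𝕜) (w w' : ExteriorAlgebra 𝕜 (Fin n → 𝕜)) :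
    mk p (w - w') = mk p w - mk p w' := TensorProduct.tmul_sub _ _ _

lemma sub_mk (p p' : MvPolynomial (Fin n) 𝕜) (w : ExteriorAlgebra 𝕜 (Fin n → 𝕜)) :
    mk (p - p') w = mk p w - mk p' w := TensorProduct.sub_tmul _ _ _

lemma mk_sum {ι : Type*} (s : Finset ι) (p : MvPolynomial (Fin n) 𝕜)
    (w : ι → ExteriorAlgebra 𝕜 (Fin n → 𝕜)) :
    mk p (∑ i ∈ s, w i) = ∑ i ∈ s, mk p (w i) := TensorProduct.tmul_sum _ _ _

lemma sum_mk {ι : Type*} (s : Finset ι) (p : ι → MvPolynomial (Fin n) 𝕜)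
    (w : ExteriorAlgebra 𝕜 (Fin n → 𝕜)) :
    mk (∑ i ∈ s, p i) w = ∑ i ∈ s, mk (p i) w := TensorProduct.sum_tmul _ _ _

lemma hom_ext_mk {M : Type*} [AddCommGroup M] [Module 𝕜 M] {f g : PolyForm 𝕜 n →ₗ[𝕜] M}
    (h : ∀ p w, f (mk p w) = g (mk p w)) : f = g :=
  TensorProduct.ext' h

/-- Linear maps on forms agree if they agree on the forms `p w` with `w` homogeneous. -/
lemma hom_ext {M : Type*} [AddCommGroup M] [Module 𝕜 M] {f g : PolyForm 𝕜 n →ₗ[𝕜] M}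
    (h : ∀ (k : ℕ) p, ∀ w ∈ ⋀[𝕜]^k (Fin n → 𝕜), f (mk p w) = g (mk p w)) : f = g := by
  refine hom_ext_mk fun p w => ?_
  let F : ExteriorAlgebra 𝕜 (Fin n → 𝕜) →ₗ[𝕜] PolyForm 𝕜 n :=
    { toFun := mk p, map_add' := mk_add p, map_smul' := fun c w => mk_smul c p w }
  have : f ∘ₗ F = g ∘ₗ F := by
    refine ExteriorAlgebra.lhom_ext fun k => ?_
    ext v
    exact h k p _ (ιMulti_mem k v)
  exact LinearMap.congr_fun this w

end PolyForm
end PolyForms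

/-! ### Degree of forms and the exterior differential -/

section Deg

variable {𝕜 : Type*} [Field 𝕜] {n : ℕ}

variable (𝕜 n) in
/-- The forms of degree `k`. -/
def formDeg (k : ℕ) : Submodule 𝕜 (PolyForm 𝕜 n) :=
  Submodule.span 𝕜 {x | ∃ p, ∃ w ∈ ⋀[𝕜]^k (Fin n → 𝕜), x = PolyForm.mk p w}

lemma mk_mem_formDeg {k : ℕ} (p : MvPolynomial (Fin n) 𝕜) {w : ExteriorAlgebra 𝕜 (Fin n → 𝕜)}
    (hw : w ∈ ⋀[𝕜]^k (Fin n → 𝕜)) : PolyForm.mk p w ∈ formDeg 𝕜 n k :=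
  Submodule.subset_span ⟨p, w, hw, rfl⟩

lemma formDeg_le {k : ℕ} {S : Submodule 𝕜 (PolyForm 𝕜 n)}
    (h : ∀ p, ∀ w ∈ ⋀[𝕜]^k (Fin n → 𝕜), PolyForm.mk p w ∈ S) : formDeg 𝕜 n k ≤ S := by
  rw [formDeg, Submodule.span_le]
  rintro x ⟨p, w, hw, rfl⟩
  exact h p w hw

lemma formDeg_hom_ext {k : ℕ} {M : Type*} [AddCommGroup M] [Module 𝕜 M]
    {f g : PolyForm 𝕜 n →ₗ[𝕜] M}
    (h : ∀ p, ∀ w ∈ ⋀[𝕜]^k (Fin n → 𝕜), f (PolyForm.mk p w) = g (PolyForm.mk p w))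
    {x : PolyForm 𝕜 n} (hx : x ∈ formDeg 𝕜 n k) : f x = g x :=
  formDeg_le (S := LinearMap.eqLocus f g) h hx

lemma PolyForm.hom_ext_formDeg {M : Type*} [AddCommGroup M] [Module 𝕜 M]
    {f g : PolyForm 𝕜 n →ₗ[𝕜] M} (h : ∀ (k : ℕ), ∀ x ∈ formDeg 𝕜 n k, f x = g x) : f = g :=
  PolyForm.hom_ext fun k p _ hw => h k _ (mk_mem_formDeg p hw)

lemma formDeg_eq_zero {k : ℕ} (hk : n < k) {x : PolyForm 𝕜 n} (hx : x ∈ formDeg 𝕜 n k) :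
    x = 0 := by
  refine formDeg_hom_ext (f := LinearMap.id) (g := 0) (fun p w hw => ?_) hx
  rw [extPower_eq_zero hk hw, PolyForm.mk_zero]; simp

lemma one_mem_formDeg : (1 : PolyForm 𝕜 n) ∈ formDeg 𝕜 n 0 := by
  rw [← PolyForm.mk_one_one]; exact mk_mem_formDeg _ one_mem_extPower

lemma formDeg_mul {j k : ℕ} {x y : PolyForm 𝕜 n} (hx : x ∈ formDeg 𝕜 n j)
    (hy : y ∈ formDeg 𝕜 n k) : x * y ∈ formDeg 𝕜 n (j + k) := by
  refine formDeg_le (S := (formDeg 𝕜 n (j + k)).comap (LinearMap.mulRight 𝕜 y))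
    (fun p w hw => ?_) hx
  refine formDeg_le (S := (formDeg 𝕜 n (j + k)).comap (LinearMap.mulLeft 𝕜 (PolyForm.mk p w)))
    (fun p' w' hw' => ?_) hy
  simp only [Submodule.mem_comap, LinearMap.mulLeft_apply, PolyForm.mk_mul_mk]
  exact mk_mem_formDeg _ (extPower_mul hw hw')

/-- Forms are graded commutative. -/
lemma formDeg_mul_comm {j k : ℕ} {x y : PolyForm 𝕜 n} (hx : x ∈ formDeg 𝕜 n j)
    (hy : y ∈ formDeg 𝕜 n k) : x * y = (-1 : 𝕜) ^ (j * k) • (y * x) := by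
  refine formDeg_hom_ext (f := LinearMap.mulRight 𝕜 y)
    (g := (-1 : 𝕜) ^ (j * k) • LinearMap.mulLeft 𝕜 y) (fun p w hw => ?_) hx
  refine formDeg_hom_ext (f := LinearMap.mulLeft 𝕜 (PolyForm.mk p w))
    (g := (-1 : 𝕜) ^ (j * k) • LinearMap.mulRight 𝕜 (PolyForm.mk p w)) (fun p' w' hw' => ?_) hy
  simp only [LinearMap.mulLeft_apply, LinearMap.smul_apply, LinearMap.mulRight_apply,
    PolyForm.mk_mul_mk]
  rw [extPower_mul_comm hw hw', PolyForm.mk_smul, mul_comm p]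

lemma formProj_of_mem {j k : ℕ} {x : PolyForm 𝕜 n} (hx : x ∈ formDeg 𝕜 n k) :
    formProj 𝕜 n j x = if j = k then x else 0 := by
  refine formDeg_hom_ext (f := formProj 𝕜 n j) (g := if j = k then LinearMap.id else 0)
    (fun p w hw => ?_) hx |>.trans (by split_ifs <;> rfl)
  rw [formProj, PolyForm.map_mk, extProj_of_mem hw]
  split_ifs
  · rfl
  · rw [PolyForm.mk_zero]; rfl

end Deg

section ExtDeriv

variable {𝕜 : Type*} [Field 𝕜] {n : ℕ}

lemma extDeriv_mk (p : MvPolynomial (Fin n) 𝕜) (w : ExteriorAlgebra 𝕜 (Fin n → 𝕜)) :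
    extDeriv 𝕜 n (PolyForm.mk p w) = ∑ j : Fin n, PolyForm.mk (MvPolynomial.pderiv j p)
      (ExteriorAlgebra.ι 𝕜 (Pi.single j 1) * w) := by
  rw [extDeriv, LinearMap.sum_apply]; rfl

lemma extDeriv_mem {k : ℕ} {x : PolyForm 𝕜 n} (hx : x ∈ formDeg 𝕜 n k) :
    extDeriv 𝕜 n x ∈ formDeg 𝕜 n (k + 1) := by
  refine formDeg_le (S := (formDeg 𝕜 n (k + 1)).comap (extDeriv 𝕜 n)) (fun p w hw => ?_) hx
  rw [Submodule.mem_comap, extDeriv_mk]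
  exact Submodule.sum_mem _ fun j _ => mk_mem_formDeg _ (ι_mul_mem _ hw)

/-- The exterior differential is a graded derivation. -/
lemma extDeriv_mul {k : ℕ} {x : PolyForm 𝕜 n} (hx : x ∈ formDeg 𝕜 n k) (y : PolyForm 𝕜 n) :
    extDeriv 𝕜 n (x * y) = extDeriv 𝕜 n x * y + (-1 : 𝕜) ^ k • (x * extDeriv 𝕜 n y) := by
  refine formDeg_hom_ext (f := extDeriv 𝕜 n ∘ₗ LinearMap.mulRight 𝕜 y)
    (g := LinearMap.mulRight 𝕜 y ∘ₗ extDeriv 𝕜 n +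
      (-1 : 𝕜) ^ k • LinearMap.mulRight 𝕜 (extDeriv 𝕜 n y)) (fun p w hw => ?_) hx
  refine LinearMap.congr_fun (PolyForm.hom_ext_mk (f := extDeriv 𝕜 n ∘ₗ
    LinearMap.mulLeft 𝕜 (PolyForm.mk p w)) (g := LinearMap.mulLeft 𝕜 (extDeriv 𝕜 n (.mk p w)) +
      (-1 : 𝕜) ^ k • (LinearMap.mulLeft 𝕜 (.mk p w) ∘ₗ extDeriv 𝕜 n)) fun p' w' => ?_) y
  simp only [LinearMap.comp_apply, LinearMap.mulLeft_apply, LinearMap.add_apply,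
    LinearMap.smul_apply, PolyForm.mk_mul_mk, extDeriv_mk, Finset.mul_sum, Finset.sum_mul,
    Finset.smul_sum, ← Finset.sum_add_distrib]
  refine Finset.sum_congr rfl fun j _ => ?_
  rw [Derivation.leibniz, PolyForm.add_mk, add_comm, ← mul_assoc w,
    ← PolyForm.mk_smul, ← smul_mul_assoc, ← ι_mul_comm_homogeneous _ hw]
  simp only [smul_eq_mul, mul_assoc, mul_comm]

lemma pderiv_comm (l j : Fin n) (p : MvPolynomial (Fin n) 𝕜) :
    MvPolynomial.pderiv l (MvPolynomial.pderiv j p) =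
      MvPolynomial.pderiv j (MvPolynomial.pderiv l p) := by
  have h : ⁅(MvPolynomial.pderiv l : Derivation 𝕜 (MvPolynomial (Fin n) 𝕜) _),
      MvPolynomial.pderiv j⁆ = 0 :=
    MvPolynomial.derivation_ext fun i => by
      classical
      rw [Derivation.commutator_apply, MvPolynomial.pderiv_X, MvPolynomial.pderiv_X,
        Derivation.zero_apply]
      by_cases h1 : l = i <;> by_cases h2 : j = i <;> simp [h1, h2, Ne.symm]
  have := DFunLike.congr_fun h p
  rwa [Derivation.commutator_apply, Derivation.zero_apply, sub_eq_zero] at this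

lemma extDeriv_extDeriv [CharZero 𝕜] (x : PolyForm 𝕜 n) : extDeriv 𝕜 n (extDeriv 𝕜 n x) = 0 := by
  refine LinearMap.congr_fun (PolyForm.hom_ext_mk (f := extDeriv 𝕜 n ∘ₗ extDeriv 𝕜 n)
    (g := 0) fun p w => ?_) x
  have h : ∀ j l : Fin n, (PolyForm.mk (MvPolynomial.pderiv l (MvPolynomial.pderiv j p))
      (ExteriorAlgebra.ι 𝕜 (Pi.single l 1) * (ExteriorAlgebra.ι 𝕜 (Pi.single j 1) * w))) =
      - (PolyForm.mk (MvPolynomial.pderiv j (MvPolynomial.pderiv l p))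
      (ExteriorAlgebra.ι 𝕜 (Pi.single j 1) * (ExteriorAlgebra.ι 𝕜 (Pi.single l 1) * w))) := by
    intro j l
    rw [← mul_assoc, eq_neg_of_add_eq_zero_left (ExteriorAlgebra.ι_add_mul_swap _ _), neg_mul,
      PolyForm.mk_neg, mul_assoc, pderiv_comm]
  simp only [LinearMap.comp_apply, LinearMap.zero_apply, extDeriv_mk, map_sum]
  have h2 : ∀ y : PolyForm 𝕜 n, y = -y → y = 0 := fun y hy => by
    have : (2 : 𝕜) • y = 0 := by rw [two_smul]; nth_rewrite 1 [hy]; exact neg_add_cancel y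
    exact (smul_eq_zero.1 this).resolve_left two_ne_zero
  refine h2 _ ?_
  conv_rhs => rw [Finset.sum_comm]
  rw [← Finset.sum_neg_distrib]
  refine Finset.sum_congr rfl fun j _ => ?_
  rw [← Finset.sum_neg_distrib]
  exact Finset.sum_congr rfl fun l _ => h j l

end ExtDeriv

/-! ### Integrals of polynomials over the unit interval and over simplices -/

section Radial

variable {𝕜 : Type*} [Field 𝕜] {n : ℕ}

lemma unitIntegral_monomial {A : Type*} [CommRing A] [Algebra 𝕜 A] (m : ℕ) (a : A) :
    unitIntegral 𝕜 (Polynomial.monomial m a) = ((m + 1 : ℕ) : 𝕜)⁻¹ • a := by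
  simp [unitIntegral, Polynomial.lsum_apply]

lemma unitIntegral_map {A B : Type*} [CommRing A] [Algebra 𝕜 A] [CommRing B] [Algebra 𝕜 B]
    (f : A →ₐ[𝕜] B) (p : Polynomial A) :
    unitIntegral 𝕜 (p.map (f : A →+* B)) = f (unitIntegral 𝕜 p) := by
  induction p using Polynomial.induction_on' with
  | add p q hp hq => rw [Polynomial.map_add, map_add, map_add, map_add, hp, hq]
  | monomial m a =>
    rw [Polynomial.map_monomial, unitIntegral_monomial, unitIntegral_monomial, map_smul]; rfl

/-- The operator `p ↦ ∫₀¹ uᵏ p(u t + (1 - u) eᵢ) du`. -/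
def radialIntegral (i : Fin (n + 1)) (k : ℕ) :
    MvPolynomial (Fin n) 𝕜 →ₗ[𝕜] MvPolynomial (Fin n) 𝕜 :=
  unitIntegral 𝕜 ∘ₗ LinearMap.mulLeft 𝕜 (Polynomial.X ^ k) ∘ₗ (dilation 𝕜 i).toLinearMap

variable (𝕜) in
/-- The affine coordinates centred at the `i`-th vertex. -/
def centred (i : Fin (n + 1)) (j : Fin n) : MvPolynomial (Fin n) 𝕜 :=
  MvPolynomial.X j - MvPolynomial.C (vertex 𝕜 i j)

variable (𝕜) in
/-- Substitution of the centred coordinates. -/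
def centre (i : Fin (n + 1)) : MvPolynomial (Fin n) 𝕜 →ₐ[𝕜] MvPolynomial (Fin n) 𝕜 :=
  MvPolynomial.aeval (centred 𝕜 i)

/-- Monomials in centred coordinates span the polynomials. -/
lemma centred_hom_ext {M : Type*} [AddCommGroup M] [Module 𝕜 M]
    {f g : MvPolynomial (Fin n) 𝕜 →ₗ[𝕜] M} (i : Fin (n + 1))
    (h : ∀ a, f (centre 𝕜 i (MvPolynomial.monomial a 1)) =
      g (centre 𝕜 i (MvPolynomial.monomial a 1))) : f = g := by
  have h1 : f ∘ₗ (centre 𝕜 i).toLinearMap = g ∘ₗ (centre 𝕜 i).toLinearMap := by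
    ext a; exact h a
  have h2 : (centre 𝕜 i).comp (MvPolynomial.aeval fun j =>
      (MvPolynomial.X j + MvPolynomial.C (vertex 𝕜 i j) : MvPolynomial (Fin n) 𝕜)) =
        AlgHom.id 𝕜 _ := by
    ext j
    simp [centre, centred, MvPolynomial.algebraMap_eq]
  refine LinearMap.ext fun p => ?_
  have := LinearMap.congr_fun h1 (MvPolynomial.aeval (fun j =>
      (MvPolynomial.X j + MvPolynomial.C (vertex 𝕜 i j) : MvPolynomial (Fin n) 𝕜)) p)
  have h3 := DFunLike.congr_fun h2 p
  simp only [AlgHom.comp_apply, AlgHom.id_apply] at h3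
  simp only [LinearMap.comp_apply, AlgHom.toLinearMap_apply, h3] at this
  exact this

lemma pderiv_centre (i : Fin (n + 1)) (j : Fin n) (p : MvPolynomial (Fin n) 𝕜) :
    MvPolynomial.pderiv j (centre 𝕜 i p) = centre 𝕜 i (MvPolynomial.pderiv j p) := by
  induction p using MvPolynomial.induction_on with
  | C a => simp [centre, MvPolynomial.algebraMap_eq]
  | add p q hp hq => simp only [map_add, hp, hq]
  | mul_X p l hp =>
    rw [map_mul, Derivation.leibniz, Derivation.leibniz, map_add, hp]
    simp only [smul_eq_mul, map_mul]
    congr 2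
    simp only [centre, MvPolynomial.aeval_X, centred, map_sub, MvPolynomial.pderiv_C, sub_zero,
      MvPolynomial.pderiv_X]
    simp only [Pi.single_apply]
    split_ifs <;> simp

lemma dilation_centre (i : Fin (n + 1)) (q : MvPolynomial (Fin n) 𝕜) {m : ℕ}
    (hq : q.IsHomogeneous m) :
    dilation 𝕜 i (centre 𝕜 i q) = Polynomial.X ^ m * Polynomial.C (centre 𝕜 i q) := by
  have hX : ∀ j, dilation 𝕜 i (centred 𝕜 i j) = Polynomial.X * Polynomial.C (centred 𝕜 i j) := by
    intro j
    have hC : ∀ c : 𝕜, dilation 𝕜 i (MvPolynomial.C c) = Polynomial.C (MvPolynomial.C c) :=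
      fun c => (dilation 𝕜 i).commutes c
    rw [centred, map_sub, hC, dilation, MvPolynomial.aeval_X, Polynomial.C_sub]
    ring
  rw [q.as_sum]
  simp only [map_sum, Finset.mul_sum]
  refine Finset.sum_congr rfl fun a ha => ?_
  have hm : a.degree = m := by
    have := hq (MvPolynomial.mem_support_iff.1 ha)
    rwa [Finsupp.degree_eq_weight_one]
  have hc : ∀ c : 𝕜, (MvPolynomial.monomial a) c = c • MvPolynomial.monomial a (1 : 𝕜) := by
    intro c; rw [MvPolynomial.smul_monomial, smul_eq_mul, mul_one]
  rw [hc, map_smul, map_smul, ← Polynomial.smul_C, mul_smul_comm]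
  congr 1
  rw [centre, MvPolynomial.aeval_monomial, map_one, one_mul, Finsupp.prod, map_prod, map_prod,
    ← hm, Finsupp.degree_apply, ← Finset.prod_pow_eq_pow_sum, ← Finset.prod_mul_distrib]
  refine Finset.prod_congr rfl fun j _ => ?_
  rw [map_pow, map_pow, hX, mul_pow]

lemma radialIntegral_centre (i : Fin (n + 1)) (k : ℕ) {q : MvPolynomial (Fin n) 𝕜} {m : ℕ}
    (hq : q.IsHomogeneous m) :
    radialIntegral i k (centre 𝕜 i q) = ((k + m + 1 : ℕ) : 𝕜)⁻¹ • centre 𝕜 i q := by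
  rw [radialIntegral, LinearMap.comp_apply, LinearMap.comp_apply, LinearMap.mulLeft_apply,
    AlgHom.toLinearMap_apply, dilation_centre i q hq, ← mul_assoc, ← pow_add, mul_comm,
    Polynomial.C_mul_X_pow_eq_monomial, unitIntegral_monomial]

/-- Euler's identity for polynomials homogeneous about the vertex `i`. -/
lemma sum_centred_mul (i : Fin (n + 1)) {q : MvPolynomial (Fin n) 𝕜} {m : ℕ}
    (hq : q.IsHomogeneous m) :
    ∑ j, centred 𝕜 i j * centre 𝕜 i (MvPolynomial.pderiv j q) = (m : 𝕜) • centre 𝕜 i q := by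
  have h := congrArg (centre 𝕜 i) hq.sum_X_mul_pderiv
  rw [map_nsmul, ← Nat.cast_smul_eq_nsmul 𝕜] at h
  rw [← h, map_sum]
  refine Finset.sum_congr rfl fun j _ => ?_
  rw [map_mul, centre, MvPolynomial.aeval_X]

/-- Differentiation under the integral sign: each derivative contributes one factor of the
integration variable. -/
lemma pderiv_radialIntegral (i : Fin (n + 1)) (k : ℕ) (j : Fin n) (p : MvPolynomial (Fin n) 𝕜) :
    MvPolynomial.pderiv j (radialIntegral i k p) =
      radialIntegral i (k + 1) (MvPolynomial.pderiv j p) := by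
  suffices h : (MvPolynomial.pderiv j).toLinearMap ∘ₗ radialIntegral i k =
      radialIntegral i (k + 1) ∘ₗ (MvPolynomial.pderiv j).toLinearMap by
    have := LinearMap.congr_fun h p
    simpa only [LinearMap.comp_apply, Derivation.coeFn_coe] using this
  refine centred_hom_ext i fun a => ?_
  have ha := MvPolynomial.isHomogeneous_monomial (1 : 𝕜) (Eq.refl a.degree)
  simp only [LinearMap.comp_apply, Derivation.coeFn_coe]
  rw [radialIntegral_centre i k ha, Derivation.map_smul, pderiv_centre]
  have hd : (MvPolynomial.pderiv j (MvPolynomial.monomial a (1 : 𝕜))).IsHomogeneous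
      (a.degree - 1) := ha.pderiv
  rw [radialIntegral_centre i (k + 1) hd]
  rcases Nat.eq_zero_or_pos a.degree with h0 | h0
  · have : a = 0 := (Finsupp.degree_eq_zero_iff a).1 h0
    subst this
    simp
  · congr 3; omega

variable [CharZero 𝕜]

/-- `∫₀¹ (d/du) (u^{k+1} p(u t + (1 - u) eᵢ)) du = p`. -/
lemma euler_radialIntegral (i : Fin (n + 1)) (k : ℕ) (p : MvPolynomial (Fin n) 𝕜) :
    ∑ j, centred 𝕜 i j * MvPolynomial.pderiv j (radialIntegral i k p) +
      ((k + 1 : ℕ) : 𝕜) • radialIntegral i k p = p := by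
  refine Eq.trans ?_ (LinearMap.congr_fun (centred_hom_ext i
    (f := (∑ j, LinearMap.mulLeft 𝕜 (centred 𝕜 i j) ∘ₗ (MvPolynomial.pderiv j).toLinearMap ∘ₗ
      radialIntegral i k) + ((k + 1 : ℕ) : 𝕜) • radialIntegral i k)
    (g := LinearMap.id) fun a => ?_) p)
  · simp only [LinearMap.add_apply, LinearMap.sum_apply, LinearMap.comp_apply,
      LinearMap.smul_apply, LinearMap.mulLeft_apply, Derivation.coeFn_coe]
  have ha := MvPolynomial.isHomogeneous_monomial (1 : 𝕜) (Eq.refl a.degree)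
  simp only [LinearMap.add_apply, LinearMap.sum_apply, LinearMap.comp_apply,
      LinearMap.smul_apply, LinearMap.mulLeft_apply, Derivation.coeFn_coe]
  simp only [radialIntegral_centre i k ha, Derivation.map_smul, pderiv_centre, mul_smul_comm]
  rw [← Finset.smul_sum, sum_centred_mul i ha, smul_smul, smul_smul, ← add_smul, LinearMap.id_apply]
  convert one_smul 𝕜 _ using 2
  have : ((k + a.degree + 1 : ℕ) : 𝕜) ≠ 0 := Nat.cast_ne_zero.2 (by omega)
  field_simp
  push_cast
  ring

/-- `∫₀¹ (d/du) p(u t + (1 - u) eᵢ) du = p - p(eᵢ)`. -/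
lemma euler_radialIntegral_zero (i : Fin (n + 1)) (p : MvPolynomial (Fin n) 𝕜) :
    ∑ j, centred 𝕜 i j * radialIntegral i 0 (MvPolynomial.pderiv j p) =
      p - MvPolynomial.C (MvPolynomial.aeval (vertex 𝕜 i) p) := by
  refine Eq.trans ?_ (LinearMap.congr_fun (centred_hom_ext i
    (f := (∑ j, LinearMap.mulLeft 𝕜 (centred 𝕜 i j) ∘ₗ radialIntegral i 0 ∘ₗ
      (MvPolynomial.pderiv j).toLinearMap))
    (g := LinearMap.id - Algebra.linearMap 𝕜 _ ∘ₗ (MvPolynomial.aeval (vertex 𝕜 i)).toLinearMap)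
    fun a => ?_) p)
  · simp only [LinearMap.sum_apply, LinearMap.comp_apply,
      LinearMap.mulLeft_apply, Derivation.coeFn_coe]
  have ha := MvPolynomial.isHomogeneous_monomial (1 : 𝕜) (Eq.refl a.degree)
  simp only [LinearMap.sub_apply, LinearMap.sum_apply, LinearMap.comp_apply, LinearMap.id_apply,
      LinearMap.mulLeft_apply, Derivation.coeFn_coe, AlgHom.toLinearMap_apply]
  have he : MvPolynomial.aeval (vertex 𝕜 i) (centre 𝕜 i (MvPolynomial.monomial a 1)) =
      if a = 0 then 1 else 0 := by
    have : (MvPolynomial.aeval (vertex 𝕜 i)).comp (centre 𝕜 i) =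
        MvPolynomial.aeval (fun _ => (0 : 𝕜)) := by
      ext j; simp [centre, centred]
    have := DFunLike.congr_fun this (MvPolynomial.monomial a 1)
    rw [AlgHom.comp_apply] at this
    rw [this, MvPolynomial.aeval_monomial]
    split_ifs with h
    · subst h; simp
    · obtain ⟨j, hj⟩ := Finsupp.ne_iff.1 h
      rw [Finsupp.prod, Finset.prod_eq_zero (Finsupp.mem_support_iff.2 hj), mul_zero]
      exact zero_pow hj
  rw [he]
  have hd : ∀ j, radialIntegral i 0 (MvPolynomial.pderiv j (centre 𝕜 i (.monomial a 1))) = 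
      ((0 + (a.degree - 1) + 1 : ℕ) : 𝕜)⁻¹ • centre 𝕜 i (MvPolynomial.pderiv j (.monomial a 1)) :=
    fun j => by rw [pderiv_centre, radialIntegral_centre i 0 ha.pderiv]
  simp only [hd, mul_smul_comm]
  rw [← Finset.smul_sum, sum_centred_mul i ha, smul_smul]
  split_ifs with h
  · subst h; simp [centre]
  · have h0 : a.degree ≠ 0 := fun h' => h ((Finsupp.degree_eq_zero_iff a).1 h')
    have h1 : 0 + (a.degree - 1) + 1 = a.degree := by omega
    rw [h1, inv_mul_cancel₀ (Nat.cast_ne_zero.2 h0)]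
    simp

end Radial

/-! ### The cone homotopy -/

section Cone

variable {𝕜 : Type*} [Field 𝕜] {n : ℕ}

variable (𝕜) in
/-- Contraction of forms with the Euler vector field centred at the `i`-th vertex. -/
def eulerContract (i : Fin (n + 1)) : PolyForm 𝕜 n →ₗ[𝕜] PolyForm 𝕜 n :=
  ∑ j : Fin n, PolyForm.map (LinearMap.mulLeft 𝕜 (centred 𝕜 i j)) (contract (LinearMap.proj j))

lemma eulerContract_mk (i : Fin (n + 1)) (p : MvPolynomial (Fin n) 𝕜)
    (w : ExteriorAlgebra 𝕜 (Fin n → 𝕜)) :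
    eulerContract 𝕜 i (PolyForm.mk p w) =
      ∑ j, PolyForm.mk (centred 𝕜 i j * p) (contract (LinearMap.proj j) w) := by
  rw [eulerContract, LinearMap.sum_apply]; rfl

lemma coneHomotopy_mk (i : Fin (n + 1)) {k : ℕ} (p : MvPolynomial (Fin n) 𝕜)
    {w : ExteriorAlgebra 𝕜 (Fin n → 𝕜)} (hw : w ∈ ⋀[𝕜]^(k + 1) (Fin n → 𝕜)) :
    coneHomotopy 𝕜 i (PolyForm.mk p w) =
      eulerContract 𝕜 i (PolyForm.mk (radialIntegral i k p) w) := by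
  by_cases hk : k < n
  · rw [coneHomotopy, LinearMap.sum_apply, Finset.sum_eq_single_of_mem k (Finset.mem_range.2 hk),
      LinearMap.sum_apply, eulerContract_mk]
    · refine Finset.sum_congr rfl fun j _ => ?_
      rw [PolyForm.map_mk, LinearMap.comp_apply (CliffordAlgebra.contractLeft _),
        extProj_of_mem hw, if_pos rfl]
      rfl
    · intro l _ hl
      rw [LinearMap.sum_apply]
      refine Finset.sum_eq_zero fun j _ => ?_
      rw [PolyForm.map_mk, LinearMap.comp_apply (CliffordAlgebra.contractLeft _),
        extProj_of_mem hw, if_neg (by omega), map_zero, PolyForm.mk_zero]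
  · rw [extPower_eq_zero (by omega) hw, PolyForm.mk_zero, PolyForm.mk_zero, map_zero, map_zero]

lemma coneHomotopy_mk_zero (i : Fin (n + 1)) (p : MvPolynomial (Fin n) 𝕜)
    {w : ExteriorAlgebra 𝕜 (Fin n → 𝕜)} (hw : w ∈ ⋀[𝕜]^0 (Fin n → 𝕜)) :
    coneHomotopy 𝕜 i (PolyForm.mk p w) = 0 := by
  rw [coneHomotopy, LinearMap.sum_apply]
  refine Finset.sum_eq_zero fun l _ => ?_
  rw [LinearMap.sum_apply]
  refine Finset.sum_eq_zero fun j _ => ?_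
  rw [PolyForm.map_mk, LinearMap.comp_apply (CliffordAlgebra.contractLeft _),
    extProj_of_mem hw, if_neg (by omega), map_zero, PolyForm.mk_zero]

lemma coneHomotopy_of_zero (i : Fin (n + 1)) {x : PolyForm 𝕜 n} (hx : x ∈ formDeg 𝕜 n 0) :
    coneHomotopy 𝕜 i x = 0 :=
  formDeg_hom_ext (g := 0) (fun p _ hw => coneHomotopy_mk_zero i p hw) hx

lemma coneHomotopy_mem (i : Fin (n + 1)) {k : ℕ} {x : PolyForm 𝕜 n}
    (hx : x ∈ formDeg 𝕜 n (k + 1)) : coneHomotopy 𝕜 i x ∈ formDeg 𝕜 n k := by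
  refine formDeg_le (S := (formDeg 𝕜 n k).comap (coneHomotopy 𝕜 i)) (fun p w hw => ?_) hx
  rw [Submodule.mem_comap, coneHomotopy_mk i p hw, eulerContract_mk]
  exact Submodule.sum_mem _ fun j _ => mk_mem_formDeg _ (contract_mem _ hw)

variable (𝕜) in
/-- Evaluation of forms at the `i`-th vertex. -/
def vertexEval (i : Fin (n + 1)) : PolyForm 𝕜 n →ₐ[𝕜] 𝕜 :=
  (Algebra.TensorProduct.lmul' 𝕜).comp (Algebra.TensorProduct.map
    (MvPolynomial.aeval (vertex 𝕜 i)) ExteriorAlgebra.algebraMapInv)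

lemma vertexEval_mk (i : Fin (n + 1)) (p : MvPolynomial (Fin n) 𝕜)
    (w : ExteriorAlgebra 𝕜 (Fin n → 𝕜)) : vertexEval 𝕜 i (PolyForm.mk p w) =
      MvPolynomial.aeval (vertex 𝕜 i) p * ExteriorAlgebra.algebraMapInv w := rfl

lemma algebraMapInv_eq_zero {k : ℕ} {w : ExteriorAlgebra 𝕜 (Fin n → 𝕜)}
    (hw : w ∈ ⋀[𝕜]^(k + 1) (Fin n → 𝕜)) : ExteriorAlgebra.algebraMapInv w = 0 := by
  refine extPower_induction (P := fun w => ExteriorAlgebra.algebraMapInv w = 0)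
    (fun u => ?_) (map_zero _) ?_ ?_ hw
  · rw [ExteriorAlgebra.ιMulti_succ_apply, map_mul, ExteriorAlgebra.algebraMapInv,
      ExteriorAlgebra.lift_ι_apply]
    simp
  · intro x y hx hy; rw [map_add, hx, hy, add_zero]
  · intro c x hx; rw [map_smul, hx, smul_zero]

lemma vertexEval_of_succ (i : Fin (n + 1)) {k : ℕ} {x : PolyForm 𝕜 n}
    (hx : x ∈ formDeg 𝕜 n (k + 1)) : vertexEval 𝕜 i x = 0 :=
  formDeg_hom_ext (f := (vertexEval 𝕜 i).toLinearMap) (g := 0) (fun p w hw => by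
    rw [AlgHom.toLinearMap_apply, vertexEval_mk, algebraMapInv_eq_zero hw, mul_zero]; rfl) hx

/-- The cone homotopy at the vertex `i` has image in the forms which vanish at that vertex. -/
lemma vertexEval_coneHomotopy (i : Fin (n + 1)) (x : PolyForm 𝕜 n) :
    vertexEval 𝕜 i (coneHomotopy 𝕜 i x) = 0 := by
  suffices h : (vertexEval 𝕜 i).toLinearMap ∘ₗ coneHomotopy 𝕜 i = 0 from LinearMap.congr_fun h x
  refine PolyForm.hom_ext fun k p w hw => ?_
  rw [LinearMap.comp_apply, LinearMap.zero_apply, AlgHom.toLinearMap_apply]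
  rcases k with _ | k
  · rw [coneHomotopy_mk_zero i p hw, map_zero]
  · rw [coneHomotopy_mk i p hw, eulerContract_mk, map_sum]
    refine Finset.sum_eq_zero fun j _ => ?_
    rw [vertexEval_mk, map_mul]
    simp [centred]

/-- Euler's identity for exterior forms: contracting with a basis covector and multiplying back
counts the degree. -/
lemma sum_ι_mul_contract {k : ℕ} {w : ExteriorAlgebra 𝕜 (Fin n → 𝕜)}
    (hw : w ∈ ⋀[𝕜]^k (Fin n → 𝕜)) :
    ∑ j, ExteriorAlgebra.ι 𝕜 (Pi.single j 1) * contract (LinearMap.proj j) w = (k : 𝕜) • w := by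
  rw [← ExteriorAlgebra.ιMulti_span_fixedDegree] at hw
  induction hw using Submodule.span_induction with
  | mem x hx =>
    obtain ⟨u, rfl⟩ := hx
    induction k with
    | zero => simp [ExteriorAlgebra.ιMulti_zero_apply]
    | succ k ih =>
      rw [ExteriorAlgebra.ιMulti_succ_apply]
      simp only [contract_ι_mul, mul_sub, Finset.sum_sub_distrib, LinearMap.proj_apply]
      have h1 : ∀ j : Fin n, ExteriorAlgebra.ι 𝕜 (Pi.single j (1 : 𝕜)) *
          (ExteriorAlgebra.ι 𝕜 (u 0) * contract (LinearMap.proj j)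
            (ExteriorAlgebra.ιMulti 𝕜 k (Matrix.vecTail u))) =
          - (ExteriorAlgebra.ι 𝕜 (u 0) * (ExteriorAlgebra.ι 𝕜 (Pi.single j (1 : 𝕜)) *
            contract (LinearMap.proj j) (ExteriorAlgebra.ιMulti 𝕜 k (Matrix.vecTail u)))) := by
        intro j
        rw [← mul_assoc, eq_neg_of_add_eq_zero_left (ExteriorAlgebra.ι_add_mul_swap _ _), neg_mul,
          mul_assoc]
      simp only [h1, Finset.sum_neg_distrib, ← Finset.mul_sum, ih]
      have h2 : ∑ j, ExteriorAlgebra.ι 𝕜 (Pi.single j (1 : 𝕜)) *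
          (u 0 j • ExteriorAlgebra.ιMulti 𝕜 k (Matrix.vecTail u)) = ExteriorAlgebra.ι 𝕜 (u 0) *
          ExteriorAlgebra.ιMulti 𝕜 k (Matrix.vecTail u) := by
        simp only [mul_smul_comm, ← smul_mul_assoc, ← map_smul]
        rw [← Finset.sum_mul, ← map_sum]
        congr 2
        ext j
        simp [Finset.sum_apply, Pi.single_apply]
      rw [h2, mul_smul_comm, sub_neg_eq_add]
      push_cast
      rw [add_smul, one_smul, add_comm]
  | zero => simp
  | add x y _ _ hx hy => simp only [map_add, mul_add, Finset.sum_add_distrib, hx, hy, smul_add]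
  | smul c x _ hx => simp only [map_smul, mul_smul_comm, ← Finset.smul_sum, hx, smul_comm c]

/-- Cartan's formula for the Euler vector field. -/
lemma extDeriv_eulerContract (i : Fin (n + 1)) {k : ℕ} (p : MvPolynomial (Fin n) 𝕜)
    {w : ExteriorAlgebra 𝕜 (Fin n → 𝕜)} (hw : w ∈ ⋀[𝕜]^k (Fin n → 𝕜)) :
    extDeriv 𝕜 n (eulerContract 𝕜 i (PolyForm.mk p w)) +
      eulerContract 𝕜 i (extDeriv 𝕜 n (PolyForm.mk p w)) =
    PolyForm.mk (∑ j, centred 𝕜 i j * MvPolynomial.pderiv j p + (k : 𝕜) • p) w := by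
  have hX : ∀ l j : Fin n, MvPolynomial.pderiv l (centred 𝕜 i j) = if l = j then 1 else 0 := by
    intro l j
    rw [centred, map_sub, MvPolynomial.pderiv_C, sub_zero, MvPolynomial.pderiv_X, Pi.single_apply]
    simp only [eq_comm]
  have h1 : extDeriv 𝕜 n (eulerContract 𝕜 i (PolyForm.mk p w)) = PolyForm.mk p ((k : 𝕜) • w) +
      ∑ j, ∑ l, PolyForm.mk (centred 𝕜 i j * MvPolynomial.pderiv l p)
        (ExteriorAlgebra.ι 𝕜 (Pi.single l 1) * contract (LinearMap.proj j) w) := by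
    rw [eulerContract_mk, map_sum, ← sum_ι_mul_contract hw, PolyForm.mk_sum,
      ← Finset.sum_add_distrib]
    refine Finset.sum_congr rfl fun j _ => ?_
    rw [extDeriv_mk]
    have : ∀ l, MvPolynomial.pderiv l (centred 𝕜 i j * p) =
        centred 𝕜 i j * MvPolynomial.pderiv l p + if l = j then p else 0 := by
      intro l
      rw [Derivation.leibniz, hX]
      split_ifs <;> simp
    simp only [this, PolyForm.add_mk, Finset.sum_add_distrib]
    rw [add_comm]
    congr 1
    rw [Finset.sum_eq_single j]
    · rw [if_pos rfl]
    · intro l _ hl; rw [if_neg hl, PolyForm.zero_mk]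
    · simp
  have h2 : eulerContract 𝕜 i (extDeriv 𝕜 n (PolyForm.mk p w)) =
      PolyForm.mk (∑ j, centred 𝕜 i j * MvPolynomial.pderiv j p) w -
      ∑ j, ∑ l, PolyForm.mk (centred 𝕜 i j * MvPolynomial.pderiv l p)
        (ExteriorAlgebra.ι 𝕜 (Pi.single l 1) * contract (LinearMap.proj j) w) := by
    rw [extDeriv_mk, map_sum, PolyForm.sum_mk]
    simp only [eulerContract_mk]
    rw [Finset.sum_comm, ← Finset.sum_sub_distrib]
    refine Finset.sum_congr rfl fun j _ => ?_
    simp only [contract_ι_mul, PolyForm.mk_sub, Finset.sum_sub_distrib, PolyForm.mk_smul]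
    congr 1
    rw [Finset.sum_eq_single j]
    · simp
    · intro l _ hl; simp [Ne.symm hl]
    · simp
  rw [h1, h2, PolyForm.add_mk, PolyForm.mk_smul, PolyForm.smul_mk]
  abel

variable [CharZero 𝕜]

/-- The homotopy formula `d hⁱ + hⁱ d = 1 - εⁱ`. -/
lemma extDeriv_coneHomotopy (i : Fin (n + 1)) (x : PolyForm 𝕜 n) :
    extDeriv 𝕜 n (coneHomotopy 𝕜 i x) + coneHomotopy 𝕜 i (extDeriv 𝕜 n x) =
      x - vertexEval 𝕜 i x • 1 := by
  suffices h : extDeriv 𝕜 n ∘ₗ coneHomotopy 𝕜 i + coneHomotopy 𝕜 i ∘ₗ extDeriv 𝕜 n =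
      LinearMap.id - (vertexEval 𝕜 i).toLinearMap.smulRight 1 from LinearMap.congr_fun h x
  refine PolyForm.hom_ext fun k p w hw => ?_
  simp only [LinearMap.add_apply, LinearMap.comp_apply, LinearMap.sub_apply, LinearMap.id_apply,
    LinearMap.smulRight_apply, AlgHom.toLinearMap_apply]
  rcases k with _ | k
  · rw [coneHomotopy_mk_zero i p hw, map_zero, zero_add, extDeriv_mk, map_sum]
    simp only [coneHomotopy_mk i _ (ι_mul_mem _ hw), eulerContract_mk]
    simp only [contract_ι_mul, contract_eq_zero _ hw, mul_zero, sub_zero, PolyForm.mk_smul]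
    obtain ⟨c, rfl⟩ := mem_extPower_zero hw
    rw [vertexEval_mk, map_smul, map_one, smul_eq_mul, mul_one, mul_smul, PolyForm.mk_smul,
      smul_comm, ← smul_sub, ← PolyForm.mk_one_one, ← PolyForm.smul_mk, ← PolyForm.sub_mk]
    have h := euler_radialIntegral_zero i p
    rw [MvPolynomial.C_eq_smul_one] at h
    rw [← h, PolyForm.sum_mk, Finset.smul_sum]
    refine Finset.sum_congr rfl fun j _ => ?_
    rw [Finset.sum_eq_single j]
    · simp [PolyForm.mk_smul]
    · intro l _ hl; simp [hl]
    · simp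
  · have h3 : coneHomotopy 𝕜 i (extDeriv 𝕜 n (PolyForm.mk p w)) =
        eulerContract 𝕜 i (extDeriv 𝕜 n (PolyForm.mk (radialIntegral i k p) w)) := by
      rw [extDeriv_mk, extDeriv_mk, map_sum, map_sum]
      refine Finset.sum_congr rfl fun j _ => ?_
      rw [coneHomotopy_mk i _ (ι_mul_mem _ hw), pderiv_radialIntegral]
    rw [h3, coneHomotopy_mk i p hw, extDeriv_eulerContract i _ hw, euler_radialIntegral,
      vertexEval_mk, algebraMapInv_eq_zero hw, mul_zero, zero_smul, sub_zero]

end Cone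

/-! ### Pull-back along affine maps -/

section Pullback

variable {𝕜 : Type*} [Field 𝕜] {n k : ℕ}

lemma sum_bary : ∑ a : Fin (n + 1), bary 𝕜 a = 1 := by
  rw [Fin.sum_univ_succ]
  simp [bary]

lemma sum_dbary : ∑ a : Fin (n + 1), dbary 𝕜 a = 0 := by
  rw [Fin.sum_univ_succ]
  ext j
  simp [dbary, Finset.sum_apply, Pi.single_apply]

lemma sum_vertex (i : Fin (n + 1)) : ∑ j, vertex 𝕜 i j = if i = 0 then 0 else 1 := by
  simp only [vertex]
  induction i using Fin.cases with
  | zero => simp [(Fin.succ_ne_zero _).symm]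
  | succ i => simp [Fin.succ_inj]

lemma aeval_vertex_bary (i a : Fin (n + 1)) :
    MvPolynomial.aeval (vertex 𝕜 i) (bary 𝕜 a) = if a = i then 1 else 0 := by
  induction a using Fin.cases with
  | zero =>
    simp only [bary, Fin.cons_zero, map_sub, map_one, map_sum, MvPolynomial.aeval_X, sum_vertex]
    by_cases h : i = 0
    · simp [h]
    · simp [h, Ne.symm h]
  | succ a => simp [bary, vertex, eq_comm]

lemma dilation_bary (i a : Fin (n + 1)) :
    dilation 𝕜 i (bary 𝕜 a) = Polynomial.X * Polynomial.C (bary 𝕜 a) +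
      (1 - Polynomial.X) * Polynomial.C (MvPolynomial.C (if a = i then 1 else 0)) := by
  rw [← aeval_vertex_bary]
  induction a using Fin.cases with
  | zero =>
    simp only [bary, Fin.cons_zero, map_sub, map_one, map_sum, MvPolynomial.aeval_X, dilation,
      Finset.sum_add_distrib, ← Finset.mul_sum]
    ring
  | succ a => simp [bary, dilation]

variable (𝕜) in
/-- The pull-back of polynomials along an affine map of simplices. -/
def pullPoly (v : Fin (k + 1) → Fin (n + 1)) : MvPolynomial (Fin n) 𝕜 →ₐ[𝕜] MvPolynomial (Fin k) 𝕜 :=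
  MvPolynomial.aeval fun j : Fin n => ∑ a : Fin (k + 1) with v a = j.succ, bary 𝕜 a

variable (𝕜) in
/-- The pull-back of constant one-forms along an affine map of simplices. -/
def pullCovec (v : Fin (k + 1) → Fin (n + 1)) : (Fin n → 𝕜) →ₗ[𝕜] (Fin k → 𝕜) :=
  Fintype.linearCombination 𝕜 fun j : Fin n => ∑ a : Fin (k + 1) with v a = j.succ, dbary 𝕜 a

lemma pullback_mk (v : Fin (k + 1) → Fin (n + 1)) (p : MvPolynomial (Fin n) 𝕜)
    (w : ExteriorAlgebra 𝕜 (Fin n → 𝕜)) : pullback 𝕜 v (PolyForm.mk p w) =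
      PolyForm.mk (pullPoly 𝕜 v p) (ExteriorAlgebra.map (pullCovec 𝕜 v) w) := rfl

lemma pullPoly_X (v : Fin (k + 1) → Fin (n + 1)) (j : Fin n) :
    pullPoly 𝕜 v (MvPolynomial.X j) = ∑ a : Fin (k + 1) with v a = j.succ, bary 𝕜 a :=
  MvPolynomial.aeval_X _ _

lemma vertex_comp (v : Fin (k + 1) → Fin (n + 1)) (i : Fin (k + 1)) (j : Fin n) :
    vertex 𝕜 (v i) j = ∑ a : Fin (k + 1) with v a = j.succ, if a = i then 1 else 0 := by
  rw [Finset.sum_ite_eq']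
  simp [vertex]

lemma vertexEval_pullback (v : Fin (k + 1) → Fin (n + 1)) (i : Fin (k + 1)) (x : PolyForm 𝕜 n) :
    vertexEval 𝕜 i (pullback 𝕜 v x) = vertexEval 𝕜 (v i) x := by
  suffices h : (vertexEval 𝕜 i).toLinearMap ∘ₗ pullback 𝕜 v = (vertexEval 𝕜 (v i)).toLinearMap from
    LinearMap.congr_fun h x
  refine PolyForm.hom_ext_mk fun p w => ?_
  simp only [LinearMap.comp_apply, AlgHom.toLinearMap_apply]
  rw [pullback_mk, vertexEval_mk, vertexEval_mk]
  congr 1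
  · have : (MvPolynomial.aeval (vertex 𝕜 i)).comp (pullPoly 𝕜 v) =
        MvPolynomial.aeval (vertex 𝕜 (v i)) := by
      ext j
      rw [AlgHom.comp_apply, pullPoly_X, map_sum, MvPolynomial.aeval_X, vertex_comp]
      exact Finset.sum_congr rfl fun a _ => aeval_vertex_bary i a
    exact DFunLike.congr_fun this p
  · have : ExteriorAlgebra.algebraMapInv.comp (ExteriorAlgebra.map (pullCovec 𝕜 v)) =
        (ExteriorAlgebra.algebraMapInv : _ →ₐ[𝕜] 𝕜) := by
      refine ExteriorAlgebra.hom_ext ?_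
      ext j
      simp [ExteriorAlgebra.algebraMapInv]
    exact DFunLike.congr_fun this w

lemma pullPoly_dilation (v : Fin (k + 1) → Fin (n + 1)) (i : Fin (k + 1))
    (p : MvPolynomial (Fin n) 𝕜) :
    (dilation 𝕜 (v i) p).map (pullPoly 𝕜 v : MvPolynomial (Fin n) 𝕜 →+* _) =
      dilation 𝕜 i (pullPoly 𝕜 v p) := by
  have : (Polynomial.mapAlgHom (pullPoly 𝕜 v)).comp (dilation 𝕜 (v i)) =
      (dilation 𝕜 i).comp (pullPoly 𝕜 v) := by
    ext1 j
    have hC : ∀ c : 𝕜, pullPoly 𝕜 v (MvPolynomial.C c) = MvPolynomial.C c :=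
      fun c => (pullPoly 𝕜 v).commutes c
    have hX : dilation 𝕜 (v i) (MvPolynomial.X j) = Polynomial.X * Polynomial.C (MvPolynomial.X j) +
      (1 - Polynomial.X) * Polynomial.C (MvPolynomial.C (vertex 𝕜 (v i) j)) :=
      MvPolynomial.aeval_X _ _
    rw [AlgHom.comp_apply, AlgHom.comp_apply, pullPoly_X, map_sum, hX]
    simp only [dilation_bary, Polynomial.map_add, Polynomial.map_mul, Polynomial.map_sub,
      Polynomial.map_one, Polynomial.coe_mapAlgHom, Polynomial.map_X, Polynomial.map_C,
      Finset.sum_add_distrib, ← Finset.mul_sum, vertex_comp v i j]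
    simp only [RingHom.coe_coe, pullPoly_X, hC, map_sum]
  exact DFunLike.congr_fun this p

lemma pullPoly_radialIntegral (v : Fin (k + 1) → Fin (n + 1)) (i : Fin (k + 1)) (m : ℕ)
    (p : MvPolynomial (Fin n) 𝕜) :
    pullPoly 𝕜 v (radialIntegral (v i) m p) = radialIntegral i m (pullPoly 𝕜 v p) := by
  simp only [radialIntegral, LinearMap.comp_apply, LinearMap.mulLeft_apply,
    AlgHom.toLinearMap_apply]
  rw [← unitIntegral_map, Polynomial.map_mul, pullPoly_dilation, Polynomial.map_pow,
    Polynomial.map_X]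

lemma sum_centred_dbary (i a : Fin (n + 1)) :
    ∑ b, centred 𝕜 i b * MvPolynomial.C (dbary 𝕜 a b) =
      bary 𝕜 a - MvPolynomial.C (if a = i then 1 else 0) := by
  rw [← aeval_vertex_bary]
  induction a using Fin.cases with
  | zero =>
    simp only [bary, dbary, centred, Fin.cons_zero, map_sub, map_one, map_sum,
      MvPolynomial.aeval_X, map_neg, mul_neg, mul_one, Finset.sum_neg_distrib,
      Finset.sum_sub_distrib]
    ring
  | succ a => 
    simp [bary, dbary, centred, Pi.single_apply]

lemma pullback_eulerContract (v : Fin (k + 1) → Fin (n + 1)) (i : Fin (k + 1))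
    (p : MvPolynomial (Fin n) 𝕜) (w : ExteriorAlgebra 𝕜 (Fin n → 𝕜)) :
    pullback 𝕜 v (eulerContract 𝕜 (v i) (PolyForm.mk p w)) =
      eulerContract 𝕜 i (pullback 𝕜 v (PolyForm.mk p w)) := by
  have hd : ∀ b : Fin k, (LinearMap.proj b : (Fin k → 𝕜) →ₗ[𝕜] 𝕜) ∘ₗ pullCovec 𝕜 v =
      ∑ j, (∑ a : Fin (k + 1) with v a = j.succ, dbary 𝕜 a b) •
        (LinearMap.proj j : (Fin n → 𝕜) →ₗ[𝕜] 𝕜) := by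
    intro b
    refine LinearMap.ext fun u => ?_
    simp [pullCovec, Fintype.linearCombination_apply, LinearMap.sum_apply, Finset.sum_apply,
      mul_comm]
  rw [eulerContract_mk, pullback_mk, eulerContract_mk, map_sum]
  simp only [pullback_mk, contract_map, hd, map_sum, LinearMap.sum_apply, map_smul,
    LinearMap.smul_apply, PolyForm.mk_sum, PolyForm.mk_smul]
  rw [Finset.sum_comm]
  refine Finset.sum_congr rfl fun j _ => ?_
  simp only [← PolyForm.smul_mk]
  rw [← PolyForm.sum_mk]
  congr 1
  simp only [← smul_mul_assoc]
  rw [map_mul, ← Finset.sum_mul]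
  congr 1
  simp only [MvPolynomial.smul_eq_C_mul, map_sum, Finset.sum_mul]
  rw [Finset.sum_comm]
  simp only [mul_comm (MvPolynomial.C _), sum_centred_dbary]
  rw [Finset.sum_sub_distrib, centred, map_sub, pullPoly_X, vertex_comp]
  congr 1
  rw [← map_sum]
  exact (pullPoly 𝕜 v).commutes _

/-- The cone homotopies are natural with respect to affine maps of simplices. -/
lemma pullback_coneHomotopy (v : Fin (k + 1) → Fin (n + 1)) (i : Fin (k + 1)) (x : PolyForm 𝕜 n) :
    pullback 𝕜 v (coneHomotopy 𝕜 (v i) x) = coneHomotopy 𝕜 i (pullback 𝕜 v x) := by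
  suffices h : pullback 𝕜 v ∘ₗ coneHomotopy 𝕜 (v i) = coneHomotopy 𝕜 i ∘ₗ pullback 𝕜 v from
    LinearMap.congr_fun h x
  refine PolyForm.hom_ext fun m p w hw => ?_
  rw [LinearMap.comp_apply, LinearMap.comp_apply, pullback_mk]
  rcases m with _ | m
  · rw [coneHomotopy_mk_zero _ _ hw, coneHomotopy_mk_zero _ _ (map_mem_extPower _ hw), map_zero]
  · rw [coneHomotopy_mk _ _ hw, coneHomotopy_mk _ _ (map_mem_extPower _ hw),
      pullback_eulerContract, pullback_mk, pullPoly_radialIntegral]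

end Pullback

section Integration

variable {𝕜 : Type*} [Field 𝕜] {n : ℕ}

/-- The functional `εⁱᵏ ∘ hⁱᵏ⁻¹ ∘ ⋯ ∘ hⁱ⁰` on forms. -/
def iterEval : List (Fin (n + 1)) → PolyForm 𝕜 n →ₗ[𝕜] 𝕜
  | [] => 0
  | [i] => (vertexEval 𝕜 i).toLinearMap
  | i :: j :: l => iterEval (j :: l) ∘ₗ coneHomotopy 𝕜 i

lemma iterEval_map {k : ℕ} (v : Fin (k + 1) → Fin (n + 1)) (l : List (Fin (k + 1)))
    (x : PolyForm 𝕜 n) : iterEval (l.map v) x = iterEval l (pullback 𝕜 v x) := by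
  induction l generalizing x with
  | nil => rfl
  | cons i l ih =>
    cases l with
    | nil => exact (vertexEval_pullback v i x).symm
    | cons j l =>
      simp only [List.map_cons, iterEval, LinearMap.comp_apply] at ih ⊢
      rw [ih, pullback_coneHomotopy]

/-- The functional `∫ tᵃ dt₁ ⋯ dtₖ` on polynomials. -/
def polyIntegral (𝕜 : Type*) [Field 𝕜] (k : ℕ) : MvPolynomial (Fin k) 𝕜 →ₗ[𝕜] 𝕜 :=
  (MvPolynomial.basisMonomials (Fin k) 𝕜).constr 𝕜 fun a : Fin k →₀ ℕ =>
      (∏ j, ((a j).factorial : 𝕜)) * (((∑ j, a j) + k).factorial : 𝕜)⁻¹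

/-- The coefficient of `dt₁ ⋯ dtₖ` in a constant form. -/
def topCoeff (𝕜 : Type*) [Field 𝕜] (k : ℕ) : ExteriorAlgebra 𝕜 (Fin k → 𝕜) →ₗ[𝕜] 𝕜 :=
  ExteriorAlgebra.liftAlternating (R := 𝕜) (M := Fin k → 𝕜) (N := 𝕜)
      (Pi.single k Matrix.detRowAlternating)

lemma simplexIntegral_mk (k : ℕ) (p : MvPolynomial (Fin k) 𝕜)
    (w : ExteriorAlgebra 𝕜 (Fin k → 𝕜)) :
    simplexIntegral 𝕜 k (PolyForm.mk p w) = polyIntegral 𝕜 k p * topCoeff 𝕜 k w := rfl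

lemma polyIntegral_monomial (k : ℕ) (a : Fin k →₀ ℕ) :
    polyIntegral 𝕜 k (MvPolynomial.monomial a 1) =
      (∏ j, ((a j).factorial : 𝕜)) * (((∑ j, a j) + k).factorial : 𝕜)⁻¹ := by
  have h : MvPolynomial.monomial a (1 : 𝕜) = MvPolynomial.basisMonomials (Fin k) 𝕜 a := by simp
  rw [polyIntegral, h, Module.Basis.constr_basis]

lemma topCoeff_eq_zero {k m : ℕ} (hm : m ≠ k) {w : ExteriorAlgebra 𝕜 (Fin k → 𝕜)}
    (hw : w ∈ ⋀[𝕜]^m (Fin k → 𝕜)) : topCoeff 𝕜 k w = 0 := by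
  refine extPower_induction (P := fun w => topCoeff 𝕜 k w = 0)
    (fun u => ?_) (map_zero _) ?_ ?_ hw
  · rw [topCoeff, ExteriorAlgebra.liftAlternating_apply_ιMulti, Pi.single_eq_of_ne hm]; rfl
  · intro x y hx hy; rw [map_add, hx, hy, add_zero]
  · intro c x hx; rw [map_smul, hx, smul_zero]

lemma topCoeff_ιMulti {k : ℕ} (u : Fin k → Fin k → 𝕜) :
    topCoeff 𝕜 k (ExteriorAlgebra.ιMulti 𝕜 k u) = Matrix.det (Matrix.of u) := by
  rw [topCoeff, ExteriorAlgebra.liftAlternating_apply_ιMulti, Pi.single_eq_same]; rfl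

variable [CharZero 𝕜]

/-- Dirichlet's integral. -/
lemma polyIntegral_dirichlet (k c : ℕ) (b : Fin k →₀ ℕ) :
    polyIntegral 𝕜 k (bary 𝕜 0 ^ c * MvPolynomial.monomial b 1) =
      (c.factorial : 𝕜) * (∏ j, ((b j).factorial : 𝕜)) *
        ((c + (∑ j, b j) + k).factorial : 𝕜)⁻¹ := by
  induction c generalizing b with
  | zero => rw [pow_zero, one_mul, polyIntegral_monomial]; simp
  | succ c ih =>
    have h1 : bary 𝕜 0 ^ (c + 1) * MvPolynomial.monomial b (1 : 𝕜) =
        bary 𝕜 0 ^ c * MvPolynomial.monomial b 1 -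
        ∑ j, bary 𝕜 0 ^ c * MvPolynomial.monomial (b + Finsupp.single j 1) 1 := by
      have : ∀ j, MvPolynomial.monomial (b + Finsupp.single j 1) (1 : 𝕜) =
          MvPolynomial.X j * MvPolynomial.monomial b 1 := by
        intro j
        rw [add_comm, MvPolynomial.monomial_single_add, pow_one]
      simp only [this, ← Finset.mul_sum, ← Finset.sum_mul]
      rw [pow_succ]
      nth_rewrite 2 [bary]
      rw [Fin.cons_zero]
      ring
    have h2 : ∀ j, (∏ l, (((b + Finsupp.single j 1 : Fin k →₀ ℕ) l).factorial : 𝕜)) =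
        ((b j + 1 : ℕ) : 𝕜) * ∏ l, ((b l).factorial : 𝕜) := by
      intro j
      rw [← Finset.mul_prod_erase _ _ (Finset.mem_univ j),
        ← Finset.mul_prod_erase _ (fun l => ((b l).factorial : 𝕜)) (Finset.mem_univ j), ← mul_assoc]
      congr 1
      · simp [Nat.factorial_succ]
      · refine Finset.prod_congr rfl fun l hl => ?_
        simp [(Finset.ne_of_mem_erase hl).symm]
    have h3 : ∀ j, c + ∑ l, (b + Finsupp.single j 1 : Fin k →₀ ℕ) l + k = c + ∑ l, b l + k + 1 := by
      intro j
      simp only [Finsupp.add_apply, Finset.sum_add_distrib]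
      simp [Finsupp.single_apply]
      omega
    have h4 : c + 1 + ∑ l, b l + k = c + ∑ l, b l + k + 1 := by omega
    rw [h1, map_sub, map_sum, ih]
    simp only [ih, h2, h3, h4, Nat.factorial_succ (c + ∑ l, b l + k)]
    rw [← Finset.sum_mul, ← Finset.mul_sum, ← Finset.sum_mul, Nat.factorial_succ c]
    have h5 : ((c + ∑ l, b l + k + 1 : ℕ) : 𝕜) ≠ 0 := Nat.cast_ne_zero.2 (by omega)
    have h6 : ((c + ∑ l, b l + k).factorial : 𝕜) ≠ 0 :=
      Nat.cast_ne_zero.2 (Nat.factorial_ne_zero _)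
    have h7 : ∑ i, ((b i + 1 : ℕ) : 𝕜) = ((∑ l, b l + k : ℕ) : 𝕜) := by
      push_cast
      rw [Finset.sum_add_distrib]
      simp
    rw [h7]
    push_cast at h5 ⊢
    field_simp
    ring

end Integration

/-! ### Integration over faces as iterated cone homotopies -/

section Stokes

variable {𝕜 : Type*} [Field 𝕜] {n : ℕ}

lemma pullPoly_succ_X (k : ℕ) (j : Fin (k + 1)) :
    pullPoly 𝕜 (Fin.succ : Fin (k + 1) → Fin (k + 2)) (MvPolynomial.X j) = bary 𝕜 j := by
  rw [pullPoly_X]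
  simp [Fin.succ_inj, Finset.filter_eq']

lemma pullCovec_succ_single (k : ℕ) (j : Fin (k + 1)) :
    pullCovec 𝕜 (Fin.succ : Fin (k + 1) → Fin (k + 2)) (Pi.single j 1) = dbary 𝕜 j := by
  rw [pullCovec, Fintype.linearCombination_apply_single]
  simp [Fin.succ_inj, Finset.filter_eq']

/-- On the face of `Δₖ₊₁` opposite to the vertex `0`, the contraction of a top form with any of the
coordinate fields is the top form of the face. -/
lemma topCoeff_map_contract (k : ℕ) (j : Fin (k + 1))
    {w : ExteriorAlgebra 𝕜 (Fin (k + 1) → 𝕜)} (hw : w ∈ ⋀[𝕜]^(k + 1) (Fin (k + 1) → 𝕜)) :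
    topCoeff 𝕜 k (ExteriorAlgebra.map (pullCovec 𝕜 (Fin.succ : Fin (k + 1) → Fin (k + 2)))
      (contract (LinearMap.proj j) w)) = topCoeff 𝕜 (k + 1) w := by
  set L := pullCovec 𝕜 (Fin.succ : Fin (k + 1) → Fin (k + 2)) with hL
  let F : ExteriorAlgebra 𝕜 (Fin (k + 1) → 𝕜) →ₗ[𝕜] 𝕜 :=
    topCoeff 𝕜 k ∘ₗ (ExteriorAlgebra.map L).toLinearMap ∘ₗ contract (LinearMap.proj j)
  let Φ : (Fin (k + 1) → 𝕜) [⋀^Fin (k + 1)]→ₗ[𝕜] 𝕜 :=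
    F.compAlternatingMap (ExteriorAlgebra.ιMulti 𝕜 (k + 1))
  let e : Fin (k + 1) → Fin (k + 1) → 𝕜 := fun j => Pi.single j 1
  have hΦ : Φ = Φ e • Matrix.detRowAlternating := by
    have := Φ.eq_smul_basis_det (Pi.basisFun 𝕜 (Fin (k + 1)))
    rw [Pi.basisFun_det] at this
    convert this using 3
    ext l; simp [e]
  have h1 : Φ (Function.update e 0 (∑ l, e l)) = Φ e := by
    rw [AlternatingMap.map_update_sum, Finset.sum_eq_single 0]
    · rw [Function.update_eq_self]
    · intro l _ hl
      exact Φ.map_update_self e (Ne.symm hl)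
    · simp
  have h2 : Function.update e 0 (∑ l, e l) = Fin.cons (∑ l, e l) (fun m => e m.succ) := by
    ext m : 1
    induction m using Fin.cases with
    | zero => simp
    | succ m => simp
  have hs : L (∑ l, e l) = 0 := by
    rw [map_sum]
    simp only [e, hL, pullCovec_succ_single]
    exact sum_dbary
  have h3 : Φ e = 1 := by
    rw [← h1, h2]
    have hc : ExteriorAlgebra.ιMulti 𝕜 (k + 1)
        (Fin.cons (∑ l, e l) (fun m => e m.succ) : Fin (k + 1) → Fin (k + 1) → 𝕜) =
        ExteriorAlgebra.ι 𝕜 (∑ l, e l) * ExteriorAlgebra.ιMulti 𝕜 k (fun m : Fin k => e m.succ) := by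
      rw [ExteriorAlgebra.ιMulti_succ_apply]; rfl
    have hj : (∑ l, e l) j = 1 := by simp [e, Finset.sum_apply, Pi.single_apply]
    change topCoeff 𝕜 k (ExteriorAlgebra.map L (contract (LinearMap.proj j)
      (ExteriorAlgebra.ιMulti 𝕜 (k + 1) _))) = 1
    rw [hc, contract_ι_mul, map_sub, map_mul, ExteriorAlgebra.map_apply_ι, hs, map_zero, zero_mul,
      sub_zero, LinearMap.proj_apply, hj, one_smul, ExteriorAlgebra.map_apply_ιMulti,
      topCoeff_ιMulti]
    have : Matrix.of (L ∘ fun m : Fin k => e m.succ) = 1 := by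
      ext a b
      simp [e, hL, pullCovec_succ_single, dbary, Matrix.one_apply, Pi.single_apply, eq_comm]
    rw [this, Matrix.det_one]
  rw [h3, one_smul] at hΦ
  refine extPower_induction (P := fun w => F w = topCoeff 𝕜 (k + 1) w) (fun u => ?_) (by simp)
    ?_ ?_ hw
  · rw [topCoeff_ιMulti]
    exact DFunLike.congr_fun hΦ u
  · intro x y hx hy; rw [map_add, map_add, hx, hy]
  · intro c x hx; rw [map_smul, map_smul, hx]

variable [CharZero 𝕜]

lemma polyIntegral_succ (k : ℕ) (p : MvPolynomial (Fin (k + 1)) 𝕜) :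
    polyIntegral 𝕜 k (pullPoly 𝕜 (Fin.succ : Fin (k + 1) → Fin (k + 2)) (radialIntegral 0 k p)) =
      polyIntegral 𝕜 (k + 1) p := by
  suffices h : polyIntegral 𝕜 k ∘ₗ (pullPoly 𝕜 (Fin.succ : Fin (k + 1) → Fin (k + 2))).toLinearMap
      ∘ₗ radialIntegral 0 k = polyIntegral 𝕜 (k + 1) from LinearMap.congr_fun h p
  have hc : centre 𝕜 (0 : Fin (k + 2)) = AlgHom.id 𝕜 _ := by
    ext j : 1
    simp [centre, centred, vertex, (Fin.succ_ne_zero _).symm]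
  refine centred_hom_ext 0 fun a => ?_
  have ha := MvPolynomial.isHomogeneous_monomial (1 : 𝕜) (Eq.refl a.degree)
  simp only [LinearMap.comp_apply, AlgHom.toLinearMap_apply]
  rw [radialIntegral_centre 0 k ha, hc, AlgHom.id_apply, map_smul, map_smul, polyIntegral_monomial]
  have hm : pullPoly 𝕜 (Fin.succ : Fin (k + 1) → Fin (k + 2)) (MvPolynomial.monomial a 1) =
      bary 𝕜 0 ^ (a 0) * MvPolynomial.monomial (Finsupp.equivFunOnFinite.symm fun j => a j.succ) 1 := by
    rw [MvPolynomial.monomial_eq, MvPolynomial.monomial_eq, Finsupp.prod_fintype _ _ (by simp),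
      Finsupp.prod_fintype _ _ (by simp), Fin.prod_univ_succ, map_mul, map_mul, map_pow,
      pullPoly_succ_X, map_prod]
    simp only [map_one, one_mul, map_pow, pullPoly_succ_X]
    rfl
  have hdeg : a.degree = a 0 + ∑ j : Fin k, a j.succ := by
    rw [Finsupp.degree_eq_sum, Fin.sum_univ_succ]
  rw [hm, polyIntegral_dirichlet, Fin.prod_univ_succ, hdeg, Fin.sum_univ_succ]
  have h1 : a 0 + ∑ j : Fin k, a j.succ + (k + 1) = (a 0 + ∑ j : Fin k, a j.succ + k) + 1 := by ring
  have h2 : k + (a 0 + ∑ j : Fin k, a j.succ) + 1 = (a 0 + ∑ j : Fin k, a j.succ + k) + 1 := by ring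
  simp only [Finsupp.equivFunOnFinite_symm_apply_apply]
  rw [h1, h2, Nat.factorial_succ, Nat.cast_mul, mul_inv, smul_eq_mul]
  ring

/-- The integral over a simplex is the cone homotopy to its first vertex, integrated over the
opposite face. -/
lemma simplexIntegral_succ (k : ℕ) (x : PolyForm 𝕜 (k + 1)) :
    simplexIntegral 𝕜 (k + 1) x =
      simplexIntegral 𝕜 k (pullback 𝕜 Fin.succ (coneHomotopy 𝕜 0 x)) := by
  suffices h : simplexIntegral 𝕜 (k + 1) =
      simplexIntegral 𝕜 k ∘ₗ pullback 𝕜 Fin.succ ∘ₗ coneHomotopy 𝕜 0 from LinearMap.congr_fun h x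
  refine PolyForm.hom_ext fun m p w hw => ?_
  rw [LinearMap.comp_apply, LinearMap.comp_apply, simplexIntegral_mk]
  rcases m with _ | m
  · rw [coneHomotopy_mk_zero _ _ hw, map_zero, map_zero, topCoeff_eq_zero (by omega) hw, mul_zero]
  · rw [coneHomotopy_mk _ _ hw, eulerContract_mk, map_sum, map_sum]
    simp only [pullback_mk, simplexIntegral_mk]
    by_cases hm : m = k
    · subst hm
      simp only [topCoeff_map_contract m _ hw]
      rw [← Finset.sum_mul, ← polyIntegral_succ, ← map_sum]
      congr 2
      simp only [map_mul, ← Finset.sum_mul]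
      have : ∀ j, centred 𝕜 (0 : Fin (m + 2)) j = MvPolynomial.X j := fun j => by
        simp [centred, vertex, (Fin.succ_ne_zero _).symm]
      simp only [this, pullPoly_succ_X, sum_bary, one_mul]
    · rw [topCoeff_eq_zero (by omega) hw, mul_zero]
      refine (Finset.sum_eq_zero fun j _ => ?_).symm
      rw [topCoeff_eq_zero hm (map_mem_extPower _ (contract_mem _ hw)), mul_zero]

lemma simplexIntegral_eq_iterEval (k : ℕ) (x : PolyForm 𝕜 k) :
    simplexIntegral 𝕜 k x = iterEval (List.finRange (k + 1)) x := by
  induction k with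
  | zero =>
    suffices h : simplexIntegral 𝕜 0 = (vertexEval 𝕜 0).toLinearMap from LinearMap.congr_fun h x
    refine PolyForm.hom_ext fun m p w hw => ?_
    rw [AlgHom.toLinearMap_apply, vertexEval_mk, simplexIntegral_mk]
    rcases m with _ | m
    · obtain ⟨c, rfl⟩ := mem_extPower_zero hw
      have h1 : polyIntegral 𝕜 0 p = MvPolynomial.aeval (vertex 𝕜 0) p := by
        rw [MvPolynomial.eq_C_of_isEmpty p, MvPolynomial.C_eq_smul_one, map_smul, map_smul,
          map_one (MvPolynomial.aeval _), ← MvPolynomial.C_1, MvPolynomial.C_apply,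
          polyIntegral_monomial]
        simp
      have h2 : topCoeff 𝕜 0 (1 : ExteriorAlgebra 𝕜 (Fin 0 → 𝕜)) = 1 := by
        rw [← ExteriorAlgebra.ιMulti_zero_apply (R := 𝕜) (Fin.elim0 : Fin 0 → Fin 0 → 𝕜),
          topCoeff_ιMulti]
        simp
      rw [map_smul, map_smul, h1, h2, map_one]
    · rw [extPower_eq_zero (by omega) hw, map_zero, map_zero, mul_zero, mul_zero]
  | succ k ih =>
    rw [simplexIntegral_succ, ih, ← iterEval_map, List.finRange_succ (n := k + 1)]
    conv_rhs => rw [List.finRange_succ (n := k)]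
    rw [List.finRange_succ (n := k)]
    rfl

/-- Integration over a face is an iterated cone homotopy followed by evaluation at a vertex. -/
lemma faceIntegral_eq_iterEval (σ : Face (n + 1)) :
    faceIntegral 𝕜 σ = iterEval (σ.1.sort (· ≤ ·)) := by
  refine LinearMap.ext fun x => ?_
  rw [faceIntegral, LinearMap.comp_apply, simplexIntegral_eq_iterEval, ← iterEval_map]
  congr 2
  rw [← List.ofFn_eq_map]
  refine List.ext_getElem ?_ fun m h1 h2 => ?_
  · simp [Nat.sub_add_cancel σ.2.card_pos]
  · rw [List.getElem_ofFn, Finset.orderEmbOfFin_apply]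
    rfl

end Stokes

/-! ### Whitney forms, Stokes' theorem and Dupont's homotopy -/

section Whitney

variable {𝕜 : Type*} [Field 𝕜] {n : ℕ}

lemma sort_insert_min {α : Type*} [LinearOrder α] {a : α} {S : Finset α} (h : ∀ x ∈ S, a < x) :
    (insert a S).sort (· ≤ ·) = a :: S.sort (· ≤ ·) :=
  Finset.sort_insert _ (fun b hb => (h b hb).le) fun ha => lt_irrefl _ (h a ha)

/-- The number of elements of `S` before `a`. -/
def posIn {α : Type*} [LinearOrder α] (S : Finset α) (a : α) : ℕ := (S.filter (· < a)).card

section posIn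

variable {α : Type*} [LinearOrder α]

lemma posIn_eq_zero {S : Finset α} {a : α} (h : ∀ x ∈ S, a ≤ x) : posIn S a = 0 := by
  rw [posIn, Finset.card_eq_zero, Finset.filter_eq_empty_iff]
  exact fun x hx => not_lt.2 (h x hx)

lemma posIn_insert {S : Finset α} {a i : α} (hi : i ∉ S) :
    posIn (insert i S) a = posIn S a + if i < a then 1 else 0 := by
  unfold posIn
  rw [Finset.filter_insert]
  split_ifs with h
  · rw [Finset.card_insert_of_notMem (by simp [hi])]
  · rfl

lemma posIn_erase {S : Finset α} {a i : α} (hi : i ∈ S) :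
    posIn S a = posIn (S.erase i) a + if i < a then 1 else 0 := by
  rw [← posIn_insert (Finset.notMem_erase i S), Finset.insert_erase hi]

lemma posIn_erase_self {S : Finset α} {a : α} : posIn (S.erase a) a = posIn S a := by
  by_cases h : a ∈ S
  · rw [posIn_erase h, if_neg (lt_irrefl a), add_zero]
  · rw [Finset.erase_eq_of_notMem h]

lemma posIn_insert_self {S : Finset α} {a : α} : posIn (insert a S) a = posIn S a := by
  by_cases h : a ∈ S
  · rw [Finset.insert_eq_of_mem h]
  · rw [posIn_insert h, if_neg (lt_irrefl a), add_zero]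

end posIn

variable (𝕜) in
/-- The product `dt_{i₀} ∧ ⋯ ∧ dt_{iₖ}` over the elements `i₀ < ⋯ < iₖ` of `S`. -/
def wedge (S : Finset (Fin (n + 1))) : ExteriorAlgebra 𝕜 (Fin n → 𝕜) :=
  ((S.sort (· ≤ ·)).map fun b => ExteriorAlgebra.ι 𝕜 (dbary 𝕜 b)).prod

lemma wedge_insert_min {S : Finset (Fin (n + 1))} {a : Fin (n + 1)} (h : ∀ x ∈ S, a < x) :
    wedge 𝕜 (insert a S) = ExteriorAlgebra.ι 𝕜 (dbary 𝕜 a) * wedge 𝕜 S := by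
  rw [wedge, sort_insert_min h, List.map_cons, List.prod_cons]; rfl

lemma wedge_mem (S : Finset (Fin (n + 1))) : wedge 𝕜 S ∈ ⋀[𝕜]^S.card (Fin n → 𝕜) := by
  induction S using Finset.induction_on_min with
  | empty => simp [wedge]
  | insert a S h ih =>
    rw [wedge_insert_min h, Finset.card_insert_of_notMem fun ha => lt_irrefl _ (h a ha)]
    exact ι_mul_mem _ ih

lemma ι_mul_wedge (S : Finset (Fin (n + 1))) (a : Fin (n + 1)) :
    ExteriorAlgebra.ι 𝕜 (dbary 𝕜 a) * wedge 𝕜 S =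
      if a ∈ S then 0 else (-1 : 𝕜) ^ posIn S a • wedge 𝕜 (insert a S) := by
  induction S using Finset.induction_on_min with
  | empty =>
    rw [← wedge_insert_min (by simp)]
    simp [posIn]
  | insert m S h ih =>
    have hm : m ∉ S := fun hm => lt_irrefl _ (h m hm)
    rcases lt_trichotomy a m with ham | rfl | ham
    · have h' : ∀ x ∈ insert m S, a < x := fun x hx => by
        rcases Finset.mem_insert.1 hx with rfl | hx
        · exact ham
        · exact ham.trans (h x hx)
      rw [if_neg fun ha => lt_irrefl _ (h' a ha), posIn_eq_zero fun x hx => (h' x hx).le, pow_zero,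
        one_smul, wedge_insert_min h']
    · rw [if_pos (Finset.mem_insert_self _ _), wedge_insert_min h, ← mul_assoc,
        ExteriorAlgebra.ι_sq_zero, zero_mul]
    · rw [wedge_insert_min h, ← mul_assoc,
        eq_neg_of_add_eq_zero_left (ExteriorAlgebra.ι_add_mul_swap _ _), neg_mul, mul_assoc, ih]
      by_cases haS : a ∈ S
      · rw [if_pos haS, if_pos (Finset.mem_insert_of_mem haS), mul_zero, neg_zero]
      · have h' : ∀ x ∈ insert a S, m < x := fun x hx => by
          rcases Finset.mem_insert.1 hx with rfl | hx
          · exact ham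
          · exact h x hx
        rw [if_neg haS, if_neg (by simp [ham.ne', haS]), Finset.insert_comm, wedge_insert_min h',
          posIn_insert hm, if_pos ham, pow_succ, mul_smul_comm]
        simp

lemma pderiv_bary (j : Fin n) (a : Fin (n + 1)) :
    MvPolynomial.pderiv j (bary 𝕜 a) = dbary 𝕜 a j • 1 := by
  induction a using Fin.cases with
  | zero =>
    simp only [bary, dbary, Fin.cons_zero, map_sub, map_sum, MvPolynomial.pderiv_X]
    simp [Pi.single_apply]
  | succ a =>
    simp only [bary, dbary, Fin.cons_succ, MvPolynomial.pderiv_X]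
    by_cases h : j = a
    · subst h; simp
    · simp [h, Ne.symm h]

lemma extDeriv_mk_bary (a : Fin (n + 1)) (w : ExteriorAlgebra 𝕜 (Fin n → 𝕜)) :
    extDeriv 𝕜 n (PolyForm.mk (bary 𝕜 a) w) =
      PolyForm.mk 1 (ExteriorAlgebra.ι 𝕜 (dbary 𝕜 a) * w) := by
  rw [extDeriv_mk]
  simp only [pderiv_bary, PolyForm.smul_mk, ← PolyForm.mk_smul, ← PolyForm.mk_sum,
    ← smul_mul_assoc, ← Finset.sum_mul, ← map_smul, ← map_sum]
  congr 3
  ext j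
  simp [Finset.sum_apply, Pi.single_apply]

variable (𝕜) in
/-- Whitney's elementary form of a set of vertices; it is zero for the empty set. -/
def whitneySet (S : Finset (Fin (n + 1))) : PolyForm 𝕜 n :=
  ((S.card - 1).factorial : 𝕜) • ∑ a ∈ S,
    (-1 : 𝕜) ^ posIn S a • PolyForm.mk (bary 𝕜 a) (wedge 𝕜 (S.erase a))

lemma whitney_eq (σ : Face (n + 1)) : whitney 𝕜 σ = whitneySet 𝕜 σ.1 := rfl

lemma whitneySet_mem {S : Finset (Fin (n + 1))} {k : ℕ} (hk : S.card = k + 1) :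
    whitneySet 𝕜 S ∈ formDeg 𝕜 n k := by
  refine Submodule.smul_mem _ _ (Submodule.sum_mem _ fun a ha => Submodule.smul_mem _ _ ?_)
  refine mk_mem_formDeg _ ?_
  have := wedge_mem (𝕜 := 𝕜) (S.erase a)
  rwa [Finset.card_erase_of_mem ha, hk] at this

lemma whitneySet_singleton (a : Fin (n + 1)) : whitneySet 𝕜 {a} = PolyForm.mk (bary 𝕜 a) 1 := by
  simp [whitneySet, posIn, wedge, Finset.filter_singleton]

lemma sum_whitneySet_singleton : ∑ a : Fin (n + 1), whitneySet 𝕜 {a} = 1 := by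
  simp only [whitneySet_singleton]
  rw [← PolyForm.sum_mk, sum_bary, PolyForm.mk_one_one]

lemma extDeriv_whitneySet_eq {S : Finset (Fin (n + 1))} (hS : S.Nonempty) :
    extDeriv 𝕜 n (whitneySet 𝕜 S) = (S.card.factorial : 𝕜) • PolyForm.mk 1 (wedge 𝕜 S) := by
  have h1 : ∀ a ∈ S, extDeriv 𝕜 n ((-1 : 𝕜) ^ posIn S a •
      PolyForm.mk (bary 𝕜 a) (wedge 𝕜 (S.erase a))) = PolyForm.mk 1 (wedge 𝕜 S) := by
    intro a ha
    rw [map_smul, extDeriv_mk_bary, ι_mul_wedge, if_neg (Finset.notMem_erase a S),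
      Finset.insert_erase ha, PolyForm.mk_smul, smul_smul, posIn_erase_self, ← mul_pow]
    simp
  rw [whitneySet, map_smul, map_sum, Finset.sum_congr rfl h1, Finset.sum_const,
    ← Nat.cast_smul_eq_nsmul 𝕜, smul_smul, ← Nat.mul_factorial_pred hS.card_ne_zero, Nat.cast_mul,
    mul_comm]

/-- The differential of Whitney forms is the simplicial coboundary. -/
lemma extDeriv_whitneySet {S : Finset (Fin (n + 1))} (hS : S.Nonempty) :
    extDeriv 𝕜 n (whitneySet 𝕜 S) =
      ∑ i ∈ Sᶜ, (-1 : 𝕜) ^ posIn S i • whitneySet 𝕜 (insert i S) := by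
  have h1 : ∀ i ∈ Sᶜ, (-1 : 𝕜) ^ posIn S i • whitneySet 𝕜 (insert i S) =
      (S.card.factorial : 𝕜) • (PolyForm.mk (bary 𝕜 i) (wedge 𝕜 S) - ∑ a ∈ S,
        (-1 : 𝕜) ^ posIn S a • PolyForm.mk (bary 𝕜 a)
          (ExteriorAlgebra.ι 𝕜 (dbary 𝕜 i) * wedge 𝕜 (S.erase a))) := by
    intro i hi
    rw [Finset.mem_compl] at hi
    rw [whitneySet, Finset.card_insert_of_notMem hi, Nat.add_sub_cancel, smul_comm,
      Finset.sum_insert hi, smul_add, smul_smul, posIn_insert_self, ← mul_pow,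
      Finset.erase_insert hi, sub_eq_add_neg, ← Finset.sum_neg_distrib, Finset.smul_sum]
    simp only [mul_neg, mul_one, neg_neg, one_pow, one_smul]
    congr 2
    refine Finset.sum_congr rfl fun a ha => ?_
    have hai : a ≠ i := fun h => hi (h ▸ ha)
    rw [ι_mul_wedge, if_neg (by simp [hi]), Finset.erase_insert_of_ne hai.symm, smul_smul,
      PolyForm.mk_smul, smul_smul, ← neg_smul, posIn_erase (a := i) ha, posIn_insert hi]
    congr 1
    rcases lt_or_gt_of_ne hai with h | h
    · rw [if_pos h, if_neg h.not_gt, add_zero, pow_succ]; ring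
    · rw [if_neg h.not_gt, if_pos h, add_zero, pow_succ]; ring
  rw [extDeriv_whitneySet_eq hS, Finset.sum_congr rfl h1, ← Finset.smul_sum,
    Finset.sum_sub_distrib, Finset.sum_comm]
  congr 1
  have h2 : ∀ a ∈ S, ∑ i ∈ Sᶜ, (-1 : 𝕜) ^ posIn S a • PolyForm.mk (bary 𝕜 a)
          (ExteriorAlgebra.ι 𝕜 (dbary 𝕜 i) * wedge 𝕜 (S.erase a)) =
      - PolyForm.mk (bary 𝕜 a) (wedge 𝕜 S) := by
    intro a ha
    have h3 : ∑ i ∈ Sᶜ, ExteriorAlgebra.ι 𝕜 (dbary 𝕜 i) * wedge 𝕜 (S.erase a) =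
        - (ExteriorAlgebra.ι 𝕜 (dbary 𝕜 a) * wedge 𝕜 (S.erase a)) := by
      rw [eq_neg_iff_add_eq_zero]
      have h4 : ∑ i, ExteriorAlgebra.ι 𝕜 (dbary 𝕜 i) * wedge 𝕜 (S.erase a) = 0 := by
        rw [← Finset.sum_mul, ← map_sum, sum_dbary, map_zero, zero_mul]
      rw [← Finset.sum_compl_add_sum S] at h4
      rw [← h4]
      congr 1
      rw [Finset.sum_eq_single_of_mem a ha fun b hb hba => by
        rw [ι_mul_wedge, if_pos (Finset.mem_erase.2 ⟨hba, hb⟩)]]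
    rw [← Finset.smul_sum, ← PolyForm.mk_sum, h3, ι_mul_wedge, if_neg (Finset.notMem_erase a S),
      Finset.insert_erase ha, PolyForm.mk_neg, PolyForm.mk_smul, smul_neg, smul_smul,
      posIn_erase_self, ← mul_pow]
    simp
  rw [Finset.sum_congr rfl h2, Finset.sum_neg_distrib, sub_neg_eq_add, ← PolyForm.sum_mk,
    ← PolyForm.sum_mk, ← PolyForm.add_mk, Finset.sum_compl_add_sum, sum_bary]

end Whitney

section AltSum

/-- The alternating sum `∑ⱼ (-1)ʲ F(l without its j-th element)`. -/
def altSum {α M : Type*} [AddCommGroup M] : (List α → M) → List α → M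
  | _, [] => 0
  | F, i :: l => F l - altSum (fun l' => F (i :: l')) l

variable {α M : Type*} [AddCommGroup M]

/-- The recursive alternating sum over a sorted list is the usual sum with simplicial signs. -/
lemma altSum_sort [LinearOrder α] {R : Type*} [Ring R] [Module R M] (F : List α → M)
    (S : Finset α) : altSum F (S.sort (· ≤ ·)) =
      ∑ a ∈ S, (-1 : R) ^ posIn S a • F ((S.erase a).sort (· ≤ ·)) := by
  induction S using Finset.induction_on_min generalizing F with
  | empty => simp [altSum]
  | insert m S h ih =>
    have hm : m ∉ S := fun hm => lt_irrefl _ (h m hm)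
    rw [sort_insert_min h, altSum, ih, Finset.sum_insert hm, Finset.erase_insert hm,
      posIn_insert_self, posIn_eq_zero fun x hx => (h x hx).le, pow_zero, one_smul, sub_eq_add_neg,
      ← Finset.sum_neg_distrib]
    congr 1
    refine Finset.sum_congr rfl fun a ha => ?_
    rw [posIn_insert hm, if_pos (h a ha), Finset.erase_insert_of_ne (h a ha).ne,
      sort_insert_min fun x hx => h x (Finset.mem_of_mem_erase hx), pow_succ]
    simp

lemma sum_insert_eq_sum_erase [Fintype α] [DecidableEq α] (g : Finset α → α → M) :
    ∑ S : Finset α, ∑ i ∈ Sᶜ, g S i = ∑ T : Finset α, ∑ i ∈ T, g (T.erase i) i := by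
  rw [Finset.sum_sigma', Finset.sum_sigma']
  refine Finset.sum_bij' (fun x _ => ⟨insert x.2 x.1, x.2⟩) (fun x _ => ⟨x.1.erase x.2, x.2⟩)
    ?_ ?_ ?_ ?_ ?_
  · intro x _; simp
  · intro x _; simp
  · rintro ⟨S, i⟩ h
    simp only [Finset.mem_sigma, Finset.mem_univ, Finset.mem_compl, true_and] at h
    simp [Finset.erase_insert h]
  · rintro ⟨S, i⟩ h
    simp only [Finset.mem_sigma, Finset.mem_univ, true_and] at h
    simp [Finset.insert_erase h]
  · rintro ⟨S, i⟩ h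
    simp only [Finset.mem_sigma, Finset.mem_univ, Finset.mem_compl, true_and] at h
    simp [Finset.erase_insert h]

end AltSum

section Dupont

variable {𝕜 : Type*} [Field 𝕜] {n : ℕ}

/-- The iterated cone homotopy `hⁱᵏ ∘ ⋯ ∘ hⁱ⁰`. -/
def iterCone : List (Fin (n + 1)) → PolyForm 𝕜 n →ₗ[𝕜] PolyForm 𝕜 n
  | [] => LinearMap.id
  | i :: l => iterCone l ∘ₗ coneHomotopy 𝕜 i

lemma prod_reverse_map_coneHomotopy (l : List (Fin (n + 1))) :
    (l.reverse.map fun i => (coneHomotopy 𝕜 i : Module.End 𝕜 (PolyForm 𝕜 n))).prod =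
      iterCone l := by
  induction l with
  | nil => rfl
  | cons i l ih =>
    rw [List.reverse_cons, List.map_append, List.prod_append, ih]
    simp [iterCone, Module.End.mul_eq_comp]

lemma iterEval_cons {i : Fin (n + 1)} {l : List (Fin (n + 1))} (hl : l ≠ []) :
    iterEval (𝕜 := 𝕜) (i :: l) = iterEval l ∘ₗ coneHomotopy 𝕜 i := by
  cases l with
  | nil => exact absurd rfl hl
  | cons j l => rfl

lemma iterCone_one {l : List (Fin (n + 1))} (hl : l ≠ []) : iterCone (𝕜 := 𝕜) l 1 = 0 := by
  cases l with
  | nil => exact absurd rfl hl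
  | cons j l =>
    rw [iterCone, LinearMap.comp_apply, coneHomotopy_of_zero j one_mem_formDeg, map_zero]

lemma iterEval_one (i j : Fin (n + 1)) (l : List (Fin (n + 1))) :
    iterEval (𝕜 := 𝕜) (i :: j :: l) 1 = 0 := by
  rw [iterEval, LinearMap.comp_apply, coneHomotopy_of_zero i one_mem_formDeg, map_zero]

variable [CharZero 𝕜]

lemma coneHomotopy_extDeriv (i : Fin (n + 1)) (x : PolyForm 𝕜 n) :
    coneHomotopy 𝕜 i (extDeriv 𝕜 n x) =
      x - vertexEval 𝕜 i x • 1 - extDeriv 𝕜 n (coneHomotopy 𝕜 i x) := by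
  rw [← extDeriv_coneHomotopy, add_sub_cancel_left]

/-- Stokes' theorem. -/
lemma iterEval_extDeriv (l : List (Fin (n + 1))) (x : PolyForm 𝕜 n) :
    iterEval l (extDeriv 𝕜 n x) = altSum (fun l' => iterEval l' x) l := by
  induction l generalizing x with
  | nil => simp [iterEval, altSum]
  | cons i l ih =>
    have h0 : ∀ i, ∀ x, vertexEval 𝕜 i (extDeriv 𝕜 n x) = 0 := fun i x => by
      suffices h : (vertexEval 𝕜 i).toLinearMap ∘ₗ extDeriv 𝕜 n = 0 from LinearMap.congr_fun h x
      exact PolyForm.hom_ext_formDeg fun k x hx => vertexEval_of_succ i (extDeriv_mem hx)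
    rcases l with _ | ⟨j, l⟩
    · simp [iterEval, altSum, h0]
    rw [iterEval, LinearMap.comp_apply, coneHomotopy_extDeriv, map_sub, map_sub, map_smul,
      ih, altSum]
    rcases l with _ | ⟨k, l⟩
    · simp [iterEval, altSum]
    · rw [iterEval_one, smul_zero, sub_zero]
      rfl

/-- The commutator of the exterior differential with an iterated cone homotopy: the faces of the
list, and a constant which is the integral over the simplex that the list spans. -/
lemma iterCone_extDeriv (l : List (Fin (n + 1))) (x : PolyForm 𝕜 n) :
    iterCone l (extDeriv 𝕜 n x) = (-1 : 𝕜) ^ l.length • extDeriv 𝕜 n (iterCone l x) +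
      altSum (fun l' => iterCone l' x) l + ((-1 : 𝕜) ^ l.length * iterEval l x) • 1 := by
  induction l generalizing x with
  | nil => simp [iterCone, altSum, iterEval]
  | cons i l ih =>
    rw [iterCone, LinearMap.comp_apply, coneHomotopy_extDeriv, map_sub, map_sub, map_smul, ih,
      altSum, List.length_cons, pow_succ]
    simp only [iterCone, LinearMap.comp_apply]
    rcases l with _ | ⟨j, l⟩
    · simp [iterCone, altSum, iterEval]; abel
    · rw [iterCone_one (by simp), iterEval_cons (i := i) (l := j :: l) (by simp),
        LinearMap.comp_apply]
      module

omit [CharZero 𝕜] in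
lemma dupont_apply (x : PolyForm 𝕜 n) : dupont 𝕜 n x = ∑ σ : Face (n + 1),
    (-1 : 𝕜) ^ (σ.1.card - 1) • (whitneySet 𝕜 σ.1 * iterCone (σ.1.sort (· ≤ ·)) x) := by
  rw [dupont, LinearMap.sum_apply]
  refine Finset.sum_congr rfl fun σ _ => ?_
  rw [prod_reverse_map_coneHomotopy]
  rfl

lemma sum_face {m : ℕ} {M : Type*} [AddCommMonoid M] (f : Finset (Fin m) → M) (h : f ∅ = 0) :
    ∑ σ : Face m, f σ.1 = ∑ S, f S := by
  rw [← Finset.sum_subtype (Finset.univ.filter fun S : Finset (Fin m) => S.Nonempty) (by simp) f,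
    Finset.sum_filter]
  refine Finset.sum_congr rfl fun S _ => ?_
  split_ifs with hS
  · rfl
  · rw [Finset.not_nonempty_iff_eq_empty.1 hS, h]

/-- Dupont's homotopy contracts the forms onto the Whitney forms. -/
lemma extDeriv_dupont (x : PolyForm 𝕜 n) :
    extDeriv 𝕜 n (dupont 𝕜 n x) + dupont 𝕜 n (extDeriv 𝕜 n x) =
      x - ∑ σ : Face (n + 1), faceIntegral 𝕜 σ x • whitney 𝕜 σ := by
  let g : Finset (Fin (n + 1)) → Fin (n + 1) → PolyForm 𝕜 n := fun S i =>
    ((-1 : 𝕜) ^ S.card * (-1) ^ posIn S i) •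
      (whitneySet 𝕜 (insert i S) * iterCone (S.sort (· ≤ ·)) x)
  have hterm : ∀ σ : Face (n + 1),
      extDeriv 𝕜 n ((-1 : 𝕜) ^ (σ.1.card - 1) •
        (whitneySet 𝕜 σ.1 * iterCone (σ.1.sort (· ≤ ·)) x)) +
      (-1 : 𝕜) ^ (σ.1.card - 1) •
        (whitneySet 𝕜 σ.1 * iterCone (σ.1.sort (· ≤ ·)) (extDeriv 𝕜 n x)) =
      - (∑ i ∈ σ.1ᶜ, g σ.1 i) + ∑ i ∈ σ.1, g (σ.1.erase i) i -
        faceIntegral 𝕜 σ x • whitney 𝕜 σ := by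
    intro σ
    obtain ⟨k, hk⟩ : ∃ k, σ.1.card = k + 1 := ⟨_, (Nat.sub_add_cancel σ.2.card_pos).symm⟩
    have h1 : ∑ i ∈ σ.1, g (σ.1.erase i) i = (-1 : 𝕜) ^ k • (whitneySet 𝕜 σ.1 *
        altSum (fun l' => iterCone l' x) (σ.1.sort (· ≤ ·))) := by
      rw [altSum_sort (R := 𝕜), Finset.mul_sum, Finset.smul_sum]
      refine Finset.sum_congr rfl fun i hi => ?_
      simp only [g]
      rw [Finset.card_erase_of_mem hi, Finset.insert_erase hi, posIn_erase_self, hk,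
        Nat.add_sub_cancel, mul_smul_comm, smul_smul]
    have h2 : ∑ i ∈ σ.1ᶜ, g σ.1 i = (-1 : 𝕜) ^ (k + 1) • (extDeriv 𝕜 n (whitneySet 𝕜 σ.1) *
        iterCone (σ.1.sort (· ≤ ·)) x) := by
      rw [extDeriv_whitneySet σ.2, Finset.sum_mul, Finset.smul_sum]
      refine Finset.sum_congr rfl fun i hi => ?_
      simp only [g]
      rw [hk, smul_mul_assoc, smul_smul]
    rw [h1, h2, map_smul, extDeriv_mul (whitneySet_mem hk), iterCone_extDeriv,
      faceIntegral_eq_iterEval, whitney_eq, Finset.length_sort, hk, Nat.add_sub_cancel, mul_add,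
      mul_add, mul_smul_comm, mul_smul_comm, mul_one]
    have h3 : (-1 : 𝕜) ^ k * (-1) ^ k = 1 := by rw [← mul_pow]; simp
    simp only [smul_add, smul_smul, pow_succ, mul_neg, mul_one, neg_mul, ← mul_assoc, h3]
    module
  rw [dupont_apply, dupont_apply, map_sum, ← Finset.sum_add_distrib,
    Finset.sum_congr rfl fun σ _ => hterm σ, Finset.sum_sub_distrib, Finset.sum_add_distrib]
  congr 1
  have h4 : ∑ σ : Face (n + 1), ∑ i ∈ σ.1, g (σ.1.erase i) i = ∑ S, ∑ i ∈ Sᶜ, g S i := by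
    rw [sum_insert_eq_sum_erase, ← sum_face _ (by simp)]
  have h5 : ∑ σ : Face (n + 1), -(∑ i ∈ σ.1ᶜ, g σ.1 i) = x - ∑ S, ∑ i ∈ Sᶜ, g S i := by
    have := sum_face (fun S => (if S = ∅ then x else 0) - ∑ i ∈ Sᶜ, g S i) (by
      simp only [if_true, sub_eq_zero, g]
      rw [Finset.compl_empty]
      simp only [Finset.card_empty, posIn, Finset.filter_empty, pow_zero, one_mul, one_smul,
        insert_empty_eq, Finset.sort_empty, iterCone, LinearMap.id_apply, ← Finset.sum_mul]
      rw [sum_whitneySet_singleton, one_mul])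
    rw [Finset.sum_sub_distrib (s := (Finset.univ : Finset (Finset (Fin (n + 1))))),
      Finset.sum_ite_eq' Finset.univ, if_pos (Finset.mem_univ _)] at this
    rw [← this]
    refine Finset.sum_congr rfl fun σ _ => ?_
    rw [if_neg σ.2.ne_empty, zero_sub]
  rw [h4, h5, sub_add_cancel]

end Dupont

/-! ### Forms with coefficients -/

section Spanning

variable {𝕜 ι : Type*} [Field 𝕜] [Finite ι] {M N : Type*}
  [AddCommGroup M] [Module 𝕜 M] [AddCommGroup N] [Module 𝕜 N]

/-- A multilinear map sends the spans of sets into a submodule if it does so for the sets. -/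
lemma multilinear_mem_of_span (f : MultilinearMap 𝕜 (fun _ : ι => M) N) (G : ι → Set M)
    (S : Submodule 𝕜 N) (h : ∀ y : ι → M, (∀ a, y a ∈ G a) → f y ∈ S) {x : ι → M}
    (hx : ∀ a, x a ∈ Submodule.span 𝕜 (G a)) : f x ∈ S := by
  classical
  have := Fintype.ofFinite ι
  suffices H : ∀ s : Finset ι, ∀ x : ι → M, (∀ a ∈ s, x a ∈ Submodule.span 𝕜 (G a)) →
      (∀ a ∉ s, x a ∈ G a) → f x ∈ S from
    H Finset.univ x (fun a _ => hx a) (fun a ha => absurd (Finset.mem_univ a) ha)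
  intro s
  induction s using Finset.induction_on with
  | empty => exact fun x _ h2 => h x fun a => h2 a (Finset.notMem_empty a)
  | insert b s hb ih =>
    intro x h1 h2
    have key : ∀ z ∈ Submodule.span 𝕜 (G b), f (Function.update x b z) ∈ S := by
      intro z hz
      induction hz using Submodule.span_induction with
      | mem z hz =>
        refine ih _ (fun a ha => ?_) fun a ha => ?_
        · have hab : a ≠ b := fun hab => hb (hab ▸ ha)
          rw [Function.update_of_ne hab]
          exact h1 a (Finset.mem_insert_of_mem ha)
        · by_cases hab : a = b
          · subst hab; rwa [Function.update_self]
          · rw [Function.update_of_ne hab]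
            exact h2 a (by simp [hab, ha])
      | zero => rw [f.map_update_zero]; exact S.zero_mem
      | add y z _ _ hy hz => rw [f.map_update_add]; exact S.add_mem hy hz
      | smul c z _ hz => rw [f.map_update_smul]; exact S.smul_mem c hz
    have := key (x b) (h1 b (Finset.mem_insert_self b s))
    rwa [Function.update_eq_self] at this

lemma multilinear_eq_of_span {f g : MultilinearMap 𝕜 (fun _ : ι => M) N} (G : ι → Set M)
    (h : ∀ y : ι → M, (∀ a, y a ∈ G a) → f y = g y) {x : ι → M}
    (hx : ∀ a, x a ∈ Submodule.span 𝕜 (G a)) : f x = g x := by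
  have := multilinear_mem_of_span (f - g) G ⊥ (fun y hy => by
    rw [Submodule.mem_bot, sub_apply, h y hy, sub_self]) hx
  rwa [Submodule.mem_bot, sub_apply, sub_eq_zero] at this

end Spanning

section Signs

lemma units_smul_eq (𝕜 : Type*) {M : Type*} [Field 𝕜] [AddCommGroup M] [Module 𝕜 M] (u : ℤˣ)
    (x : M) : u • x = ((u : ℤ) : 𝕜) • x := by
  rw [Units.smul_def, Int.cast_smul_eq_zsmul]

lemma map_units_smul' {𝕜 M N : Type*} [Field 𝕜] [AddCommGroup M] [Module 𝕜 M] [AddCommGroup N]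
    [Module 𝕜 N] (f : M →ₗ[𝕜] N) (u : ℤˣ) (x : M) : f (u • x) = u • f x := by
  rw [Units.smul_def, map_zsmul, Units.smul_def]

lemma neg_one_pow_smul_eq {𝕜 M : Type*} [Field 𝕜] [AddCommGroup M] [Module 𝕜 M] (k : ℕ) (x : M) :
    (-1 : 𝕜) ^ k • x = (k : ℤ).negOnePow • x := by
  rw [units_smul_eq 𝕜]
  congr 1
  rw [Int.negOnePow_def]
  simp

lemma tmul_units_smul {𝕜 M N : Type*} [Field 𝕜] [AddCommGroup M] [Module 𝕜 M] [AddCommGroup N]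
    [Module 𝕜 N] (u : ℤˣ) (x : M) (y : N) : x ⊗ₜ[𝕜] (u • y) = u • (x ⊗ₜ[𝕜] y) := by
  rw [units_smul_eq 𝕜, TensorProduct.tmul_smul, ← units_smul_eq 𝕜]

lemma units_smul_tmul {𝕜 M N : Type*} [Field 𝕜] [AddCommGroup M] [Module 𝕜 M] [AddCommGroup N]
    [Module 𝕜 N] (u : ℤˣ) (x : M) (y : N) : (u • x) ⊗ₜ[𝕜] y = u • (x ⊗ₜ[𝕜] y) := by
  rw [units_smul_eq 𝕜, ← TensorProduct.smul_tmul', ← units_smul_eq 𝕜]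

lemma units_smul_mem {𝕜 M : Type*} [Field 𝕜] [AddCommGroup M] [Module 𝕜 M] (S : Submodule 𝕜 M)
    (u : ℤˣ) {x : M} (hx : x ∈ S) : u • x ∈ S := by
  rw [units_smul_eq 𝕜]; exact S.smul_mem _ hx

end Signs

section Extend

variable {𝕜 V : Type*} [Field 𝕜] [AddCommGroup V] [Module 𝕜 V] {n : ℕ}

lemma list_ofFn_tmul_prod {A B : Type*} [Ring A] [Algebra 𝕜 A] [Ring B] [Algebra 𝕜 B] {k : ℕ}
    (a : Fin k → A) (b : Fin k → B) : (List.ofFn fun i => a i ⊗ₜ[𝕜] b i).prod =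
      (List.ofFn a).prod ⊗ₜ[𝕜] (List.ofFn b).prod := by
  induction k with
  | zero => simp [Algebra.TensorProduct.one_def]
  | succ k ih =>
    rw [List.ofFn_succ, List.ofFn_succ, List.ofFn_succ, List.prod_cons, List.prod_cons,
      List.prod_cons, ih, Algebra.TensorProduct.tmul_mul_tmul]

lemma onWords_prod {k : ℕ} (q : MultilinearMap 𝕜 (fun _ : Fin k => V) V) (v : Fin k → V) :
    onWords q (List.ofFn fun a => TensorAlgebra.ι 𝕜 (v a)).prod = q v := by
  rw [← TensorAlgebra.tprod_apply, onWords, LinearMap.comp_apply, LinearMap.comp_apply]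
  have : (TensorAlgebra.equivDirectSum (R := 𝕜) (M := V)).toLinearMap
      (TensorAlgebra.tprod 𝕜 V k v) =
      DirectSum.of (fun k => ⨂[𝕜]^k V) k (PiTensorProduct.tprod 𝕜 v) :=
    TensorAlgebra.toDirectSum_tensorPower_tprod v
  rw [this, ← DirectSum.lof_eq_of 𝕜, DirectSum.component.of, dif_pos rfl]
  exact PiTensorProduct.lift.tprod v

lemma extendScalars_tmul {k : ℕ} (q : MultilinearMap 𝕜 (fun _ : Fin k => V) V)
    (ω : Fin k → PolyForm 𝕜 n) (v : Fin k → V) :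
    extendScalars n q (fun a => ω a ⊗ₜ v a) = (List.ofFn ω).prod ⊗ₜ q v := by
  rw [extendScalars, LinearMap.compMultilinearMap_apply, MultilinearMap.compLinearMap_apply,
    MultilinearMap.mkPiAlgebraFin_apply]
  simp only [LinearMap.lTensor_tmul]
  rw [list_ofFn_tmul_prod, LinearMap.lTensor_tmul, onWords_prod]

lemma prod_mem_formDeg {k : ℕ} {e : Fin k → ℕ} {ω : Fin k → PolyForm 𝕜 n}
    (h : ∀ a, ω a ∈ formDeg 𝕜 n (e a)) : (List.ofFn ω).prod ∈ formDeg 𝕜 n (∑ a, e a) := by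
  induction k with
  | zero => simpa using one_mem_formDeg
  | succ k ih =>
    rw [List.ofFn_succ, List.prod_cons, Fin.sum_univ_succ]
    exact formDeg_mul (h 0) (ih fun a => h a.succ)

/-- The sign in the extension of scalars, for letters of shifted degree `d a` whose component of
form degree `e a` is considered. -/
def wordSign {k : ℕ} (d : Fin k → ℤ) (e : Fin k → ℕ) : ℤˣ :=
  ((∑ a, (e a : ℤ)) + ∑ a, ∑ b, if a < b then (d a - (e a : ℤ)) * (e b : ℤ) else 0).negOnePow

namespace CompleteLInftyAlgebra

variable (L : CompleteLInftyAlgebra 𝕜 V)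

/-- The operations on `Ω(Δₙ; L)` without the differential of forms, as multilinear maps. -/
def coeffOps (n k : ℕ) (d : Fin k → ℤ) :
    MultilinearMap 𝕜 (fun _ : Fin k => PolyForm 𝕜 n ⊗[𝕜] V) (PolyForm 𝕜 n ⊗[𝕜] V) :=
  ∑ e : Fin k → Fin (n + 1), wordSign d (fun a => (e a : ℕ)) •
    (extendScalars n (L.q k)).compLinearMap fun a => (formProj 𝕜 n (e a)).rTensor V

lemma formOps_eq (n k : ℕ) (hk : k ≠ 1) (d : Fin k → ℤ) (x : Fin k → PolyForm 𝕜 n ⊗[𝕜] V) :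
    L.formOps n k d x = L.coeffOps n k d x := by
  rw [formOps, dif_neg hk, sub_zero, coeffOps, sum_apply]
  rfl

/-- The value of the operations on homogeneous letters. -/
lemma coeffOps_tmul {k : ℕ} (d : Fin k → ℤ) {e : Fin k → ℕ} {ω : Fin k → PolyForm 𝕜 n}
    (h : ∀ a, ω a ∈ formDeg 𝕜 n (e a)) (v : Fin k → V) :
    L.coeffOps n k d (fun a => ω a ⊗ₜ v a) =
      wordSign d e • ((List.ofFn ω).prod ⊗ₜ L.q k v) := by
  rw [coeffOps, sum_apply]
  simp only [smul_apply, MultilinearMap.compLinearMap_apply,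
    LinearMap.rTensor_tmul, extendScalars_tmul]
  by_cases he : ∀ a, e a < n + 1
  · rw [Finset.sum_eq_single fun a => ⟨e a, he a⟩]
    · simp only [formProj_of_mem (h _), if_true]
    · intro e' _ hne
      obtain ⟨a, ha⟩ := Function.ne_iff.1 hne
      have h0 : formProj 𝕜 n (e' a) (ω a) = 0 := by
        rw [formProj_of_mem (h a), if_neg fun h' => ha (Fin.ext h')]
      rw [List.prod_eq_zero, TensorProduct.zero_tmul, smul_zero]
      rw [List.mem_ofFn]
      exact ⟨a, h0⟩
    · simp
  · push Not at he
    obtain ⟨a, ha⟩ := he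
    have h0 : ω a = 0 := formDeg_eq_zero (by omega) (h a)
    rw [List.prod_eq_zero (List.mem_ofFn.2 ⟨a, h0⟩), TensorProduct.zero_tmul, smul_zero]
    refine Finset.sum_eq_zero fun e' _ => ?_
    rw [List.prod_eq_zero, TensorProduct.zero_tmul, smul_zero]
    rw [List.mem_ofFn]
    exact ⟨a, by rw [h0, map_zero]⟩

/-- The filtration of `Ω(Δₙ; L)` by the forms with coefficients in `FᵖL`. -/
def formFil (n p : ℕ) : Submodule 𝕜 (PolyForm 𝕜 n ⊗[𝕜] V) :=
  Submodule.span 𝕜 {x | ∃ e, ∃ ω ∈ formDeg 𝕜 n e, ∃ v ∈ L.fil p, x = ω ⊗ₜ v}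

/-- The elements of `Ω(Δₙ; L)` of shifted degree `d`. -/
def formGr (n : ℕ) (d : ℤ) : Submodule 𝕜 (PolyForm 𝕜 n ⊗[𝕜] V) :=
  Submodule.span 𝕜 {x | ∃ e : ℕ, ∃ ω ∈ formDeg 𝕜 n e, ∃ v ∈ L.gr (d + 1 - e), x = ω ⊗ₜ v}

lemma tmul_mem_formGr {d : ℤ} {e : ℕ} {ω : PolyForm 𝕜 n} (hω : ω ∈ formDeg 𝕜 n e) {v : V}
    (hv : v ∈ L.gr (d + 1 - e)) : ω ⊗ₜ[𝕜] v ∈ L.formGr n d :=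
  Submodule.subset_span ⟨e, ω, hω, v, hv, rfl⟩

variable (𝕜 n) in
/-- Forms are sums of homogeneous forms. -/
lemma _root_.DelGetzler.iSup_formDeg : ⨆ k, formDeg 𝕜 n k = ⊤ := by
  rw [← Submodule.ker_mkQ (⨆ k, formDeg 𝕜 n k), LinearMap.ker_eq_top]
  refine PolyForm.hom_ext_formDeg fun k x hx => ?_
  rw [LinearMap.zero_apply, Submodule.mkQ_apply, Submodule.Quotient.mk_eq_zero]
  exact Submodule.mem_iSup_of_mem k hx

lemma tmul_mem_formFil {p : ℕ} (ω : PolyForm 𝕜 n) {v : V} (hv : v ∈ L.fil p) :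
    ω ⊗ₜ[𝕜] v ∈ L.formFil n p := by
  have h : ⨆ k, formDeg 𝕜 n k ≤ (L.formFil n p).comap ((TensorProduct.mk 𝕜 _ V).flip v) :=
    iSup_le fun k ω hω => Submodule.subset_span ⟨k, ω, hω, v, hv, rfl⟩
  rw [iSup_formDeg] at h
  exact h (Submodule.mem_top (x := ω))

lemma formFil_one : L.formFil n 1 = ⊤ := by
  rw [eq_top_iff, ← TensorProduct.span_tmul_eq_top, Submodule.span_le]
  rintro _ ⟨ω, v, rfl⟩
  exact L.tmul_mem_formFil ω (by rw [L.fil_one]; trivial)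

lemma formFil_antitone : Antitone (L.formFil n) := by
  intro p p' h
  refine Submodule.span_mono ?_
  rintro _ ⟨e, ω, hω, v, hv, rfl⟩
  exact ⟨e, ω, hω, v, L.fil_antitone h hv, rfl⟩

lemma map_mem_of_formFil {M : Type*} [AddCommGroup M] [Module 𝕜 M] {p : ℕ}
    (f : PolyForm 𝕜 n ⊗[𝕜] V →ₗ[𝕜] M) (S : Submodule 𝕜 M)
    (h : ∀ e, ∀ ω ∈ formDeg 𝕜 n e, ∀ v ∈ L.fil p, f (ω ⊗ₜ v) ∈ S) {x : PolyForm 𝕜 n ⊗[𝕜] V}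
    (hx : x ∈ L.formFil n p) : f x ∈ S := by
  have : L.formFil n p ≤ S.comap f := by
    rw [formFil, Submodule.span_le]
    rintro _ ⟨e, ω, hω, v, hv, rfl⟩
    exact h e ω hω v hv
  exact this hx

lemma map_mem_of_formGr {M : Type*} [AddCommGroup M] [Module 𝕜 M] {d : ℤ}
    (f : PolyForm 𝕜 n ⊗[𝕜] V →ₗ[𝕜] M) (S : Submodule 𝕜 M)
    (h : ∀ e : ℕ, ∀ ω ∈ formDeg 𝕜 n e, ∀ v ∈ L.gr (d + 1 - e), f (ω ⊗ₜ v) ∈ S)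
    {x : PolyForm 𝕜 n ⊗[𝕜] V} (hx : x ∈ L.formGr n d) : f x ∈ S := by
  have : L.formGr n d ≤ S.comap f := by
    rw [formGr, Submodule.span_le]
    rintro _ ⟨e, ω, hω, v, hv, rfl⟩
    exact h e ω hω v hv
  exact this hx

include L in
lemma forms_hom_ext {M : Type*} [AddCommGroup M] [Module 𝕜 M]
    {f g : PolyForm 𝕜 n ⊗[𝕜] V →ₗ[𝕜] M}
    (h : ∀ e : ℕ, ∀ ω ∈ formDeg 𝕜 n e, ∀ v, f (ω ⊗ₜ v) = g (ω ⊗ₜ v)) : f = g := by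
  refine LinearMap.ext fun x => ?_
  have := L.map_mem_of_formFil (f - g) ⊥ (fun e ω hω v _ => by
    rw [Submodule.mem_bot, LinearMap.sub_apply, h e ω hω v, sub_self])
    (L.formFil_one (n := n) ▸ Submodule.mem_top (x := x))
  rwa [Submodule.mem_bot, LinearMap.sub_apply, sub_eq_zero] at this

lemma coeffOps_mem_formFil {k : ℕ} (hk : 1 ≤ k) (d : Fin k → ℤ) {p : Fin k → ℕ}
    (hp : ∀ a, 1 ≤ p a) {x : Fin k → PolyForm 𝕜 n ⊗[𝕜] V} (hx : ∀ a, x a ∈ L.formFil n (p a)) :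
    L.coeffOps n k d x ∈ L.formFil n (∑ a, p a) := by
  refine multilinear_mem_of_span _ _ _ (fun y hy => ?_) hx
  choose e ω hω v hv h using hy
  obtain rfl : y = fun a => ω a ⊗ₜ v a := funext h
  rw [L.coeffOps_tmul d hω]
  exact units_smul_mem _ _ (L.tmul_mem_formFil _ (L.q_continuous k p v hk hp hv))

lemma coeffOps_mem_formGr {k : ℕ} (d : Fin k → ℤ) {x : Fin k → PolyForm 𝕜 n ⊗[𝕜] V}
    (hx : ∀ a, x a ∈ L.formGr n (d a)) : L.coeffOps n k d x ∈ L.formGr n (∑ a, d a + 1) := by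
  refine multilinear_mem_of_span _ _ _ (fun y hy => ?_) hx
  choose e ω hω v hv h using hy
  obtain rfl : y = fun a => ω a ⊗ₜ v a := funext h
  rw [L.coeffOps_tmul d hω]
  refine units_smul_mem _ _ (L.tmul_mem_formGr (prod_mem_formDeg hω) ?_)
  have := L.q_degree k (fun a => d a - e a) v fun a => by
    have := hv a; rwa [show d a - (e a : ℤ) + 1 = d a + 1 - e a by ring]
  convert this using 2
  rw [Finset.sum_sub_distrib]
  push_cast
  ring

/-- Evaluation of forms with coefficients at the `i`-th vertex. -/
def _root_.DelGetzler.vertexValue (i : Fin (n + 1)) : PolyForm 𝕜 n ⊗[𝕜] V →ₗ[𝕜] V :=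
  (TensorProduct.lid 𝕜 V).toLinearMap ∘ₗ (vertexEval 𝕜 i).toLinearMap.rTensor V

lemma _root_.DelGetzler.vertexValue_tmul (i : Fin (n + 1)) (ω : PolyForm 𝕜 n) (v : V) :
    vertexValue i (ω ⊗ₜ[𝕜] v) = vertexEval 𝕜 i ω • v := rfl

lemma vertexValue_coeffOps (i : Fin (n + 1)) (k : ℕ) (d : Fin k → ℤ)
    (x : Fin k → PolyForm 𝕜 n ⊗[𝕜] V) :
    vertexValue i (L.coeffOps n k d x) = L.q k fun a => vertexValue i (x a) := by
  refine multilinear_eq_of_span (f := (vertexValue i).compMultilinearMap (L.coeffOps n k d))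
    (g := (L.q k).compLinearMap fun _ => vertexValue i)
    (fun _ => {x | ∃ e, ∃ ω ∈ formDeg 𝕜 n e, ∃ v ∈ L.fil 1, x = ω ⊗ₜ v}) (fun y hy => ?_)
    (fun a => (L.formFil_one (n := n) ▸ Submodule.mem_top (x := x a) : x a ∈ L.formFil n 1))
  choose e ω hω v hv h using hy
  obtain rfl : y = fun a => ω a ⊗ₜ v a := funext h
  rw [LinearMap.compMultilinearMap_apply, MultilinearMap.compLinearMap_apply,
    L.coeffOps_tmul d hω, map_units_smul', vertexValue_tmul]
  simp only [vertexValue_tmul]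
  rw [MultilinearMap.map_smul_univ, map_list_prod, List.map_ofFn, List.prod_ofFn]
  by_cases he : ∀ a, e a = 0
  · have : wordSign d e = 1 := by simp [wordSign, he]
    rw [this, one_smul]; rfl
  · push Not at he
    obtain ⟨a, ha⟩ := he
    have h0 : vertexEval 𝕜 i (ω a) = 0 := by
      obtain ⟨m, hm⟩ := Nat.exists_eq_succ_of_ne_zero ha
      exact vertexEval_of_succ i (hm ▸ hω a)
    rw [Finset.prod_eq_zero (Finset.mem_univ a) (by exact h0),
      Finset.prod_eq_zero (Finset.mem_univ a) h0, zero_smul, smul_zero]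

end CompleteLInftyAlgebra

end Extend

/-! ### The contraction with coefficients -/

section Linear

variable {𝕜 V : Type*} [Field 𝕜] [AddCommGroup V] [Module 𝕜 V] {n : ℕ}

namespace CompleteLInftyAlgebra

variable (L : CompleteLInftyAlgebra 𝕜 V)

/-- The linear part `q₁`. -/
def q₁ : V →ₗ[𝕜] V := (L.q 1).toLinearMap (fun _ => 0) 0

lemma q₁_apply (v : V) : L.q₁ v = L.q 1 fun _ => v := by
  rw [q₁, MultilinearMap.toLinearMap_apply]
  congr 1
  ext a
  rw [Subsingleton.elim a 0, Function.update_self]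

lemma q₁_mem_gr {k : ℤ} {v : V} (hv : v ∈ L.gr k) : L.q₁ v ∈ L.gr (k + 1) := by
  have := L.q_degree 1 (fun _ => k - 1) (fun _ => v) (fun _ => by simpa using hv)
  rw [q₁_apply]
  simpa using this

lemma q₁_mem_fil {p : ℕ} (hp : 1 ≤ p) {v : V} (hv : v ∈ L.fil p) : L.q₁ v ∈ L.fil p := by
  have := L.q_continuous 1 (fun _ => p) (fun _ => v) le_rfl (fun _ => hp) (fun _ => hv)
  rw [q₁_apply]
  simpa using this

lemma koszulSign_one (d : Fin 1 → ℤ) (c : Fin 1 → ℕ) : koszulSign d c = 1 := by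
  simp [koszulSign]

lemma iSup_gr : ⨆ k, L.gr k = ⊤ := L.gr_internal.submodule_iSup_eq_top

lemma q₁_q₁ (v : V) : L.q₁ (L.q₁ v) = 0 := by
  suffices h : L.q₁ ∘ₗ L.q₁ = 0 from LinearMap.congr_fun h v
  rw [← LinearMap.ker_eq_top, eq_top_iff, ← L.iSup_gr]
  refine iSup_le fun k v hv => ?_
  rw [LinearMap.mem_ker, LinearMap.comp_apply]
  have h := L.q_square 1 (fun _ => k - 1) (fun _ => v) (fun _ => by simpa using hv)
  have hs : (Finset.univ.filter fun S : Finset (Fin 1) => S.Nonempty) = {Finset.univ} := by decide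
  rw [hs, Finset.sum_singleton, koszulSign_one, one_smul] at h
  rw [q₁_apply, q₁_apply, ← h]
  have hc : (Finset.univ : Finset (Fin 1))ᶜ.card = 0 := by simp
  have key : ∀ (m : ℕ) (hm : m = 0) (w : Fin m → V) (u : V),
      L.q (m + 1) (Fin.cons u w : Fin (m + 1) → V) = L.q 1 fun _ => u := by
    rintro _ rfl w u
    congr 1
    ext a
    rw [Subsingleton.elim (α := Fin 1) a 0]; rfl
  rw [key _ hc]
  rfl

/-- The total differential of `Ω(Δₙ; L)`, with the sign for which it is the linear part of the
operations. -/
def formDiff (n : ℕ) : PolyForm 𝕜 n ⊗[𝕜] V →ₗ[𝕜] PolyForm 𝕜 n ⊗[𝕜] V :=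
  (L.coeffOps n 1 0).toLinearMap (fun _ => 0) 0 - (extDeriv 𝕜 n).rTensor V

lemma formDiff_apply (x : PolyForm 𝕜 n ⊗[𝕜] V) :
    L.formDiff n x = L.coeffOps n 1 0 (fun _ => x) - (extDeriv 𝕜 n).rTensor V x := by
  rw [formDiff, LinearMap.sub_apply, MultilinearMap.toLinearMap_apply]
  congr 2
  ext a
  rw [Subsingleton.elim a 0, Function.update_self]

lemma formDiff_tmul {e : ℕ} {ω : PolyForm 𝕜 n} (hω : ω ∈ formDeg 𝕜 n e) (v : V) :
    L.formDiff n (ω ⊗ₜ v) = (-1 : 𝕜) ^ e • (ω ⊗ₜ L.q₁ v) - extDeriv 𝕜 n ω ⊗ₜ v := by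
  rw [formDiff_apply, L.coeffOps_tmul 0 (e := fun _ => e) (ω := fun _ => ω) (fun _ => hω),
    neg_one_pow_smul_eq (𝕜 := 𝕜) e (ω ⊗ₜ[𝕜] L.q₁ v), q₁_apply, LinearMap.rTensor_tmul]
  simp [wordSign]

lemma formDiff_mem_formFil {p : ℕ} (hp : 1 ≤ p) {x : PolyForm 𝕜 n ⊗[𝕜] V}
    (hx : x ∈ L.formFil n p) : L.formDiff n x ∈ L.formFil n p := by
  refine L.map_mem_of_formFil _ _ (fun e ω hω v hv => ?_) hx
  rw [L.formDiff_tmul hω]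
  exact Submodule.sub_mem _ (Submodule.smul_mem _ _ (L.tmul_mem_formFil _ (L.q₁_mem_fil hp hv)))
    (L.tmul_mem_formFil _ hv)

lemma rTensor_mem_formFil {p : ℕ} (f : PolyForm 𝕜 n →ₗ[𝕜] PolyForm 𝕜 n)
    {x : PolyForm 𝕜 n ⊗[𝕜] V} (hx : x ∈ L.formFil n p) : f.rTensor V x ∈ L.formFil n p :=
  L.map_mem_of_formFil _ _ (fun _ ω _ _ hv => L.tmul_mem_formFil (f ω) hv) hx

lemma iterCone_mem (l : List (Fin (n + 1))) {k : ℕ} {x : PolyForm 𝕜 n}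
    (hx : x ∈ formDeg 𝕜 n k) :
    if l.length ≤ k then iterCone l x ∈ formDeg 𝕜 n (k - l.length) else iterCone l x = 0 := by
  induction l generalizing k x with
  | nil => simpa [iterCone] using hx
  | cons i l ih =>
    rw [iterCone, LinearMap.comp_apply]
    rcases k with _ | k
    · rw [if_neg (by simp), coneHomotopy_of_zero i hx, map_zero]
    · have := ih (coneHomotopy_mem i hx)
      simpa using this

lemma dupont_mem {k : ℕ} {x : PolyForm 𝕜 n} (hx : x ∈ formDeg 𝕜 n (k + 1)) :
    dupont 𝕜 n x ∈ formDeg 𝕜 n k := by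
  rw [dupont_apply]
  refine Submodule.sum_mem _ fun σ _ => Submodule.smul_mem _ _ ?_
  obtain ⟨m, hm⟩ : ∃ m, σ.1.card = m + 1 := ⟨_, (Nat.sub_add_cancel σ.2.card_pos).symm⟩
  have := iterCone_mem (σ.1.sort (· ≤ ·)) hx
  rw [Finset.length_sort, hm] at this
  split_ifs at this with h
  · have := formDeg_mul (whitneySet_mem (𝕜 := 𝕜) hm) this
    rwa [show m + (k + 1 - (m + 1)) = k by omega] at this
  · rw [this, mul_zero]; exact Submodule.zero_mem _

lemma dupont_zero {x : PolyForm 𝕜 n} (hx : x ∈ formDeg 𝕜 n 0) : dupont 𝕜 n x = 0 := by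
  rw [dupont_apply]
  refine Finset.sum_eq_zero fun σ _ => ?_
  have := iterCone_mem (σ.1.sort (· ≤ ·)) hx
  rw [Finset.length_sort, if_neg (by have := σ.2.card_pos; omega)] at this
  rw [this, mul_zero, smul_zero]

lemma dupont_mem_formGr {d : ℤ} {x : PolyForm 𝕜 n ⊗[𝕜] V} (hx : x ∈ L.formGr n (d + 1)) :
    (dupont 𝕜 n).rTensor V x ∈ L.formGr n d := by
  refine L.map_mem_of_formGr _ _ (fun e ω hω v hv => ?_) hx
  rw [LinearMap.rTensor_tmul]
  rcases e with _ | e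
  · rw [dupont_zero hω, TensorProduct.zero_tmul]; exact Submodule.zero_mem _
  · refine L.tmul_mem_formGr (dupont_mem hω) ?_
    convert hv using 2; push_cast; ring

/-- Dupont's homotopy has image in the forms which vanish at the vertices. -/
lemma vertexEval_dupont (i : Fin (n + 1)) (x : PolyForm 𝕜 n) :
    vertexEval 𝕜 i (dupont 𝕜 n x) = 0 := by
  rw [dupont_apply, map_sum]
  refine Finset.sum_eq_zero fun σ _ => ?_
  rw [map_smul, map_mul]
  obtain ⟨m, hm⟩ : ∃ m, σ.1.card = m + 1 := ⟨_, (Nat.sub_add_cancel σ.2.card_pos).symm⟩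
  rcases m with _ | m
  · obtain ⟨a, ha⟩ := Finset.card_eq_one.1 hm
    rw [ha, whitneySet_singleton, vertexEval_mk, aeval_vertex_bary]
    split_ifs with h
    · subst h
      rw [Finset.sort_singleton, iterCone, iterCone, LinearMap.id_comp, vertexEval_coneHomotopy,
        mul_zero, smul_zero]
    · rw [zero_mul, zero_mul, smul_zero]
  · rw [vertexEval_of_succ i (whitneySet_mem hm), zero_mul, smul_zero]

lemma vertexValue_dupont (i : Fin (n + 1)) (x : PolyForm 𝕜 n ⊗[𝕜] V) :
    vertexValue i ((dupont 𝕜 n).rTensor V x) = 0 := by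
  suffices h : vertexValue i ∘ₗ (dupont 𝕜 n).rTensor V = 0 from LinearMap.congr_fun h x
  refine TensorProduct.ext' fun ω v => ?_
  rw [LinearMap.comp_apply, LinearMap.rTensor_tmul, vertexValue_tmul, vertexEval_dupont, zero_smul]
  rfl

lemma whitneyMap_apply (α : Face (n + 1) → V) :
    whitneyMap n α = ∑ σ : Face (n + 1), whitney 𝕜 σ ⊗ₜ[𝕜] α σ := by
  rw [whitneyMap, LinearMap.sum_apply]; rfl

lemma integrationMap_tmul (ω : PolyForm 𝕜 n) (v : V) (σ : Face (n + 1)) :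
    integrationMap n (ω ⊗ₜ[𝕜] v) σ = faceIntegral 𝕜 σ ω • v := rfl

variable [CharZero 𝕜]

lemma formDiff_formDiff (x : PolyForm 𝕜 n ⊗[𝕜] V) : L.formDiff n (L.formDiff n x) = 0 := by
  suffices h : L.formDiff n ∘ₗ L.formDiff n = 0 from LinearMap.congr_fun h x
  refine L.forms_hom_ext fun e ω hω v => ?_
  rw [LinearMap.comp_apply, L.formDiff_tmul hω, map_sub, map_smul, L.formDiff_tmul hω,
    L.formDiff_tmul (extDeriv_mem hω), L.q₁_q₁, extDeriv_extDeriv, TensorProduct.zero_tmul,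
    TensorProduct.tmul_zero, pow_succ, LinearMap.zero_apply]
  module

/-- The contraction of `Ω(Δₙ; L)` onto the cochains. -/
lemma formDiff_dupont (x : PolyForm 𝕜 n ⊗[𝕜] V) :
    L.formDiff n ((dupont 𝕜 n).rTensor V x) + (dupont 𝕜 n).rTensor V (L.formDiff n x) =
      whitneyMap n (integrationMap n x) - x := by
  suffices h : L.formDiff n ∘ₗ (dupont 𝕜 n).rTensor V + (dupont 𝕜 n).rTensor V ∘ₗ L.formDiff n =
      whitneyMap n ∘ₗ integrationMap n - LinearMap.id from LinearMap.congr_fun h x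
  refine L.forms_hom_ext fun e ω hω v => ?_
  simp only [LinearMap.add_apply, LinearMap.comp_apply, LinearMap.sub_apply, LinearMap.id_apply,
    LinearMap.rTensor_tmul, whitneyMap_apply, integrationMap_tmul]
  have h1 : ∑ σ : Face (n + 1), whitney 𝕜 σ ⊗ₜ[𝕜] (faceIntegral 𝕜 σ ω • v) =
      (∑ σ : Face (n + 1), faceIntegral 𝕜 σ ω • whitney 𝕜 σ) ⊗ₜ[𝕜] v := by
    rw [TensorProduct.sum_tmul]
    simp only [TensorProduct.smul_tmul]
  have h2 := extDeriv_dupont (𝕜 := 𝕜) ω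
  have h3 : ∑ σ : Face (n + 1), faceIntegral 𝕜 σ ω • whitney 𝕜 σ =
      ω - (extDeriv 𝕜 n (dupont 𝕜 n ω) + dupont 𝕜 n (extDeriv 𝕜 n ω)) := by rw [h2]; abel
  rw [h3] at h1
  rw [h1, L.formDiff_tmul hω, map_sub, map_smul, LinearMap.rTensor_tmul, LinearMap.rTensor_tmul]
  rcases e with _ | e
  · rw [dupont_zero hω]
    simp [TensorProduct.sub_tmul]
  · rw [L.formDiff_tmul (dupont_mem hω), pow_succ]
    simp only [TensorProduct.sub_tmul, TensorProduct.add_tmul]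
    module

end CompleteLInftyAlgebra
end Linear

/-! ### The complex of cochains -/

section CochainValue

variable {V : Type*} [AddCommGroup V] {m : ℕ}

/-- The value of a cochain on a finite set of vertices, which is zero on the empty set. -/
def cochainValue (α : Face m → V) (S : Finset (Fin m)) : V :=
  if h : S.Nonempty then α ⟨S, h⟩ else 0

lemma cochainValue_empty (α : Face m → V) : cochainValue α ∅ = 0 := by simp [cochainValue]

lemma cochainValue_face (α : Face m → V) (σ : Face m) : cochainValue α σ.1 = α σ := by
  rw [cochainValue, dif_pos σ.2]

lemma cochainHomotopy_apply (i : Fin m) (α : Face m → V) (S : Finset (Fin m)) :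
    cochainValue (cochainHomotopy i α) S =
      if S = ∅ ∨ i ∈ S then 0
      else (-1 : ℤ) ^ posIn S i • cochainValue α (insert i S) := by
  rcases S.eq_empty_or_nonempty with rfl | hS
  · simp [cochainValue]
  · rw [cochainValue, dif_pos hS, cochainHomotopy, cochainValue,
      dif_pos (Finset.insert_nonempty i S)]
    simp [hS.ne_empty, posIn]

end CochainValue

section Linear

variable {𝕜 V : Type*} [Field 𝕜] [AddCommGroup V] [Module 𝕜 V] {n m : ℕ}

namespace CompleteLInftyAlgebra

variable (L : CompleteLInftyAlgebra 𝕜 V)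

lemma mem_cochains {d : ℤ} {α : Face m → V} :
    α ∈ L.cochains m d ↔ ∀ σ, α σ ∈ L.gr (d - ((σ.1.card : ℤ) - 1)) := by
  simp [cochains, Submodule.mem_pi]

lemma mem_cochainFil {p : ℕ} {α : Face m → V} :
    α ∈ L.cochainFil m p ↔ ∀ σ, α σ ∈ L.fil p := by
  simp [cochainFil, Submodule.mem_pi]

lemma cochainDiff_apply (α : Face m → V) (S : Finset (Fin m)) :
    cochainValue (L.cochainDiff m α) S = (-1 : 𝕜) ^ (S.card + 1) • L.q₁ (cochainValue α S) -
      ∑ a ∈ S, (-1 : 𝕜) ^ posIn S a • cochainValue α (S.erase a) := by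
  rcases S.eq_empty_or_nonempty with rfl | hS
  · simp [cochainValue]
  · rw [cochainValue, dif_pos hS, cochainDiff, LinearMap.pi_apply, LinearMap.sub_apply,
      LinearMap.sum_apply]
    congr 1
    · obtain ⟨k, hk⟩ : ∃ k, S.card = k + 1 := ⟨_, (Nat.sub_add_cancel hS.card_pos).symm⟩
      rw [hk, Nat.add_sub_cancel, pow_succ, pow_succ, cochainValue, dif_pos hS]
      simp [q₁]
    · refine Finset.sum_congr rfl fun a _ => ?_
      rw [LinearMap.smul_apply, cochainValue, posIn]
      congr 1
      split_ifs <;> rfl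

lemma neg_one_pow_card_erase {S : Finset (Fin m)} {a : Fin m} (ha : a ∈ S) :
    (-1 : 𝕜) ^ (S.erase a).card = - (-1) ^ S.card := by
  rw [← Finset.card_erase_add_one ha, pow_succ]; ring

/-- The simplicial coboundary squares to zero. -/
lemma coboundary_coboundary (F : Finset (Fin m) → V) (S : Finset (Fin m)) :
    ∑ a ∈ S, (-1 : 𝕜) ^ posIn S a • ∑ b ∈ S.erase a,
      (-1 : 𝕜) ^ posIn (S.erase a) b • F ((S.erase a).erase b) = 0 := by
  simp only [Finset.smul_sum]
  rw [Finset.sum_sigma']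
  refine Finset.sum_involution (fun x _ => ⟨x.2, x.1⟩) (fun x hx => ?_) (fun x hx _ h => ?_)
    (fun x hx => ?_) (fun x hx => rfl)
  · obtain ⟨a, b⟩ := x
    simp only [Finset.mem_sigma, Finset.mem_erase] at hx
    obtain ⟨ha, hb, hb'⟩ := hx
    simp only [smul_smul]
    rw [Finset.erase_right_comm (a := b), ← add_smul]
    convert zero_smul 𝕜 (F ((S.erase a).erase b)) using 2
    rw [posIn_erase ha (a := b), posIn_erase hb' (a := a)]
    rcases lt_or_gt_of_ne hb with h | h
    · rw [if_neg (not_lt.2 h.le), if_pos h]; ring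
    · rw [if_pos h, if_neg (not_lt.2 h.le)]; ring
  · simp only [Finset.mem_sigma, Finset.mem_erase] at hx
    exact hx.2.1 (congrArg Sigma.fst h)
  · simp only [Finset.mem_sigma, Finset.mem_erase] at hx ⊢
    exact ⟨hx.2.2, hx.2.1.symm, hx.1⟩

lemma cochainDiff_cochainDiff (α : Face m → V) : L.cochainDiff m (L.cochainDiff m α) = 0 := by
  funext σ
  rw [← cochainValue_face (L.cochainDiff m _) σ, cochainDiff_apply, cochainDiff_apply, map_sub, map_smul, q₁_q₁]
  simp only [cochainDiff_apply]
  simp only [smul_sub, Finset.sum_sub_distrib]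
  rw [coboundary_coboundary, map_sum, Finset.smul_sum]
  have : ∀ a ∈ σ.1, (-1 : 𝕜) ^ posIn σ.1 a • (-1 : 𝕜) ^ ((σ.1.erase a).card + 1) •
        L.q₁ (cochainValue α (σ.1.erase a)) =
      - (-1 : 𝕜) ^ (σ.1.card + 1) • L.q₁ ((-1 : 𝕜) ^ posIn σ.1 a •
        cochainValue α (σ.1.erase a)) := by
    intro a ha
    rw [pow_succ, neg_one_pow_card_erase ha, map_smul, pow_succ]
    module
  rw [Finset.sum_congr rfl this]
  simp

/-- The homotopy `hⁱ` contracts the cochains to the `i`-th vertex: `d hⁱ + hⁱ d` is the constant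
cochain at the value on that vertex, minus the identity. -/
lemma cochainDiff_cochainHomotopy (i : Fin m) (α : Face m → V) (σ : Face m) :
    L.cochainDiff m (cochainHomotopy i α) σ + cochainHomotopy i (L.cochainDiff m α) σ =
      (if σ.1.card = 1 then α (vertexFace i) else 0) - α σ := by
  obtain ⟨S, hS⟩ := σ
  rw [← cochainValue_face (L.cochainDiff m _), ← cochainValue_face (cochainHomotopy i _),
    ← cochainValue_face α, ← cochainValue_face α, cochainDiff_apply, cochainHomotopy_apply,
    cochainHomotopy_apply]
  simp only [hS.ne_empty, false_or, vertexFace, cochainDiff_apply]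
  simp only [cochainHomotopy_apply]
  by_cases hi : i ∈ S
  · rw [if_pos hi, if_pos hi, map_zero, smul_zero, zero_sub, add_zero,
      Finset.sum_eq_single_of_mem i hi]
    · by_cases h : S.erase i = ∅
      · have h1 : S = {i} := by rw [← Finset.insert_erase hi, h]; rfl
        subst h1
        simp
      · have h1 : S.card ≠ 1 := fun h1 => h (by
          rw [← Finset.card_eq_zero, Finset.card_erase_of_mem hi, h1])
        rw [if_neg (by simp [h]), if_neg h1, Finset.insert_erase hi, posIn_erase_self]
        rcases Nat.even_or_odd (posIn S i) with he | he <;> simp [he.neg_one_pow]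
    · intro a ha hai
      rw [if_pos (Or.inr (Finset.mem_erase.2 ⟨hai.symm, hi⟩)), smul_zero]
  · rw [if_neg hi, if_neg hi, Finset.sum_insert hi, Finset.card_insert_of_notMem hi,
      Finset.erase_insert hi]
    have hz : ∀ (k : ℕ) (v : V), (-1 : ℤ) ^ k • v = (-1 : 𝕜) ^ k • v := by
      intro k v
      rcases Nat.even_or_odd k with he | he <;> simp [he.neg_one_pow]
    simp only [hz, posIn_insert_self]
    by_cases h1 : S.card = 1
    · obtain ⟨b, rfl⟩ := Finset.card_eq_one.1 h1
      have hbi : b ≠ i := fun h => hi (h ▸ Finset.mem_singleton_self b)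
      have he : (insert i {b} : Finset (Fin m)).erase b = {i} := by
        ext x; simp only [Finset.mem_erase, Finset.mem_insert, Finset.mem_singleton]
        constructor
        · rintro ⟨h, rfl | h'⟩
          · rfl
          · exact absurd h' h
        · rintro rfl; exact ⟨hbi.symm, Or.inl rfl⟩
      simp only [Finset.sum_singleton, Finset.erase_singleton, true_or, if_true, smul_zero, he,
        posIn_insert hi, map_smul]
      rw [h1, if_pos rfl]
      have hp : (-1 : 𝕜) ^ posIn {b} i • (-1 : 𝕜) ^ (posIn {b} b + if i < b then 1 else 0) •
          cochainValue α {i} = - cochainValue α {i} := by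
        rcases lt_or_gt_of_ne hbi with h | h
        · simp [posIn, Finset.filter_singleton, h, not_lt.2 h.le]
        · simp [posIn, Finset.filter_singleton, h, not_lt.2 h.le]
      rw [smul_sub, smul_add, hp]
      rcases neg_one_pow_eq_or 𝕜 (posIn {b} i) with h | h <;> rw [h] <;> module
    · rw [if_neg h1]
      have hterm : ∀ a ∈ S, ((-1 : 𝕜) ^ posIn S a •
          if S.erase a = ∅ ∨ i ∈ S.erase a then 0
          else (-1 : 𝕜) ^ posIn (S.erase a) i • cochainValue α (insert i (S.erase a))) =
          - ((-1 : 𝕜) ^ posIn S i • (-1 : 𝕜) ^ posIn (insert i S) a •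
            cochainValue α ((insert i S).erase a)) := by
        intro a ha
        have hai : i ≠ a := fun h => hi (h ▸ ha)
        have h2 : S.erase a ≠ ∅ := fun h => h1 (by
          rw [← Finset.card_erase_add_one ha, h, Finset.card_empty])
        rw [if_neg (by simp [h2, hi]), Finset.erase_insert_of_ne hai, posIn_insert hi,
          posIn_erase ha (a := i)]
        rcases lt_or_gt_of_ne hai with h | h
        · rw [if_pos h, if_neg (not_lt.2 h.le), pow_succ]; module
        · rw [if_neg (not_lt.2 h.le), if_pos h, pow_succ]; module
      rw [Finset.sum_congr rfl hterm, Finset.sum_neg_distrib, ← Finset.smul_sum, map_smul]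
      rcases neg_one_pow_eq_or 𝕜 (posIn S i) with h | h <;> rw [h, pow_succ _ (S.card + 1)] <;>
        module

section FormComplex

lemma whitneyMap_eq_sum (α : Face (n + 1) → V) :
    whitneyMap n α = ∑ S, whitneySet 𝕜 S ⊗ₜ[𝕜] cochainValue α S := by
  rw [← sum_face _ (by rw [cochainValue_empty, TensorProduct.tmul_zero]), whitneyMap_apply]
  exact Finset.sum_congr rfl fun σ _ => by rw [whitney_eq, cochainValue_face]

lemma iterEval_eq_zero (l : List (Fin (n + 1))) {k : ℕ} (hk : k + 1 ≠ l.length)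
    {x : PolyForm 𝕜 n} (hx : x ∈ formDeg 𝕜 n k) : iterEval l x = 0 := by
  induction l generalizing k x with
  | nil => rfl
  | cons i l ih =>
    rcases l with _ | ⟨j, l⟩
    · obtain ⟨k, rfl⟩ : ∃ k', k = k' + 1 := Nat.exists_eq_succ_of_ne_zero fun h => hk (by simp [h])
      exact vertexEval_of_succ i hx
    · rw [iterEval_cons (by simp), LinearMap.comp_apply]
      rcases k with _ | k
      · rw [coneHomotopy_of_zero i hx, map_zero]
      · exact ih (fun h => hk (by simpa using h)) (coneHomotopy_mem i hx)

lemma whitneyMap_cochainDiff (α : Face (n + 1) → V) :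
    whitneyMap n (L.cochainDiff (n + 1) α) = L.formDiff n (whitneyMap n α) := by
  rw [whitneyMap_eq_sum, whitneyMap_eq_sum, map_sum]
  have h1 : ∀ S : Finset (Fin (n + 1)), L.formDiff n (whitneySet 𝕜 S ⊗ₜ[𝕜] cochainValue α S) =
      whitneySet 𝕜 S ⊗ₜ[𝕜] ((-1 : 𝕜) ^ (S.card + 1) • L.q₁ (cochainValue α S)) -
      ∑ a ∈ Sᶜ, whitneySet 𝕜 (insert a S) ⊗ₜ[𝕜] ((-1 : 𝕜) ^ posIn S a • cochainValue α S) := by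
    intro S
    rcases S.eq_empty_or_nonempty with rfl | hS
    · simp [cochainValue_empty]
    · obtain ⟨k, hk⟩ : ∃ k, S.card = k + 1 := ⟨_, (Nat.sub_add_cancel hS.card_pos).symm⟩
      rw [L.formDiff_tmul (whitneySet_mem hk), extDeriv_whitneySet hS, TensorProduct.sum_tmul, hk,
        pow_succ, pow_succ, mul_assoc, neg_one_mul, neg_neg, mul_one, TensorProduct.tmul_smul]
      simp only [TensorProduct.smul_tmul]
  rw [Finset.sum_congr rfl fun S _ => h1 S, Finset.sum_sub_distrib, sum_insert_eq_sum_erase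
    fun S a => whitneySet 𝕜 (insert a S) ⊗ₜ[𝕜] ((-1 : 𝕜) ^ posIn S a • cochainValue α S)]
  simp only [cochainDiff_apply, TensorProduct.tmul_sub, TensorProduct.tmul_sum]
  rw [Finset.sum_sub_distrib]
  congr 1
  refine Finset.sum_congr rfl fun S _ => Finset.sum_congr rfl fun a ha => ?_
  rw [Finset.insert_erase ha, posIn_erase_self]

variable [CharZero 𝕜]

lemma faceIntegral_eq_zero (σ : Face (n + 1)) {k : ℕ} (hk : k + 1 ≠ σ.1.card)
    {x : PolyForm 𝕜 n} (hx : x ∈ formDeg 𝕜 n k) : faceIntegral 𝕜 σ x = 0 := by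
  rw [faceIntegral_eq_iterEval]
  exact iterEval_eq_zero _ (by rwa [Finset.length_sort]) hx

lemma cochainValue_integrationMap (ω : PolyForm 𝕜 n) (v : V) (S : Finset (Fin (n + 1))) :
    cochainValue (integrationMap n (ω ⊗ₜ[𝕜] v)) S = iterEval (S.sort (· ≤ ·)) ω • v := by
  rcases S.eq_empty_or_nonempty with rfl | hS
  · simp [cochainValue_empty, iterEval]
  · rw [cochainValue, dif_pos hS, integrationMap_tmul, faceIntegral_eq_iterEval]

/-- Stokes' theorem: integration over faces is a morphism of complexes. -/
lemma integrationMap_formDiff (x : PolyForm 𝕜 n ⊗[𝕜] V) :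
    integrationMap n (L.formDiff n x) = L.cochainDiff (n + 1) (integrationMap n x) := by
  suffices h : integrationMap n ∘ₗ L.formDiff n = L.cochainDiff (n + 1) ∘ₗ integrationMap n from
    LinearMap.congr_fun h x
  refine L.forms_hom_ext fun e ω hω v => ?_
  rw [LinearMap.comp_apply, LinearMap.comp_apply, L.formDiff_tmul hω, map_sub, map_smul]
  funext σ
  rw [← cochainValue_face (L.cochainDiff (n + 1) _) σ, cochainDiff_apply, Pi.sub_apply,
    Pi.smul_apply, integrationMap_tmul, integrationMap_tmul]
  simp only [cochainValue_integrationMap]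
  congr 1
  · rw [map_smul, ← faceIntegral_eq_iterEval, smul_smul, smul_smul]
    by_cases h : e + 1 = σ.1.card
    · rw [← h, pow_succ, pow_succ]
      congr 1; ring
    · rw [faceIntegral_eq_zero σ h hω, mul_zero, mul_zero]
  · rw [faceIntegral_eq_iterEval, iterEval_extDeriv, altSum_sort (R := 𝕜), Finset.sum_smul]
    exact Finset.sum_congr rfl fun a _ => by rw [smul_assoc]

lemma integrationMap_vertexFace (i : Fin (n + 1)) (x : PolyForm 𝕜 n ⊗[𝕜] V) :
    integrationMap n x (vertexFace i) = vertexValue i x := by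
  suffices h : LinearMap.proj (vertexFace i) ∘ₗ integrationMap n = vertexValue i from
    LinearMap.congr_fun h x
  refine TensorProduct.ext' fun ω v => ?_
  rw [LinearMap.comp_apply, LinearMap.proj_apply, integrationMap_tmul, vertexValue_tmul,
    faceIntegral_eq_iterEval, vertexFace, Finset.sort_singleton]
  rfl

lemma integrationMap_mem_cochains {d : ℤ} {x : PolyForm 𝕜 n ⊗[𝕜] V} (hx : x ∈ L.formGr n d) :
    integrationMap n x ∈ L.cochains (n + 1) (d + 1) := by
  refine L.map_mem_of_formGr _ _ (fun e ω hω v hv => ?_) hx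
  refine (L.mem_cochains).2 fun σ => ?_
  rw [integrationMap_tmul]
  by_cases h : e + 1 = σ.1.card
  · refine Submodule.smul_mem _ _ ?_
    convert hv using 2
    rw [← h]; push_cast; ring
  · rw [faceIntegral_eq_zero σ h hω, zero_smul]; exact Submodule.zero_mem _

end FormComplex

lemma vertexValue_whitneyMap (i : Fin (n + 1)) (α : Face (n + 1) → V) :
    vertexValue i (whitneyMap (𝕜 := 𝕜) n α) = α (vertexFace i) := by
  rw [whitneyMap_apply, map_sum, Finset.sum_eq_single (vertexFace i)]
  · rw [vertexValue_tmul, whitney_eq, vertexFace, whitneySet_singleton, vertexEval_mk,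
      aeval_vertex_bary, if_pos rfl, map_one, one_mul, one_smul]
  · intro σ _ hσ
    rw [vertexValue_tmul, whitney_eq]
    obtain ⟨k, hk⟩ : ∃ k, σ.1.card = k + 1 := ⟨_, (Nat.sub_add_cancel σ.2.card_pos).symm⟩
    rcases k with _ | k
    · obtain ⟨a, ha⟩ := Finset.card_eq_one.1 hk
      have hai : a ≠ i := fun h => hσ (Subtype.ext (by rw [ha, h]; rfl))
      rw [ha, whitneySet_singleton, vertexEval_mk, aeval_vertex_bary]
      simp [hai]
    · rw [vertexEval_of_succ i (whitneySet_mem hk), zero_smul]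
  · simp

lemma integrationMap_mem_cochainFil {p : ℕ} {x : PolyForm 𝕜 n ⊗[𝕜] V} (hx : x ∈ L.formFil n p) :
    integrationMap n x ∈ L.cochainFil (n + 1) p := by
  refine L.map_mem_of_formFil _ _ (fun e ω hω v hv => ?_) hx
  refine (L.mem_cochainFil).2 fun σ => ?_
  exact Submodule.smul_mem _ _ hv

lemma whitneyMap_mem_formFil {p : ℕ} {α : Face (n + 1) → V} (hα : α ∈ L.cochainFil (n + 1) p) :
    whitneyMap n α ∈ L.formFil n p := by
  rw [whitneyMap_apply]
  exact Submodule.sum_mem _ fun σ _ => L.tmul_mem_formFil _ ((L.mem_cochainFil.1 hα σ))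

lemma whitneyMap_mem_formGr {d : ℤ} {α : Face (n + 1) → V}
    (hα : α ∈ L.cochains (n + 1) (d + 1)) : whitneyMap n α ∈ L.formGr n d := by
  rw [whitneyMap_apply]
  refine Submodule.sum_mem _ fun σ _ => ?_
  obtain ⟨k, hk⟩ : ∃ k, σ.1.card = k + 1 := ⟨_, (Nat.sub_add_cancel σ.2.card_pos).symm⟩
  refine L.tmul_mem_formGr (whitneySet_mem hk) ?_
  have := L.mem_cochains.1 hα σ
  convert this using 2
  rw [hk]; push_cast; ring

lemma cochainValue_mem_fil {p : ℕ} {α : Face m → V} (hα : α ∈ L.cochainFil m p)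
    (S : Finset (Fin m)) : cochainValue α S ∈ L.fil p := by
  rw [cochainValue]
  split_ifs with h
  · exact L.mem_cochainFil.1 hα ⟨S, h⟩
  · exact Submodule.zero_mem _

lemma cochainValue_mem_gr {d : ℤ} {α : Face m → V} (hα : α ∈ L.cochains m d)
    (S : Finset (Fin m)) : cochainValue α S ∈ L.gr (d - ((S.card : ℤ) - 1)) := by
  rw [cochainValue]
  split_ifs with h
  · exact L.mem_cochains.1 hα ⟨S, h⟩
  · exact Submodule.zero_mem _

lemma cochainDiff_mem_cochainFil {p : ℕ} (hp : 1 ≤ p) {α : Face m → V}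
    (hα : α ∈ L.cochainFil m p) : L.cochainDiff m α ∈ L.cochainFil m p := by
  refine (L.mem_cochainFil).2 fun σ => ?_
  rw [← cochainValue_face (L.cochainDiff m α) σ, cochainDiff_apply]
  exact Submodule.sub_mem _ (Submodule.smul_mem _ _ (L.q₁_mem_fil hp (L.cochainValue_mem_fil hα _)))
    (Submodule.sum_mem _ fun a _ => Submodule.smul_mem _ _ (L.cochainValue_mem_fil hα _))

lemma cochainDiff_mem_cochains {d : ℤ} {α : Face m → V}
    (hα : α ∈ L.cochains m d) : L.cochainDiff m α ∈ L.cochains m (d + 1) := by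
  refine (L.mem_cochains).2 fun σ => ?_
  rw [← cochainValue_face (L.cochainDiff m α) σ, cochainDiff_apply]
  refine Submodule.sub_mem _ (Submodule.smul_mem _ _ ?_)
    (Submodule.sum_mem _ fun a ha => Submodule.smul_mem _ _ ?_)
  · convert L.q₁_mem_gr (L.cochainValue_mem_gr hα σ.1) using 2; ring
  · convert L.cochainValue_mem_gr hα (σ.1.erase a) using 2
    rw [← Finset.card_erase_add_one ha]; push_cast; ring

lemma cochainHomotopy_mem_cochainFil (i : Fin m) {p : ℕ} {α : Face m → V}
    (hα : α ∈ L.cochainFil m p) : cochainHomotopy i α ∈ L.cochainFil m p := by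
  refine (L.mem_cochainFil).2 fun σ => ?_
  rw [cochainHomotopy]
  split_ifs
  · exact Submodule.zero_mem _
  · exact zsmul_mem (L.mem_cochainFil.1 hα _) _

lemma cochainHomotopy_mem_cochains (i : Fin m) {d : ℤ} {α : Face m → V}
    (hα : α ∈ L.cochains m (d + 1)) : cochainHomotopy i α ∈ L.cochains m d := by
  refine (L.mem_cochains).2 fun σ => ?_
  rw [cochainHomotopy]
  split_ifs with h
  · exact Submodule.zero_mem _
  · have := L.mem_cochains.1 hα ⟨insert i σ.1, Finset.insert_nonempty i σ.1⟩
    refine zsmul_mem ?_ _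
    convert this using 2
    rw [Finset.card_insert_of_notMem h]; push_cast; ring

end CompleteLInftyAlgebra
end Linear

/-! ### The quadratic relations for forms of degree zero -/

section PairSum

/-- The second elementary symmetric function `∑_{a < b} e a * e b`. -/
def pairSum {k : ℕ} (e : Fin k → ℤ) : ℤ := ∑ a, ∑ b, if a < b then e a * e b else 0

lemma two_mul_pairSum {k : ℕ} (e : Fin k → ℤ) :
    2 * pairSum e = (∑ a, e a) ^ 2 - ∑ a, e a ^ 2 := by
  have h1 : (∑ a, e a) ^ 2 = ∑ a, ∑ b, e a * e b := by rw [sq, Finset.sum_mul_sum]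
  have h2 : pairSum e = ∑ a, ∑ b, if b < a then e a * e b else 0 := by
    rw [pairSum, Finset.sum_comm]
    simp only [mul_comm]
  have h3 : ∑ a, e a ^ 2 = ∑ a, ∑ b, if a = b then e a * e b else 0 := by
    simp [sq]
  rw [two_mul]
  nth_rewrite 2 [h2]
  rw [h1, h3, pairSum, ← Finset.sum_add_distrib, ← Finset.sum_sub_distrib]
  refine Finset.sum_congr rfl fun a _ => ?_
  rw [← Finset.sum_add_distrib, ← Finset.sum_sub_distrib]
  refine Finset.sum_congr rfl fun b _ => ?_
  rcases lt_trichotomy a b with h | h | h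
  · simp [h, h.ne, not_lt.2 h.le]
  · simp [h]
  · simp [h, h.ne', not_lt.2 h.le]

lemma sum_sub {m : ℕ} {M : Type*} [AddCommMonoid M] (f : Fin m → M) (S : Finset (Fin m)) :
    ∑ a, f (sub S a) = ∑ a ∈ S, f a := by
  conv_rhs => rw [← Finset.map_orderEmbOfFin_univ S rfl]
  rw [Finset.sum_map]; rfl

/-- The additivity of `pairSum` is what makes Koszul signs multiplicative when the arguments are
split into a block and its complement. -/
lemma pairSum_split {m : ℕ} (e : Fin m → ℤ) (S : Finset (Fin m)) :
    pairSum e = (∑ a ∈ S, e a) * (∑ a ∈ Sᶜ, e a) + pairSum (fun a => e (sub S a)) +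
      pairSum (fun a => e (sub Sᶜ a)) := by
  have h1 := two_mul_pairSum e
  have h2 := two_mul_pairSum fun a => e (sub S a)
  have h3 := two_mul_pairSum fun a => e (sub Sᶜ a)
  rw [sum_sub e, sum_sub (fun a => e a ^ 2)] at h2 h3
  rw [← Finset.sum_add_sum_compl S e, ← Finset.sum_add_sum_compl S fun a => e a ^ 2] at h1
  linarith

lemma pairSum_succAbove {m : ℕ} (e : Fin (m + 1) → ℤ) (a : Fin (m + 1)) :
    pairSum e = e a * (∑ b, e (a.succAbove b)) + pairSum (fun b => e (a.succAbove b)) := by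
  have h1 := two_mul_pairSum e
  have h2 := two_mul_pairSum fun b => e (a.succAbove b)
  rw [Fin.sum_univ_succAbove _ a, Fin.sum_univ_succAbove _ a] at h1
  linarith

lemma negOnePow_sum {ι : Type*} (s : Finset ι) (f : ι → ℤ) :
    (∑ a ∈ s, f a).negOnePow = ∏ a ∈ s, (f a).negOnePow := by
  classical
  induction s using Finset.induction_on with
  | empty => simp
  | insert a s ha ih => rw [Finset.sum_insert ha, Finset.prod_insert ha, Int.negOnePow_add, ih]

lemma wordSign_zero {k : ℕ} (e : Fin k → ℕ) :
    wordSign 0 e = ((∑ a, (e a : ℤ)) - pairSum fun a => (e a : ℤ)).negOnePow := by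
  rw [wordSign, sub_eq_add_neg, pairSum, ← Finset.sum_neg_distrib]
  congr 2
  refine Finset.sum_congr rfl fun a _ => ?_
  rw [← Finset.sum_neg_distrib]
  refine Finset.sum_congr rfl fun b _ => ?_
  split_ifs <;> simp

lemma wordSign_cons {k : ℕ} (d : ℤ) (e₀ : ℕ) (e : Fin k → ℕ) :
    wordSign (Fin.cons d 0 : Fin (k + 1) → ℤ) (Fin.cons e₀ e : Fin (k + 1) → ℕ) =
      (e₀ + ∑ a, (e a : ℤ) + (d - e₀) * (∑ a, (e a : ℤ)) -
        pairSum fun a => (e a : ℤ)).negOnePow := by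
  rw [wordSign]
  congr 1
  rw [pairSum, Fin.sum_univ_succ, Fin.sum_univ_succ]
  simp only [Fin.cons_zero, Fin.cons_succ, Fin.sum_univ_succ, lt_self_iff_false, if_false,
    Fin.succ_pos, if_true, zero_add, Fin.not_lt_zero, Fin.succ_lt_succ_iff, Pi.zero_apply, zero_sub,
    neg_mul, Finset.mul_sum]
  rw [← add_assoc, sub_eq_add_neg (_ + _), ← Finset.sum_neg_distrib]
  congr 1
  refine Finset.sum_congr rfl fun a _ => ?_
  rw [← Finset.sum_neg_distrib]
  refine Finset.sum_congr rfl fun b _ => ?_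
  split_ifs <;> simp

end PairSum

section Words

variable {𝕜 : Type*} [Field 𝕜] {n : ℕ}

lemma sort_map_prod_mem {m : ℕ} {e : Fin m → ℕ} {ω : Fin m → PolyForm 𝕜 n}
    (h : ∀ a, ω a ∈ formDeg 𝕜 n (e a)) (S : Finset (Fin m)) :
    ((S.sort (· ≤ ·)).map ω).prod ∈ formDeg 𝕜 n (∑ a ∈ S, e a) := by
  induction S using Finset.induction_on_min with
  | empty => simpa using one_mem_formDeg
  | insert a S ha ih =>
    have haS : a ∉ S := fun h => lt_irrefl _ (ha a h)
    rw [sort_insert_min ha, List.map_cons, List.prod_cons, Finset.sum_insert haS]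
    exact formDeg_mul (h a) ih

lemma ofFn_sub {m : ℕ} {M : Type*} (ω : Fin m → M) (S : Finset (Fin m)) :
    (List.ofFn fun a => ω (sub S a)) = (S.sort (· ≤ ·)).map ω := by
  rw [← Finset.listMap_orderEmbOfFin_finRange S rfl, List.map_map, List.ofFn_eq_map]; rfl

lemma ofFn_eq_sort {m : ℕ} {M : Type*} (ω : Fin m → M) :
    List.ofFn ω = ((Finset.univ : Finset (Fin m)).sort (· ≤ ·)).map ω := by
  rw [List.ofFn_eq_map, Fin.sort_univ]

lemma formDeg_mul_comm' {j k : ℕ} {x y : PolyForm 𝕜 n} (hx : x ∈ formDeg 𝕜 n j)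
    (hy : y ∈ formDeg 𝕜 n k) : x * y = ((j : ℤ) * k).negOnePow • (y * x) := by
  rw [formDeg_mul_comm hx hy, neg_one_pow_smul_eq]; push_cast; rfl

/-- The Koszul sign for putting the letters in `S` in front. -/
lemma prod_sub_mul_prod_sub {m : ℕ} {e : Fin m → ℕ} {ω : Fin m → PolyForm 𝕜 n}
    (h : ∀ a, ω a ∈ formDeg 𝕜 n (e a)) (S : Finset (Fin m)) :
    (List.ofFn fun a => ω (sub S a)).prod * (List.ofFn fun a => ω (sub Sᶜ a)).prod =
      koszulSign (fun a => -(e a : ℤ)) (fun a => if a ∈ S then 0 else 1) •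
        (List.ofFn ω).prod := by
  rw [ofFn_sub, ofFn_sub, ofFn_eq_sort, koszulSign]
  suffices H : ∀ T : Finset (Fin m),
      (((T ∩ S).sort (· ≤ ·)).map ω).prod * (((T \ S).sort (· ≤ ·)).map ω).prod =
        (∏ a ∈ T, ∏ b ∈ T, if a < b ∧ (if b ∈ S then 0 else 1) < (if a ∈ S then 0 else 1)
          then (-(e a : ℤ) * -(e b : ℤ)).negOnePow else 1) •
        ((T.sort (· ≤ ·)).map ω).prod by
    have := H Finset.univ
    rwa [Finset.univ_inter, ← Finset.compl_eq_univ_sdiff] at this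
  intro T
  induction T using Finset.induction_on_min with
  | empty => simp
  | insert c T hc ih =>
    have hcT : c ∉ T := fun h => lt_irrefl _ (hc c h)
    rw [sort_insert_min hc, List.map_cons, List.prod_cons, Finset.prod_insert hcT,
      Finset.prod_insert hcT]
    have h1 : ∀ a ∈ T, (∏ b ∈ insert c T,
        if a < b ∧ (if b ∈ S then 0 else 1) < (if a ∈ S then 0 else 1)
          then (-(e a : ℤ) * -(e b : ℤ)).negOnePow else 1) =
        ∏ b ∈ T, if a < b ∧ (if b ∈ S then 0 else 1) < (if a ∈ S then 0 else 1)
          then (-(e a : ℤ) * -(e b : ℤ)).negOnePow else 1 := fun a ha => by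
      rw [Finset.prod_insert hcT, if_neg fun h => lt_asymm h.1 (hc a ha), one_mul]
    rw [Finset.prod_congr rfl h1, if_neg (fun h => lt_irrefl _ h.1), one_mul]
    by_cases hcS : c ∈ S
    · have h2 : ∀ b ∈ T, (if c < b ∧ (if b ∈ S then 0 else 1) < (if c ∈ S then 0 else 1)
          then (-(e c : ℤ) * -(e b : ℤ)).negOnePow else 1) = 1 := fun b _ => by
        rw [if_neg]; simp [hcS]
      rw [Finset.insert_inter_of_mem hcS, Finset.insert_sdiff_of_mem _ hcS,
        sort_insert_min fun b hb => hc b (Finset.mem_inter.1 hb).1, List.map_cons, List.prod_cons,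
        mul_assoc, ih, Finset.prod_eq_one h2, one_mul, mul_smul_comm]
    · have h2 : ∏ b ∈ T, (if c < b ∧ (if b ∈ S then 0 else 1) < (if c ∈ S then 0 else 1)
          then (-(e c : ℤ) * -(e b : ℤ)).negOnePow else 1) =
          ((e c : ℤ) * ((∑ b ∈ T ∩ S, e b : ℕ) : ℤ)).negOnePow := by
        push_cast
        rw [Finset.mul_sum, negOnePow_sum, ← Finset.filter_mem_eq_inter, Finset.prod_filter]
        refine Finset.prod_congr rfl fun b hb => ?_
        by_cases hbS : b ∈ S
        · simp [hcS, hbS, hc b hb]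
        · simp [hcS, hbS]
      rw [Finset.insert_inter_of_notMem hcS, Finset.insert_sdiff_of_notMem _ hcS,
        sort_insert_min fun b hb => hc b (Finset.mem_sdiff.1 hb).1, List.map_cons, List.prod_cons,
        ← mul_assoc, formDeg_mul_comm' (sort_map_prod_mem h (T ∩ S)) (h c), h2, smul_mul_assoc,
        mul_assoc, ih, mul_smul_comm, smul_smul, mul_comm (e c : ℤ)]

/-- The sum of the degrees before the letter `a`. -/
def degBefore {k : ℕ} (e : Fin (k + 1) → ℤ) (a : Fin (k + 1)) : ℤ :=
  ∑ b : Fin k, if a.succAbove b < a then e (a.succAbove b) else 0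

lemma degBefore_zero {k : ℕ} (e : Fin (k + 1) → ℤ) : degBefore e 0 = 0 := by
  simp [degBefore]

lemma degBefore_succ {k : ℕ} (e : Fin (k + 2) → ℤ) (a : Fin (k + 1)) :
    degBefore e a.succ = e 0 + degBefore (fun b => e b.succ) a := by
  rw [degBefore, degBefore, Fin.sum_univ_succ]
  simp [Fin.succ_succAbove_succ, Fin.succ_lt_succ_iff]

/-- The Leibniz rule, with the differentiated factor in front. -/
lemma extDeriv_prod {k : ℕ} {e : Fin (k + 1) → ℕ} {ω : Fin (k + 1) → PolyForm 𝕜 n}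
    (h : ∀ a, ω a ∈ formDeg 𝕜 n (e a)) :
    extDeriv 𝕜 n (List.ofFn ω).prod =
      ∑ a, ((e a : ℤ) * degBefore (fun a => (e a : ℤ)) a).negOnePow •
        (extDeriv 𝕜 n (ω a) * (List.ofFn fun b => ω (a.succAbove b)).prod) := by
  induction k with
  | zero => simp [degBefore]
  | succ k ih =>
    rw [List.ofFn_succ, List.prod_cons, extDeriv_mul (h 0),
      Fin.sum_univ_succ, degBefore_zero, mul_zero, Int.negOnePow_zero, one_smul,
      ih fun a => h a.succ]
    congr 1
    rw [neg_one_pow_smul_eq (𝕜 := 𝕜), Finset.mul_sum, Finset.smul_sum]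
    refine Finset.sum_congr rfl fun a _ => ?_
    have h1 : (List.ofFn fun b => ω (a.succ.succAbove b)).prod =
        ω 0 * (List.ofFn fun b => ω (a.succAbove b).succ).prod := by
      rw [List.ofFn_succ, List.prod_cons]
      simp only [Fin.succ_succAbove_zero, Fin.succ_succAbove_succ]
    rw [h1, mul_smul_comm, ← mul_assoc, ← mul_assoc,
      formDeg_mul_comm' (h 0) (extDeriv_mem (h a.succ)), smul_mul_assoc, smul_smul, smul_smul,
      ← Int.negOnePow_add, ← Int.negOnePow_add, degBefore_succ]
    congr 1
    rw [Int.negOnePow_eq_iff]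
    refine ⟨(e 0 : ℤ), ?_⟩
    push_cast
    ring

/-- The permutation which puts the letter `a` in front. -/
def frontPerm {k : ℕ} (a : Fin (k + 1)) : Equiv.Perm (Fin (k + 1)) :=
  (finSuccEquiv k).trans (finSuccEquiv' a).symm

lemma frontPerm_zero {k : ℕ} (a : Fin (k + 1)) : frontPerm a 0 = a := by simp [frontPerm]

lemma frontPerm_succ {k : ℕ} (a : Fin (k + 1)) (b : Fin k) :
    frontPerm a b.succ = a.succAbove b := by simp [frontPerm]

lemma koszulSign_frontPerm {k : ℕ} (d : Fin (k + 1) → ℤ) (a : Fin (k + 1)) :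
    koszulSign d (fun b => ((frontPerm a).symm b : ℕ)) = (d a * degBefore d a).negOnePow := by
  have h0 : (frontPerm a).symm a = 0 := by rw [Equiv.symm_apply_eq, frontPerm_zero]
  have h1 : ∀ b, (frontPerm a).symm (a.succAbove b) = b.succ := fun b => by
    rw [Equiv.symm_apply_eq, frontPerm_succ]
  rw [koszulSign, Fin.prod_univ_succAbove _ a]
  simp only [Fin.prod_univ_succAbove _ a, h0, h1]
  have h2 : ∀ x y : Fin k, ¬ (a.succAbove x < a.succAbove y ∧
      ((y.succ : Fin (k + 1)) : ℕ) < (x.succ : Fin (k + 1))) := by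
    rintro x y ⟨h, h'⟩
    rw [Fin.succAbove_lt_succAbove_iff] at h
    rw [Fin.val_succ, Fin.val_succ] at h'
    have := Fin.lt_def.1 h
    omega
  simp only [h2, if_false, Finset.prod_const_one, mul_one, lt_self_iff_false,
    Fin.val_zero, not_lt_zero, and_false, one_mul, degBefore, Finset.mul_sum, negOnePow_sum]
  refine Finset.prod_congr rfl fun b _ => ?_
  by_cases h : a.succAbove b < a
  · simp [h, mul_comm]
  · simp [h]

end Words

section Bianchi

variable {𝕜 V : Type*} [Field 𝕜] [AddCommGroup V] [Module 𝕜 V] {n : ℕ}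

namespace CompleteLInftyAlgebra

variable (L : CompleteLInftyAlgebra 𝕜 V)

/-- The operations with a distinguished first letter `y` of degree `1` and other letters of degree
`0`. -/
def insertOps (n k : ℕ) : PolyForm 𝕜 n ⊗[𝕜] V →ₗ[𝕜]
    MultilinearMap 𝕜 (fun _ : Fin k => PolyForm 𝕜 n ⊗[𝕜] V) (PolyForm 𝕜 n ⊗[𝕜] V) :=
  (L.coeffOps n (k + 1) (Fin.cons 1 0)).curryLeft

lemma insertOps_apply {k : ℕ} (y : PolyForm 𝕜 n ⊗[𝕜] V) (x : Fin k → PolyForm 𝕜 n ⊗[𝕜] V) :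
    L.insertOps n k y x = L.coeffOps n (k + 1) (Fin.cons 1 0) (Fin.cons y x) := rfl

lemma cons_tmul {k : ℕ} (ω₀ : PolyForm 𝕜 n) (v₀ : V) (ω : Fin k → PolyForm 𝕜 n) (v : Fin k → V) :
    (Fin.cons (ω₀ ⊗ₜ[𝕜] v₀) fun a => ω a ⊗ₜ[𝕜] v a : Fin (k + 1) → PolyForm 𝕜 n ⊗[𝕜] V) =
      fun a => (Fin.cons ω₀ ω : Fin (k + 1) → PolyForm 𝕜 n) a ⊗ₜ[𝕜]
        (Fin.cons v₀ v : Fin (k + 1) → V) a := by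
  funext a
  refine Fin.cases rfl (fun a => rfl) a

lemma insertOps_tmul {k : ℕ} {e₀ : ℕ} {ω₀ : PolyForm 𝕜 n} (h₀ : ω₀ ∈ formDeg 𝕜 n e₀) (v₀ : V)
    {e : Fin k → ℕ} {ω : Fin k → PolyForm 𝕜 n} (h : ∀ a, ω a ∈ formDeg 𝕜 n (e a)) (v : Fin k → V) :
    L.insertOps n k (ω₀ ⊗ₜ v₀) (fun a => ω a ⊗ₜ v a) =
      ((e₀ : ℤ) + ∑ a, (e a : ℤ) + (1 - e₀) * (∑ a, (e a : ℤ)) -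
        pairSum fun a => (e a : ℤ)).negOnePow •
      ((ω₀ * (List.ofFn ω).prod) ⊗ₜ L.q (k + 1) (Fin.cons v₀ v)) := by
  rw [insertOps_apply, cons_tmul, L.coeffOps_tmul (e := Fin.cons e₀ e) _ (Fin.cases h₀ h),
    wordSign_cons, List.ofFn_succ, List.prod_cons]
  rfl

/-- The composition of the operations, for letters of degree `0`. -/
lemma insertOps_coeffOps_tmul {m : ℕ} {e : Fin m → ℕ} {ω : Fin m → PolyForm 𝕜 n}
    (h : ∀ a, ω a ∈ formDeg 𝕜 n (e a)) (v : Fin m → V) (S : Finset (Fin m)) :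
    L.insertOps n Sᶜ.card (L.coeffOps n S.card 0 fun a => ω (sub S a) ⊗ₜ v (sub S a))
        (fun a => ω (sub Sᶜ a) ⊗ₜ v (sub Sᶜ a)) =
      (pairSum fun a => (e a : ℤ)).negOnePow • ((List.ofFn ω).prod ⊗ₜ
        (koszulSign (fun a => -(e a : ℤ)) (fun a => if a ∈ S then 0 else 1) •
          L.q (Sᶜ.card + 1)
            (Fin.cons (L.q S.card (fun a => v (sub S a))) (fun a => v (sub Sᶜ a)) :
              Fin (Sᶜ.card + 1) → V))) := by
  have hS := prod_mem_formDeg (n := n) (𝕜 := 𝕜) fun a => h (sub S a)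
  rw [L.coeffOps_tmul (ω := fun a => ω (sub S a)) 0 fun a => h (sub S a),
    units_smul_eq 𝕜 (wordSign _ _), map_smul, smul_apply, ← units_smul_eq 𝕜,
    L.insertOps_tmul hS (ω := fun a => ω (sub Sᶜ a)) _ fun a => h (sub Sᶜ a),
    prod_sub_mul_prod_sub h, wordSign_zero, units_smul_tmul, tmul_units_smul, smul_smul, smul_smul,
    smul_smul, ← Int.negOnePow_add]
  congr 2
  rw [Int.negOnePow_eq_iff, pairSum_split _ S]
  push_cast
  rw [sum_sub (fun a => (e a : ℤ)), sum_sub (fun a => (e a : ℤ))]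
  refine ⟨∑ a ∈ S, (e a : ℤ) + ∑ a ∈ Sᶜ, (e a : ℤ) - (∑ a ∈ S, (e a : ℤ)) * (∑ a ∈ Sᶜ, (e a : ℤ)) -
    (pairSum fun a => (e (sub S a) : ℤ)) - pairSum fun a => (e (sub Sᶜ a) : ℤ), ?_⟩
  ring

/-- The composition of operations in the letters `S` and in the remaining ones, as a multilinear
map. -/
def composeOps (n : ℕ) {m : ℕ} (S : Finset (Fin m)) :
    MultilinearMap 𝕜 (fun _ : Fin m => PolyForm 𝕜 n ⊗[𝕜] V) (PolyForm 𝕜 n ⊗[𝕜] V) :=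
  MultilinearMap.domDomCongr (finSumEquivOfFinset (s := S) rfl rfl)
    (((L.insertOps n Sᶜ.card).compMultilinearMap (L.coeffOps n S.card 0)).uncurrySum
      (N := fun _ => PolyForm 𝕜 n ⊗[𝕜] V))

lemma composeOps_apply {m : ℕ} (S : Finset (Fin m)) (x : Fin m → PolyForm 𝕜 n ⊗[𝕜] V) :
    L.composeOps n S x = L.insertOps n Sᶜ.card (L.coeffOps n S.card 0 fun a => x (sub S a))
        (fun a => x (sub Sᶜ a)) := rfl

/-- The quadratic relation for the extension of scalars, for letters of degree `0`. -/
lemma sum_composeOps {m : ℕ} {x : Fin m → PolyForm 𝕜 n ⊗[𝕜] V} (hx : ∀ a, x a ∈ L.formGr n 0) :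
    ∑ S : Finset (Fin m) with S.Nonempty, L.composeOps n S x = 0 := by
  rw [← sum_apply]
  refine multilinear_eq_of_span (g := 0) _ (fun y hy => ?_) hx
  choose e ω hω v hv h using hy
  obtain rfl : y = fun a => ω a ⊗ₜ v a := funext h
  rw [sum_apply]
  simp only [composeOps_apply]
  rw [Finset.sum_congr rfl fun S _ => L.insertOps_coeffOps_tmul hω v S, ← Finset.smul_sum,
    ← TensorProduct.tmul_sum, L.q_square m (fun a => -(e a : ℤ)) v fun a => by
      convert hv a using 2; ring]
  simp

/-- Up to sign, the differential of forms is a derivation of the operations. -/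
lemma extDeriv_coeffOps {k : ℕ} {x : Fin (k + 1) → PolyForm 𝕜 n ⊗[𝕜] V}
    (hx : ∀ a, x a ∈ L.formGr n 0) :
    (extDeriv 𝕜 n).rTensor V (L.coeffOps n (k + 1) 0 x) =
      - ∑ a, L.insertOps n k ((extDeriv 𝕜 n).rTensor V (x a)) fun b => x (a.succAbove b) := by
  let f (a : Fin (k + 1)) :
      MultilinearMap 𝕜 (fun _ : Fin (k + 1) => PolyForm 𝕜 n ⊗[𝕜] V) (PolyForm 𝕜 n ⊗[𝕜] V) :=
    MultilinearMap.domDomCongr (frontPerm a)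
      ((L.insertOps n k ∘ₗ (extDeriv 𝕜 n).rTensor V).uncurryLeft)
  have hf : ∀ a x, f a x =
      L.insertOps n k ((extDeriv 𝕜 n).rTensor V (x a)) fun b => x (a.succAbove b) := by
    intro a x
    simp only [f, MultilinearMap.domDomCongr_apply, LinearMap.uncurryLeft_apply, frontPerm_zero,
      LinearMap.comp_apply]
    congr 1
  simp only [← hf]
  refine Eq.trans (b := (-∑ a, f a) x) ?_ (by rw [neg_apply, sum_apply])
  rw [← LinearMap.compMultilinearMap_apply]
  refine multilinear_eq_of_span _ (fun y hy => ?_) hx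
  choose e ω hω v hv h using hy
  obtain rfl : y = fun a => ω a ⊗ₜ v a := funext h
  rw [LinearMap.compMultilinearMap_apply, neg_apply, sum_apply, L.coeffOps_tmul 0 hω,
    map_units_smul', LinearMap.rTensor_tmul, extDeriv_prod hω, TensorProduct.sum_tmul,
    Finset.smul_sum, ← Finset.sum_neg_distrib]
  refine Finset.sum_congr rfl fun a _ => ?_
  have hq := L.q_symm (k + 1) (fun a => -(e a : ℤ)) v (fun a => by
      convert hv a using 2; ring) (frontPerm a)
  have hc : (fun b => v (frontPerm a b)) = Fin.cons (v a) fun b => v (a.succAbove b) := by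
    funext b
    refine Fin.cases ?_ (fun b => ?_) b
    · rw [frontPerm_zero]; rfl
    · rw [frontPerm_succ]; rfl
  rw [hf, LinearMap.rTensor_tmul, L.insertOps_tmul (extDeriv_mem (hω a)) _
    (ω := fun b => ω (a.succAbove b)) fun b => hω (a.succAbove b), hq, hc, koszulSign_frontPerm,
    units_smul_tmul, tmul_units_smul, smul_smul, smul_smul, wordSign_zero, ← Int.negOnePow_add,
    ← Int.negOnePow_add, ← Units.neg_smul, ← Int.negOnePow_succ]
  congr 1
  have hb : degBefore (fun a => -(e a : ℤ)) a = - degBefore (fun a => (e a : ℤ)) a := by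
    rw [degBefore, degBefore, ← Finset.sum_neg_distrib]
    exact Finset.sum_congr rfl fun b _ => by split_ifs <;> simp
  rw [Int.negOnePow_eq_iff, hb, pairSum_succAbove _ a, Fin.sum_univ_succAbove _ a]
  refine ⟨(e a : ℤ) * degBefore (fun a => (e a : ℤ)) a - 1, ?_⟩
  push_cast
  ring

end CompleteLInftyAlgebra
end Bianchi

/-! ### The Bianchi identity -/

section Bianchi

variable {𝕜 V : Type*} [Field 𝕜] [AddCommGroup V] [Module 𝕜 V] {n : ℕ}

namespace CompleteLInftyAlgebra

variable (L : CompleteLInftyAlgebra 𝕜 V)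

lemma coeffOps_zero (d : Fin 0 → ℤ) (x : Fin 0 → PolyForm 𝕜 n ⊗[𝕜] V) :
    L.coeffOps n 0 d x = 0 := by
  have h := L.coeffOps_tmul d (e := 0) (ω := fun _ => (0 : PolyForm 𝕜 n)) (fun a => a.elim0)
    (fun a => a.elim0)
  rw [L.q_zero, zero_apply, TensorProduct.tmul_zero, smul_zero] at h
  rw [← h]
  congr 1
  exact funext fun a => a.elim0

lemma coeffOps_one (d : Fin 1 → ℤ) : L.coeffOps n 1 d = L.coeffOps n 1 0 := by
  simp [coeffOps, wordSign]

/-- The summand `(1 / l!) q_l(x, …, x)` of the curvature of a form `x` of degree `0`. -/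
def curvTerm (n l : ℕ) (x : PolyForm 𝕜 n ⊗[𝕜] V) : PolyForm 𝕜 n ⊗[𝕜] V :=
  (l.factorial : 𝕜)⁻¹ • L.coeffOps n l 0 fun _ => x

/-- The summand `y ↦ (1 / k!) q_{k+1}(y, x, …, x)` of the linearized curvature at `x`. -/
def linTerm (n k : ℕ) (x : PolyForm 𝕜 n ⊗[𝕜] V) :
    PolyForm 𝕜 n ⊗[𝕜] V →ₗ[𝕜] PolyForm 𝕜 n ⊗[𝕜] V :=
  (k.factorial : 𝕜)⁻¹ •
    { toFun y := L.insertOps n k y fun _ => x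
      map_add' y z := by rw [map_add, add_apply]
      map_smul' c y := by rw [map_smul, smul_apply]; rfl }

lemma linTerm_apply (k : ℕ) (x y : PolyForm 𝕜 n ⊗[𝕜] V) :
    L.linTerm n k x y = (k.factorial : 𝕜)⁻¹ • L.insertOps n k y fun _ => x := rfl

lemma curvTerm_zero (x : PolyForm 𝕜 n ⊗[𝕜] V) : L.curvTerm n 0 x = 0 := by
  rw [curvTerm, coeffOps_zero, smul_zero]

lemma curvTerm_one (x : PolyForm 𝕜 n ⊗[𝕜] V) :
    L.curvTerm n 1 x = L.formDiff n x + (extDeriv 𝕜 n).rTensor V x := by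
  rw [curvTerm, formDiff_apply]; simp

lemma linTerm_zero (x y : PolyForm 𝕜 n ⊗[𝕜] V) :
    L.linTerm n 0 x y = L.formDiff n y + (extDeriv 𝕜 n).rTensor V y := by
  rw [linTerm_apply, insertOps_apply, coeffOps_one, formDiff_apply, sub_add_cancel,
    Nat.factorial_zero, Nat.cast_one, inv_one, one_smul]
  congr 1
  funext a
  rw [Subsingleton.elim (α := Fin 1) a 0]; rfl

lemma mem_formFil_one (x : PolyForm 𝕜 n ⊗[𝕜] V) : x ∈ L.formFil n 1 :=
  L.formFil_one (n := n) ▸ Submodule.mem_top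

lemma curvTerm_mem_formFil (l : ℕ) (x : PolyForm 𝕜 n ⊗[𝕜] V) :
    L.curvTerm n l x ∈ L.formFil n l := by
  rcases l with _ | l
  · rw [curvTerm_zero]; exact Submodule.zero_mem _
  · refine Submodule.smul_mem _ _ ?_
    have := L.coeffOps_mem_formFil (n := n) (k := l + 1) (by omega) 0 (p := fun _ => 1)
      (fun _ => le_rfl) (x := fun _ => x) fun _ => L.mem_formFil_one x
    simpa using this

lemma linTerm_mem_formFil (k : ℕ) {p : ℕ} (hp : 1 ≤ p) (x : PolyForm 𝕜 n ⊗[𝕜] V)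
    {y : PolyForm 𝕜 n ⊗[𝕜] V} (hy : y ∈ L.formFil n p) :
    L.linTerm n k x y ∈ L.formFil n (p + k) := by
  refine Submodule.smul_mem _ _ ?_
  have := L.coeffOps_mem_formFil (n := n) (k := k + 1) (by omega) (Fin.cons 1 0)
    (p := Fin.cons p fun _ => 1) (Fin.cases hp fun _ => le_rfl) (x := Fin.cons y fun _ => x)
    (Fin.cases hy fun _ => L.mem_formFil_one x)
  rw [Fin.sum_univ_succ] at this
  simpa [insertOps_apply] using this

variable [CharZero 𝕜]

/-- The quadratic relation on a form of degree `0`. -/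
lemma sum_linTerm_curvTerm (m : ℕ) {x : PolyForm 𝕜 n ⊗[𝕜] V} (hx : x ∈ L.formGr n 0) :
    ∑ p ∈ Finset.HasAntidiagonal.antidiagonal m, L.linTerm n p.1 x (L.curvTerm n p.2 x) = 0 := by
  have h := L.sum_composeOps (m := m) (x := fun _ => x) fun _ => hx
  rw [Finset.sum_filter_of_ne fun S _ hS => ?_] at h
  swap
  · by_contra hS'
    rw [Finset.not_nonempty_iff_eq_empty] at hS'
    subst hS'
    apply hS
    rw [composeOps_apply]
    have : ∀ (k : ℕ) (hk : k = 0), L.coeffOps n k 0 (fun _ => x) = 0 := by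
      rintro _ rfl; exact L.coeffOps_zero _ _
    rw [this _ Finset.card_empty, map_zero]; rfl
  obtain ⟨F, hF⟩ : ∃ F : ℕ → PolyForm 𝕜 n ⊗[𝕜] V,
      ∀ l, F l = L.insertOps n (m - l) (L.coeffOps n l 0 fun _ => x) fun _ => x := ⟨_, fun _ => rfl⟩
  have h1 : ∀ S : Finset (Fin m), L.composeOps n S (fun _ => x) = F S.card := by
    intro S
    rw [hF, composeOps_apply, Finset.card_compl, Fintype.card_fin]
  rw [Finset.sum_congr rfl fun S _ => h1 S, ← Finset.powerset_univ,
    Finset.sum_powerset_apply_card F, Finset.card_univ, Fintype.card_fin] at h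
  rw [← Finset.Nat.sum_antidiagonal_swap,
    Finset.Nat.sum_antidiagonal_eq_sum_range_succ_mk, ← smul_zero ((m.factorial : 𝕜)⁻¹), ← h,
    Finset.smul_sum]
  refine Finset.sum_congr rfl fun l hl => ?_
  have hl' : l ≤ m := Nat.lt_succ_iff.1 (Finset.mem_range.1 hl)
  rw [Prod.fst_swap, Prod.snd_swap]
  rw [hF, linTerm_apply, curvTerm, map_smul, smul_apply, smul_smul, ← Nat.cast_smul_eq_nsmul 𝕜,
    smul_smul, Nat.cast_choose 𝕜 hl']
  congr 1
  have := Nat.cast_ne_zero (R := 𝕜).2 m.factorial_ne_zero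
  field_simp

lemma extDeriv_curvTerm (k : ℕ) {x : PolyForm 𝕜 n ⊗[𝕜] V} (hx : x ∈ L.formGr n 0) :
    (extDeriv 𝕜 n).rTensor V (L.curvTerm n (k + 1) x) =
      - L.linTerm n k x ((extDeriv 𝕜 n).rTensor V x) := by
  rw [curvTerm, map_smul, L.extDeriv_coeffOps fun _ => hx, Finset.sum_const, Finset.card_univ,
    Fintype.card_fin, linTerm_apply, ← Nat.cast_smul_eq_nsmul 𝕜, smul_neg, smul_smul,
    Nat.factorial_succ]
  congr 2
  have h1 := Nat.cast_ne_zero (R := 𝕜).2 k.factorial_ne_zero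
  have h2 := Nat.cast_ne_zero (R := 𝕜).2 k.succ_ne_zero
  push_cast at h2 ⊢
  field_simp

/-- The curvature `∑_{l ≤ N} (1 / l!) q_l(x, …, x)` of a form `x` of degree `0`, where the linear
part includes the differential of forms. -/
def formCurv (n N : ℕ) (x : PolyForm 𝕜 n ⊗[𝕜] V) : PolyForm 𝕜 n ⊗[𝕜] V :=
  ∑ l ∈ Finset.range (N + 1), L.curvTerm n l x - (extDeriv 𝕜 n).rTensor V x

/-- The Bianchi identity, up to terms of filtration `N + 1`. -/
lemma bianchi (N : ℕ) {x : PolyForm 𝕜 n ⊗[𝕜] V} (hx : x ∈ L.formGr n 0) :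
    L.formDiff n (L.formCurv n N x) +
      ∑ k ∈ Finset.range N, L.linTerm n (k + 1) x (L.formCurv n N x) ∈ L.formFil n (N + 1) := by
  have hd : (extDeriv 𝕜 n).rTensor V ((extDeriv 𝕜 n).rTensor V x) = 0 := by
    rw [← LinearMap.comp_apply, ← LinearMap.rTensor_comp]
    have : extDeriv 𝕜 n ∘ₗ extDeriv 𝕜 n = 0 := LinearMap.ext extDeriv_extDeriv
    rw [this, LinearMap.rTensor_zero, LinearMap.zero_apply]
  have h1 : (extDeriv 𝕜 n).rTensor V (L.formCurv n N x) =
      - ∑ k ∈ Finset.range N, L.linTerm n k x ((extDeriv 𝕜 n).rTensor V x) := by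
    rw [formCurv, map_sub, hd, sub_zero, map_sum, Finset.sum_range_succ', curvTerm_zero, map_zero,
      add_zero, ← Finset.sum_neg_distrib]
    exact Finset.sum_congr rfl fun k _ => L.extDeriv_curvTerm k hx
  have h2 : L.formDiff n (L.formCurv n N x) +
      ∑ k ∈ Finset.range N, L.linTerm n (k + 1) x (L.formCurv n N x) =
      ∑ k ∈ Finset.range (N + 1), L.linTerm n k x (∑ l ∈ Finset.range (N + 1), L.curvTerm n l x) -
        L.linTerm n N x ((extDeriv 𝕜 n).rTensor V x) := by
    have h3 : L.formDiff n (L.formCurv n N x) = L.linTerm n 0 x (L.formCurv n N x) -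
        (extDeriv 𝕜 n).rTensor V (L.formCurv n N x) := by rw [linTerm_zero]; abel
    have h4 : L.linTerm n 0 x (L.formCurv n N x) +
        ∑ k ∈ Finset.range N, L.linTerm n (k + 1) x (L.formCurv n N x) =
        ∑ k ∈ Finset.range (N + 1), L.linTerm n k x (L.formCurv n N x) := by
      rw [Finset.sum_range_succ', add_comm]
    have h5 : ∑ k ∈ Finset.range (N + 1), L.linTerm n k x (L.formCurv n N x) =
        ∑ k ∈ Finset.range (N + 1), L.linTerm n k x
          (∑ l ∈ Finset.range (N + 1), L.curvTerm n l x) -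
        ∑ k ∈ Finset.range (N + 1), L.linTerm n k x ((extDeriv 𝕜 n).rTensor V x) := by
      rw [← Finset.sum_sub_distrib]
      exact Finset.sum_congr rfl fun k _ => by rw [formCurv, map_sub]
    rw [Finset.sum_range_succ (fun k => L.linTerm n k x ((extDeriv 𝕜 n).rTensor V x))] at h5
    rw [h3, sub_add_eq_add_sub, h4, h5, h1]
    abel
  rw [h2]
  refine Submodule.sub_mem _ ?_ ?_
  · simp only [map_sum]
    rw [← Finset.sum_product', ← Finset.sum_filter_add_sum_filter_not _ fun p : ℕ × ℕ => p.1 + p.2 ≤ N]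
    refine Submodule.add_mem _ ?_ (Submodule.sum_mem _ fun p hp => ?_)
    · rw [← Finset.sum_fiberwise_of_maps_to (t := Finset.range (N + 1)) (g := fun p : ℕ × ℕ => p.1 + p.2)
        fun p hp => Finset.mem_range.2 (Nat.lt_succ_iff.2 (Finset.mem_filter.1 hp).2)]
      refine Submodule.sum_mem _ fun m hm => ?_
      have : (Finset.filter (fun p : ℕ × ℕ => p.1 + p.2 ≤ N)
          (Finset.range (N + 1) ×ˢ Finset.range (N + 1))).filter (fun p => p.1 + p.2 = m) =
          Finset.HasAntidiagonal.antidiagonal m := by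
        ext p
        have := Finset.mem_range.1 hm
        simp only [Finset.mem_filter, Finset.mem_product, Finset.mem_range,
          Finset.HasAntidiagonal.mem_antidiagonal]
        omega
      rw [this, L.sum_linTerm_curvTerm m hx]
      exact Submodule.zero_mem _
    · obtain ⟨_, hp⟩ := Finset.mem_filter.1 hp
      rcases Nat.eq_zero_or_pos p.2 with h0 | h0
      · rw [h0, curvTerm_zero, map_zero]; exact Submodule.zero_mem _
      · exact L.formFil_antitone (by omega)
          (L.linTerm_mem_formFil p.1 h0 x (L.curvTerm_mem_formFil p.2 x))
  · exact L.formFil_antitone (by omega) (L.linTerm_mem_formFil N le_rfl x (L.mem_formFil_one _))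

end CompleteLInftyAlgebra
end Bianchi

/-! ### Homotopy transfer on powers of a cochain -/

section Count

variable {𝕜 M : Type*} [Field 𝕜] [AddCommGroup M] [Module 𝕜 M]

/-- The number of maps `Fin m → Fin k` with prescribed sizes of the fibres is a multinomial
coefficient; the proof compares two expansions of `(X₁ + ⋯ + Xₖ)ᵐ`. -/
lemma sum_block_eq_sum_multinomial (m k : ℕ) (F : (Fin k → ℕ) → M) :
    ∑ c : Fin m → Fin k, F (fun j => (block c j).card) =
      ∑ μ ∈ Finset.piAntidiag Finset.univ m, (Nat.multinomial Finset.univ μ : 𝕜) • F μ := by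
  let Φ : MvPolynomial (Fin k) 𝕜 →ₗ[𝕜] M :=
    (MvPolynomial.basisMonomials (Fin k) 𝕜).constr 𝕜 fun μ => F μ
  have hΦ : ∀ μ : Fin k → ℕ, Φ (∏ j, MvPolynomial.X j ^ μ j) = F μ := by
    intro μ
    have h1 : ∏ j, (MvPolynomial.X j : MvPolynomial (Fin k) 𝕜) ^ μ j =
        MvPolynomial.basisMonomials (Fin k) 𝕜 (Finsupp.equivFunOnFinite.symm μ) := by
      rw [MvPolynomial.coe_basisMonomials]
      dsimp only
      rw [MvPolynomial.monomial_eq, Finsupp.prod_fintype]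
      · simp
      · simp
    rw [h1, Module.Basis.constr_basis]
    rfl
  have h := congrArg Φ ((Fintype.sum_pow (fun j : Fin k => (MvPolynomial.X j :
    MvPolynomial (Fin k) 𝕜)) m).symm.trans (Finset.sum_pow_eq_sum_piAntidiag Finset.univ _ m))
  rw [map_sum, map_sum] at h
  convert h using 1
  · refine Finset.sum_congr rfl fun c _ => ?_
    rw [← Finset.prod_fiberwise_of_maps_to (g := c) (t := Finset.univ) fun _ _ => Finset.mem_univ _]
    rw [← hΦ]
    congr 1
    refine Finset.prod_congr rfl fun j _ => ?_
    rw [Finset.prod_congr rfl fun a ha => by rw [(Finset.mem_filter.1 ha).2], Finset.prod_const]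
    rfl
  · refine Finset.sum_congr rfl fun μ _ => ?_
    rw [← nsmul_eq_mul, map_nsmul, hΦ, Nat.cast_smul_eq_nsmul]

lemma sum_surjective {m k : ℕ} (T : (Fin m → Fin k) → M)
    (h : ∀ c, ¬ Function.Surjective c → T c = 0) :
    ∑ c : {c : Fin m → Fin k // Function.Surjective c}, T c.1 = ∑ c, T c := by
  rw [← Finset.sum_subtype (Finset.univ.filter Function.Surjective) (by simp) T,
    Finset.sum_filter_of_ne]
  exact fun c _ hc => not_not.1 fun h' => hc (h c h')

end Count

section Transfer

variable {𝕜 V : Type*} [Field 𝕜] [AddCommGroup V] [Module 𝕜 V] {n : ℕ}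

namespace CompleteLInftyAlgebra

variable (L : CompleteLInftyAlgebra 𝕜 V)

lemma koszulSign_zero {m : ℕ} (c : Fin m → ℕ) : koszulSign (fun _ => 0) c = 1 := by
  simp [koszulSign]

/-- The value `(1 / m!) f_m(α, …, α)` of the transferred morphism on a cochain `α` of
degree one, which has degree zero in the shifted grading. -/
def morTerm (n m : ℕ) (α : Face (n + 1) → V) : PolyForm 𝕜 n ⊗[𝕜] V :=
  (m.factorial : 𝕜)⁻¹ • transferMor (whitneyMap n) ((dupont 𝕜 n).rTensor V) (L.formOps n) m
    (fun _ => 0) (fun _ => α)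

/-- The component of degree `m` in `α` of `∑_{k=2}^{N+1} (1 / k!) q_k(x, …, x)`, where `x` is the
sum of the `morTerm`s. -/
def quadTerm (n N m : ℕ) (α : Face (n + 1) → V) : PolyForm 𝕜 n ⊗[𝕜] V :=
  ∑ k ∈ Finset.range N, ((k + 2).factorial : 𝕜)⁻¹ •
    ∑ μ ∈ Finset.piAntidiag (Finset.univ : Finset (Fin (k + 2))) m,
      L.coeffOps n (k + 2) 0 fun j => L.morTerm n (μ j) α

lemma morTerm_zero (α : Face (n + 1) → V) : L.morTerm n 0 α = 0 := by
  rw [morTerm, transferMor, smul_zero]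

lemma morTerm_one (α : Face (n + 1) → V) : L.morTerm n 1 α = whitneyMap n α := by
  rw [morTerm, transferMor]; simp

lemma coeffOps_morTerm_eq_zero {k : ℕ} {μ : Fin k → ℕ} {j : Fin k} (h : μ j = 0)
    (α : Face (n + 1) → V) : (L.coeffOps n k 0 fun j => L.morTerm n (μ j) α) = 0 :=
  (L.coeffOps n k 0).map_coord_zero j (by rw [h, morTerm_zero])

lemma quadTerm_of_le_one (N : ℕ) {m : ℕ} (hm : m ≤ 1) (α : Face (n + 1) → V) :
    L.quadTerm n N m α = 0 := by
  refine Finset.sum_eq_zero fun k _ => ?_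
  rw [Finset.sum_eq_zero, smul_zero]
  intro μ hμ
  obtain ⟨j, hj⟩ : ∃ j, μ j = 0 := by
    by_contra! h
    have h1 : ∑ _j : Fin (k + 2), 1 ≤ ∑ j, μ j :=
      Finset.sum_le_sum fun j _ => Nat.one_le_iff_ne_zero.2 (h j)
    rw [(Finset.mem_piAntidiag.1 hμ).1] at h1
    simp at h1
    omega
  exact L.coeffOps_morTerm_eq_zero hj α

/-- The nonlinear part of order `m` only involves the parts of the morphism of order less than `m`;
hence the induction that proves both membership statements. -/
lemma quadTerm_mem (N : ℕ) {m : ℕ} {α : Face (n + 1) → V}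
    (h : ∀ m' < m, L.morTerm n m' α ∈ L.formFil n m' ∧ L.morTerm n m' α ∈ L.formGr n 0) :
    L.quadTerm n N m α ∈ L.formFil n m ∧ L.quadTerm n N m α ∈ L.formGr n 1 := by
  -- only compositions without zeros contribute, and their parts are smaller than `m`
  have key : ∀ k, ∀ μ ∈ Finset.piAntidiag (Finset.univ : Finset (Fin (k + 2))) m,
      (L.coeffOps n (k + 2) 0 fun j => L.morTerm n (μ j) α) = 0 ∨
        (∀ j, 1 ≤ μ j ∧ μ j < m) := by
    intro k μ hμ
    by_cases h : ∃ j, μ j = 0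
    · obtain ⟨j, hj⟩ := h
      exact Or.inl (L.coeffOps_morTerm_eq_zero hj α)
    · push Not at h
      refine Or.inr fun j => ⟨Nat.one_le_iff_ne_zero.2 (h j), ?_⟩
      obtain ⟨j', hj'⟩ := exists_ne j
      have h1 : μ j + μ j' ≤ ∑ j, μ j := by
        rw [← Finset.sum_pair hj'.symm]
        exact Finset.sum_le_univ_sum_of_nonneg fun _ => Nat.zero_le _
      rw [(Finset.mem_piAntidiag.1 hμ).1] at h1
      have := Nat.one_le_iff_ne_zero.2 (h j')
      omega
  constructor <;> refine Submodule.sum_mem _ fun k _ => Submodule.smul_mem _ _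
    (Submodule.sum_mem _ fun μ hμ => ?_)
  · rcases key k μ hμ with h' | h'
    · rw [h']; exact Submodule.zero_mem _
    · rw [← (Finset.mem_piAntidiag.1 hμ).1]
      exact L.coeffOps_mem_formFil (by omega) 0 (fun j => (h' j).1) fun j => (h _ (h' j).2).1
  · rcases key k μ hμ with h' | h'
    · rw [h']; exact Submodule.zero_mem _
    · have := L.coeffOps_mem_formGr (n := n) (0 : Fin (k + 2) → ℤ) fun j => (h _ (h' j).2).2
      simpa using this

variable [CharZero 𝕜]

lemma transferMor_eq (m : ℕ) (α : Face (n + 1) → V) :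
    transferMor (whitneyMap n) ((dupont 𝕜 n).rTensor V) (L.formOps n) m (fun _ => 0) (fun _ => α) =
      (m.factorial : 𝕜) • L.morTerm n m α := by
  rw [morTerm, smul_inv_smul₀ (Nat.cast_ne_zero.2 m.factorial_ne_zero)]

/-- Both recursions of the transfer: the sum over surjections is the sum over compositions. -/
lemma sum_surjective_transfer {M : Type*} [AddCommGroup M] [Module 𝕜 M]
    (G : PolyForm 𝕜 n ⊗[𝕜] V →ₗ[𝕜] M) {N m : ℕ} (hm : m < N) (α : Face (n + 1) → V) :
    ∑ k ∈ Finset.range (m + 1), ((k + 2).factorial : 𝕜)⁻¹ •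
      ∑ c : {c : Fin (m + 2) → Fin (k + 2) // Function.Surjective c},
        koszulSign (fun _ => 0) (fun a => (c.1 a : ℕ)) •
          G (L.formOps n (k + 2) (fun j => ∑ _a ∈ block c.1 j, 0)
            (fun j => transferMor (whitneyMap n) ((dupont 𝕜 n).rTensor V) (L.formOps n)
              (block c.1 j).card (fun _ => 0) (fun _ => α))) =
    ((m + 2).factorial : 𝕜) • G (L.quadTerm n N (m + 2) α) := by
  have hk : ∀ k, ∑ c : {c : Fin (m + 2) → Fin (k + 2) // Function.Surjective c},
        koszulSign (fun _ => 0) (fun a => (c.1 a : ℕ)) •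
          G (L.formOps n (k + 2) (fun j => ∑ _a ∈ block c.1 j, 0)
            (fun j => transferMor (whitneyMap n) ((dupont 𝕜 n).rTensor V) (L.formOps n)
              (block c.1 j).card (fun _ => 0) (fun _ => α))) =
      ((m + 2).factorial : 𝕜) • G (∑ μ ∈ Finset.piAntidiag (Finset.univ : Finset (Fin (k + 2)))
        (m + 2), L.coeffOps n (k + 2) 0 fun j => L.morTerm n (μ j) α) := by
    intro k
    obtain ⟨F, hF⟩ : ∃ F : (Fin (k + 2) → ℕ) → M, ∀ μ, F μ = (∏ j, ((μ j).factorial : 𝕜)) •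
      G (L.coeffOps n (k + 2) 0 fun j => L.morTerm n (μ j) α) := ⟨_, fun _ => rfl⟩
    have h0 : ∀ c : Fin (m + 2) → Fin (k + 2), ¬ Function.Surjective c →
        F (fun j => (block c j).card) = 0 := by
      intro c hc
      obtain ⟨j, hj⟩ := not_forall.1 hc
      have hb : block c j = ∅ := by
        rw [block, Finset.filter_eq_empty_iff]
        exact fun a _ h => hj ⟨a, h⟩
      rw [hF, (L.coeffOps n (k + 2) 0).map_coord_zero j, map_zero, smul_zero]
      rw [hb, Finset.card_empty, morTerm_zero]
    have h1 : ∀ c : {c : Fin (m + 2) → Fin (k + 2) // Function.Surjective c},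
        koszulSign (fun _ => 0) (fun a => (c.1 a : ℕ)) •
          G (L.formOps n (k + 2) (fun j => ∑ _a ∈ block c.1 j, 0)
            (fun j => transferMor (whitneyMap n) ((dupont 𝕜 n).rTensor V) (L.formOps n)
              (block c.1 j).card (fun _ => 0) (fun _ => α))) =
        F (fun j => (block c.1 j).card) := by
      intro c
      rw [koszulSign_zero, one_smul, L.formOps_eq n (k + 2) (by omega), hF, ← map_smul,
        ← MultilinearMap.map_smul_univ]
      simp only [Finset.sum_const_zero, transferMor_eq]
      rfl
    rw [Finset.sum_congr rfl fun c _ => h1 c, sum_surjective (fun c => F _) h0,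
      sum_block_eq_sum_multinomial (𝕜 := 𝕜), map_sum, Finset.smul_sum]
    refine Finset.sum_congr rfl fun μ hμ => ?_
    rw [hF, smul_smul, ← Nat.cast_prod, ← Nat.cast_mul, mul_comm, Nat.multinomial_spec,
      (Finset.mem_piAntidiag.1 hμ).1]
  rw [quadTerm, map_sum, Finset.smul_sum, ← Finset.sum_subset (Finset.range_subset_range.2 hm)]
  · refine Finset.sum_congr rfl fun k _ => ?_
    rw [hk, map_smul, smul_comm]
  · intro k _ hk'
    rw [map_smul, smul_comm, ← hk]
    have : IsEmpty {c : Fin (m + 2) → Fin (k + 2) // Function.Surjective c} := by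
      refine ⟨fun c => hk' ?_⟩
      have := Fintype.card_le_of_surjective _ c.2
      rw [Fintype.card_fin, Fintype.card_fin] at this
      exact Finset.mem_range.2 (by omega)
    rw [Finset.univ_eq_empty, Finset.sum_empty, smul_zero]

lemma morTerm_succ_succ {N m : ℕ} (hm : m < N) (α : Face (n + 1) → V) :
    L.morTerm n (m + 2) α = (dupont 𝕜 n).rTensor V (L.quadTerm n N (m + 2) α) := by
  rw [morTerm, transferMor, L.sum_surjective_transfer _ hm,
    inv_smul_smul₀ (Nat.cast_ne_zero.2 (m + 2).factorial_ne_zero)]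

lemma cochainOps_succ_succ {N m : ℕ} (hm : m < N) (α : Face (n + 1) → V) :
    ((m + 2).factorial : 𝕜)⁻¹ • L.cochainOps n (m + 2) (fun _ => 0) (fun _ => α) =
      integrationMap n (L.quadTerm n N (m + 2) α) := by
  rw [cochainOps, transferOps, L.sum_surjective_transfer _ hm,
    inv_smul_smul₀ (Nat.cast_ne_zero.2 (m + 2).factorial_ne_zero)]

lemma morTerm_mem (m : ℕ) {α : Face (n + 1) → V} (hα : α ∈ L.cochains (n + 1) 1) :
    L.morTerm n m α ∈ L.formFil n m ∧ L.morTerm n m α ∈ L.formGr n 0 := by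
  induction m using Nat.strong_induction_on with | _ m ih =>
  match m, ih with
  | 0, _ => rw [morTerm_zero]; exact ⟨Submodule.zero_mem _, Submodule.zero_mem _⟩
  | 1, _ =>
    rw [morTerm_one]
    exact ⟨L.mem_formFil_one _, L.whitneyMap_mem_formGr (by simpa using hα)⟩
  | m + 2, ih =>
    rw [L.morTerm_succ_succ (Nat.lt_succ_self m)]
    have := L.quadTerm_mem (m + 1) ih
    exact ⟨L.rTensor_mem_formFil _ this.1, L.dupont_mem_formGr this.2⟩

/-- The form `∑_{m ≤ N + 1} (1 / m!) f_m(α, …, α)`. -/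
def morSum (n N : ℕ) (α : Face (n + 1) → V) : PolyForm 𝕜 n ⊗[𝕜] V :=
  ∑ m ∈ Finset.range (N + 2), L.morTerm n m α

/-- The part `∑_{2 ≤ k ≤ N + 1} (1 / k!) q_k(x, …, x)` of the curvature. -/
def quadSum (n N : ℕ) (x : PolyForm 𝕜 n ⊗[𝕜] V) : PolyForm 𝕜 n ⊗[𝕜] V :=
  ∑ k ∈ Finset.range N, L.curvTerm n (k + 2) x

/-- The partial sum `∑_{m ≤ N + 1} (1 / m!) r_m(α, …, α)` of the curvature of a cochain. -/
def cochainCurv (n N : ℕ) (α : Face (n + 1) → V) : Face (n + 1) → V :=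
  ∑ m ∈ Finset.range (N + 1),
    ((m + 1).factorial : 𝕜)⁻¹ • L.cochainOps n (m + 1) (fun _ => 0) (fun _ => α)

lemma morSum_mem_formGr (N : ℕ) {α : Face (n + 1) → V} (hα : α ∈ L.cochains (n + 1) 1) :
    L.morSum n N α ∈ L.formGr n 0 :=
  Submodule.sum_mem _ fun m _ => (L.morTerm_mem m hα).2

/-- Truncating the sum over `m` of the homotopy transfer recursion changes it only in high
filtration: the sum by total order is the higher curvature of the partial sum of the morphism. -/
lemma sum_quadTerm_sub_quadSum (N : ℕ) {α : Face (n + 1) → V} (hα : α ∈ L.cochains (n + 1) 1) :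
    ∑ m ∈ Finset.range (N + 2), L.quadTerm n N m α - L.quadSum n N (L.morSum n N α) ∈
      L.formFil n (N + 2) := by
  simp only [quadTerm, quadSum]
  rw [Finset.sum_comm, ← Finset.sum_sub_distrib]
  refine Submodule.sum_mem _ fun k _ => ?_
  rw [curvTerm, morSum, MultilinearMap.map_sum_finset _ (fun _ m => L.morTerm n m α),
    ← Finset.smul_sum, ← smul_sub]
  refine Submodule.smul_mem _ _ ?_
  rw [← Finset.sum_filter_add_sum_filter_not (Fintype.piFinset _)
    fun μ : Fin (k + 2) → ℕ => ∑ j, μ j < N + 2, ← sub_sub, ← Finset.sum_fiberwise_of_maps_to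
    (t := Finset.range (N + 2)) (g := fun μ : Fin (k + 2) → ℕ => ∑ j, μ j)
    fun μ hμ => Finset.mem_range.2 (Finset.mem_filter.1 hμ).2]
  have h1 : ∀ m ∈ Finset.range (N + 2),
      ((Fintype.piFinset fun _ : Fin (k + 2) => Finset.range (N + 2)).filter
        (fun μ => ∑ j, μ j < N + 2)).filter (fun μ => ∑ j, μ j = m) =
      Finset.piAntidiag Finset.univ m := by
    intro m hm
    have hm := Finset.mem_range.1 hm
    ext μ
    simp only [Finset.mem_filter, Fintype.mem_piFinset, Finset.mem_range, Finset.mem_piAntidiag,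
      Finset.mem_univ, implies_true, and_true]
    constructor
    · exact fun h => h.2
    · intro h
      have h' : ∑ j, μ j = m := h
      refine ⟨⟨fun j => ?_, by omega⟩, h⟩
      have := Finset.single_le_sum (f := μ) (fun _ _ => Nat.zero_le _) (Finset.mem_univ j)
      omega
  rw [Finset.sum_congr rfl fun m hm => Finset.sum_congr (h1 m hm) fun _ _ => rfl, sub_self,
    zero_sub]
  refine Submodule.neg_mem _ (Submodule.sum_mem _ fun μ hμ => ?_)
  have hμ' := (Finset.mem_filter.1 hμ).2
  by_cases h : ∃ j, μ j = 0
  · obtain ⟨j, hj⟩ := h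
    rw [L.coeffOps_morTerm_eq_zero hj]
    exact Submodule.zero_mem _
  · push Not at h
    exact L.formFil_antitone (not_lt.1 hμ') (L.coeffOps_mem_formFil (by omega) 0
      (fun j => Nat.one_le_iff_ne_zero.2 (h j)) fun j => (L.morTerm_mem _ hα).1)

/-- The fixed point equation of homotopy transfer, up to terms of filtration `N + 2`. -/
lemma morSum_eq (N : ℕ) {α : Face (n + 1) → V} (hα : α ∈ L.cochains (n + 1) 1) :
    L.morSum n N α - (whitneyMap n α +
      (dupont 𝕜 n).rTensor V (L.quadSum n N (L.morSum n N α))) ∈ L.formFil n (N + 2) := by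
  have h := L.rTensor_mem_formFil (dupont 𝕜 n) (L.sum_quadTerm_sub_quadSum N hα)
  convert h using 1
  rw [Finset.sum_range_succ', Finset.sum_range_succ', L.quadTerm_of_le_one N zero_le_one,
    L.quadTerm_of_le_one N le_rfl, add_zero, add_zero, map_sub, map_sum]
  nth_rewrite 1 [morSum]
  rw [Finset.sum_range_succ', Finset.sum_range_succ', morTerm_zero, morTerm_one, add_zero,
    Finset.sum_congr rfl fun m hm => L.morTerm_succ_succ (Finset.mem_range.1 hm) α]
  abel

/-- The transferred curvature of `α` is, modulo high filtration, the differential of `α` plus the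
integral over faces of the higher curvature of the image of `α` under the transfer morphism. -/
lemma cochainCurv_eq (N : ℕ) {α : Face (n + 1) → V} (hα : α ∈ L.cochains (n + 1) 1) :
    L.cochainCurv n N α - (L.cochainDiff (n + 1) α +
      integrationMap n (L.quadSum n N (L.morSum n N α))) ∈ L.cochainFil (n + 1) (N + 2) := by
  have h := L.integrationMap_mem_cochainFil (L.sum_quadTerm_sub_quadSum N hα)
  convert h using 1
  rw [Finset.sum_range_succ', Finset.sum_range_succ', L.quadTerm_of_le_one N zero_le_one,
    L.quadTerm_of_le_one N le_rfl, add_zero, add_zero, map_sub, map_sum]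
  rw [cochainCurv, Finset.sum_range_succ',
    Finset.sum_congr rfl fun m hm => L.cochainOps_succ_succ (Finset.mem_range.1 hm) α]
  have h1 : L.cochainOps n (0 + 1) (fun _ => 0) (fun _ => α) = L.cochainDiff (n + 1) α := by
    rw [cochainOps, transferOps]
  rw [h1, zero_add, Nat.factorial_one, Nat.cast_one, inv_one, one_smul]
  abel

end CompleteLInftyAlgebra
end Transfer

/-! ### The curvature of cochains -/

section Curvature

variable {𝕜 V : Type*} [Field 𝕜] [AddCommGroup V] [Module 𝕜 V] {n m : ℕ}

lemma cochainHomotopy_sub (i : Fin m) (α β : Face m → V) :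
    cochainHomotopy i (α - β) = cochainHomotopy i α - cochainHomotopy i β := by
  funext σ
  simp only [cochainHomotopy, Pi.sub_apply]
  split_ifs
  · rw [sub_zero]
  · rw [smul_sub]

lemma cochainHomotopy_add (i : Fin m) (α β : Face m → V) :
    cochainHomotopy i (α + β) = cochainHomotopy i α + cochainHomotopy i β := by
  rw [← sub_neg_eq_add, cochainHomotopy_sub, ← zero_sub β, cochainHomotopy_sub]
  have : cochainHomotopy i (0 : Face m → V) = 0 := by
    funext σ; simp [cochainHomotopy]
  rw [this, zero_sub, sub_neg_eq_add]

/-- Replacing letters of a multilinear map, one at a time. -/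
lemma multilinear_sub_mem {ι M N : Type*} [Fintype ι] [AddCommGroup M] [Module 𝕜 M]
    [AddCommGroup N] [Module 𝕜 N] (f : MultilinearMap 𝕜 (fun _ : ι => M) N) (S : Submodule 𝕜 N)
    [DecidableEq ι] {x y : M}
    (h : ∀ (w : ι → M) (j : ι), f (Function.update w j (x - y)) ∈ S) :
    f (fun _ => x) - f (fun _ => y) ∈ S := by
  suffices H : ∀ s : Finset ι, f (s.piecewise (fun _ => x) fun _ => y) - f (fun _ => y) ∈ S by
    simpa using H Finset.univ
  intro s
  induction s using Finset.induction_on with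
  | empty => simp
  | insert a s ha ih =>
    have h1 := h (s.piecewise (fun _ => x) fun _ => y) a
    rw [f.map_update_sub] at h1
    have h2 : Function.update (s.piecewise (fun _ => x) fun _ => y) a y =
        s.piecewise (fun _ => x) fun _ => y := by
      rw [Function.update_eq_self_iff, Finset.piecewise_eq_of_notMem _ _ _ ha]
    rw [h2] at h1
    rw [Finset.piecewise_insert]
    convert S.add_mem h1 ih using 1
    abel

namespace CompleteLInftyAlgebra

variable (L : CompleteLInftyAlgebra 𝕜 V)

lemma cochainFil_antitone : Antitone (L.cochainFil m) := fun _ _ h _ hα =>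
  L.mem_cochainFil.2 fun σ => L.fil_antitone h (L.mem_cochainFil.1 hα σ)

lemma mem_cochainFil_one (α : Face m → V) : α ∈ L.cochainFil m 1 :=
  L.mem_cochainFil.2 fun σ => by rw [L.fil_one]; trivial

lemma quadSum_sub_mem (N : ℕ) {s : ℕ} (hs : 1 ≤ s) {x y : PolyForm 𝕜 n ⊗[𝕜] V}
    (h : x - y ∈ L.formFil n s) :
    L.quadSum n N x - L.quadSum n N y ∈ L.formFil n (s + 1) := by
  rw [quadSum, quadSum, ← Finset.sum_sub_distrib]
  refine Submodule.sum_mem _ fun k _ => ?_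
  have hq : (L.coeffOps n (k + 2) 0 fun _ => x) - (L.coeffOps n (k + 2) 0 fun _ => y) ∈
      L.formFil n (s + 1) := multilinear_sub_mem _ _ fun w j => ?_
  · have := Submodule.smul_mem _ ((k + 2).factorial : 𝕜)⁻¹ hq
    rwa [smul_sub] at this
  have := L.coeffOps_mem_formFil (n := n) (k := k + 2) (by omega) 0
    (p := Function.update (fun _ => 1) j s) (x := Function.update w j (x - y))
    (fun a => ?_) fun a => ?_
  · refine L.formFil_antitone ?_ this
    rw [Finset.sum_update_of_mem (Finset.mem_univ j), Finset.sum_const, Finset.card_sdiff]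
    simp
  · by_cases ha : a = j
    · subst ha; simpa using hs
    · rw [Function.update_of_ne ha]
  · by_cases ha : a = j
    · subst ha; simpa using h
    · rw [Function.update_of_ne ha, Function.update_of_ne ha]
      exact L.mem_formFil_one _

lemma formCurv_eq (N : ℕ) (x : PolyForm 𝕜 n ⊗[𝕜] V) :
    L.formCurv n (N + 1) x = L.formDiff n x + L.quadSum n N x := by
  rw [formCurv, Finset.sum_range_succ', Finset.sum_range_succ', curvTerm_zero, curvTerm_one,
    quadSum]
  abel

/-- The sum of the nonlinear terms of the linearized curvature. -/
def linSum (n N : ℕ) (x y : PolyForm 𝕜 n ⊗[𝕜] V) : PolyForm 𝕜 n ⊗[𝕜] V :=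
  ∑ k ∈ Finset.range (N + 1), L.linTerm n (k + 1) x y

lemma linSum_mem (N : ℕ) {p : ℕ} (hp : 1 ≤ p) (x : PolyForm 𝕜 n ⊗[𝕜] V)
    {y : PolyForm 𝕜 n ⊗[𝕜] V} (hy : y ∈ L.formFil n p) :
    L.linSum n N x y ∈ L.formFil n (p + 1) :=
  Submodule.sum_mem _ fun k _ =>
    L.formFil_antitone (by omega) (L.linTerm_mem_formFil (k + 1) hp x hy)

/-- A cochain is determined by its value at the `i`-th vertex, its image under `hⁱ` and its
differential, filtered version. -/
lemma mem_cochainFil_of_cochainHomotopy (i : Fin m) {p : ℕ} (hp : 1 ≤ p) {α : Face m → V}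
    (h₁ : cochainHomotopy i α ∈ L.cochainFil m p) (h₂ : α (vertexFace i) ∈ L.fil p)
    (h₃ : cochainHomotopy i (L.cochainDiff m α) ∈ L.cochainFil m p) : α ∈ L.cochainFil m p := by
  refine L.mem_cochainFil.2 fun σ => ?_
  have h := L.cochainDiff_cochainHomotopy i α σ
  have h' : α σ = (if σ.1.card = 1 then α (vertexFace i) else 0) -
      (L.cochainDiff m (cochainHomotopy i α) σ + cochainHomotopy i (L.cochainDiff m α) σ) := by
    rw [h]; abel
  rw [h']
  refine Submodule.sub_mem _ ?_ (Submodule.add_mem _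
    (L.mem_cochainFil.1 (L.cochainDiff_mem_cochainFil hp h₁) σ) (L.mem_cochainFil.1 h₃ σ))
  split_ifs
  · exact h₂
  · exact Submodule.zero_mem _

variable [CharZero 𝕜]

lemma formDiff_quadSum (N : ℕ) {x : PolyForm 𝕜 n ⊗[𝕜] V} (hx : x ∈ L.formGr n 0) :
    L.formDiff n (L.quadSum n N x) + L.linSum n N x (L.formCurv n (N + 1) x) ∈
      L.formFil n (N + 2) := by
  have := L.bianchi (N + 1) hx
  rw [L.formCurv_eq, map_add, L.formDiff_formDiff, zero_add, ← L.formCurv_eq] at this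
  exact this

/-- The curvature of the form associated with a cochain is determined by the curvature of the
cochain. -/
lemma formCurv_morSum (N : ℕ) {α : Face (n + 1) → V} (hα : α ∈ L.cochains (n + 1) 1) :
    L.formCurv n (N + 1) (L.morSum n N α) - (whitneyMap n (L.cochainCurv n N α) +
      (dupont 𝕜 n).rTensor V
        (L.linSum n N (L.morSum n N α) (L.formCurv n (N + 1) (L.morSum n N α)))) ∈
      L.formFil n (N + 2) := by
  have h1 := L.formDiff_mem_formFil (by omega) (L.morSum_eq N hα)
  have h2 := L.whitneyMap_mem_formFil (L.cochainCurv_eq N hα)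
  have h3 := L.rTensor_mem_formFil (dupont 𝕜 n)
    (L.formDiff_quadSum N (L.morSum_mem_formGr N hα))
  set x := L.morSum n N α
  set Q := L.quadSum n N x with hQ
  have h4 := L.formDiff_dupont Q
  rw [map_sub, map_add, ← L.whitneyMap_cochainDiff] at h1
  rw [map_sub, map_add] at h2
  rw [map_add] at h3
  convert Submodule.sub_mem _ (Submodule.sub_mem _ h1 h2) h3 using 1
  nth_rewrite 1 [L.formCurv_eq]
  rw [← hQ, eq_sub_of_add_eq h4]
  abel

lemma cochainDiff_cochainCurv (N : ℕ) {α : Face (n + 1) → V} (hα : α ∈ L.cochains (n + 1) 1) :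
    L.cochainDiff (n + 1) (L.cochainCurv n N α) + integrationMap n
        (L.linSum n N (L.morSum n N α) (L.formCurv n (N + 1) (L.morSum n N α))) ∈
      L.cochainFil (n + 1) (N + 2) := by
  have h2 := L.cochainDiff_mem_cochainFil (by omega) (L.cochainCurv_eq N hα)
  have h3 := L.integrationMap_mem_cochainFil
    (L.formDiff_quadSum N (L.morSum_mem_formGr N hα))
  rw [map_add, L.integrationMap_formDiff] at h3
  rw [map_sub, map_add, L.cochainDiff_cochainDiff, zero_add] at h2
  convert Submodule.add_mem _ h2 h3 using 1
  abel

/-- If the curvature of a cochain vanishes on the open star of the vertex `i`, it vanishes. -/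
lemma cochainCurv_mem (i : Fin (n + 1)) (N : ℕ) {α : Face (n + 1) → V}
    (hα : α ∈ L.cochains (n + 1) 1)
    (h₁ : cochainHomotopy i (L.cochainCurv n N α) ∈ L.cochainFil (n + 1) (N + 2))
    (h₂ : L.cochainCurv n N α (vertexFace i) ∈ L.fil (N + 2)) :
    L.cochainCurv n N α ∈ L.cochainFil (n + 1) (N + 2) := by
  have hd := L.cochainDiff_cochainCurv N hα
  have hf := L.formCurv_morSum N hα
  set R := L.cochainCurv n N α
  set y := L.formCurv n (N + 1) (L.morSum n N α)
  set b := L.linSum n N (L.morSum n N α) y with hb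
  -- the two curvatures determine each other, and the nonlinear terms raise the filtration
  have step : ∀ p, p ≤ N + 2 → b ∈ L.formFil n p → 1 ≤ p → R ∈ L.cochainFil (n + 1) p := by
    intro p hp hbp hp1
    refine L.mem_cochainFil_of_cochainHomotopy i hp1 (L.cochainFil_antitone hp h₁)
      (L.fil_antitone hp h₂) (L.cochainHomotopy_mem_cochainFil i ?_)
    have := Submodule.sub_mem _ (L.cochainFil_antitone hp hd) (L.integrationMap_mem_cochainFil hbp)
    rwa [add_sub_cancel_right] at this
  have main : ∀ p, 1 ≤ p → p ≤ N + 2 → b ∈ L.formFil n p := by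
    intro p hp
    induction p, hp using Nat.le_induction with
    | base => exact fun _ => L.mem_formFil_one _
    | succ p hp ih =>
      intro hpN
      have hbp := ih (by omega)
      have hR := step p (by omega) hbp hp
      refine L.linSum_mem N hp _ ?_
      have := Submodule.add_mem _ (L.formFil_antitone (by omega : p ≤ N + 2) hf)
        (Submodule.add_mem _ (L.whitneyMap_mem_formFil hR) (L.rTensor_mem_formFil (dupont 𝕜 n) hbp))
      rwa [sub_add_cancel] at this
  exact step (N + 2) le_rfl (main _ (by omega) le_rfl) (by omega)

lemma morSum_sub_mem (N : ℕ) {p : ℕ} (hp : 1 ≤ p) {α β : Face (n + 1) → V}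
    (hα : α ∈ L.cochains (n + 1) 1) (hβ : β ∈ L.cochains (n + 1) 1)
    (h : α - β ∈ L.cochainFil (n + 1) p) (hpN : p ≤ N + 2) :
    L.morSum n N α - L.morSum n N β ∈ L.formFil n p := by
  suffices H : ∀ s, 1 ≤ s → s ≤ p → L.morSum n N α - L.morSum n N β ∈ L.formFil n s from
    H p hp le_rfl
  intro s hs
  induction s, hs using Nat.le_induction with
  | base => exact fun _ => L.mem_formFil_one _
  | succ s hs ih =>
    intro hsp
    have h1 := L.rTensor_mem_formFil (dupont 𝕜 n) (L.quadSum_sub_mem N hs (ih (by omega)))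
    have h2 := L.formFil_antitone hsp (L.whitneyMap_mem_formFil h)
    have h3 := L.formFil_antitone (by omega : s + 1 ≤ N + 2)
      (Submodule.sub_mem _ (L.morSum_eq N hα) (L.morSum_eq N hβ))
    rw [map_sub] at h1 h2
    convert Submodule.add_mem _ (Submodule.add_mem _ h1 h2) h3 using 1
    abel

/-- The nonlinear part of the curvature of cochains raises the filtration of differences. -/
lemma cochainCurv_sub_mem (N : ℕ) {p : ℕ} (hp : 1 ≤ p) (hpN : p ≤ N + 1)
    {α β : Face (n + 1) → V} (hα : α ∈ L.cochains (n + 1) 1) (hβ : β ∈ L.cochains (n + 1) 1)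
    (h : α - β ∈ L.cochainFil (n + 1) p) :
    L.cochainCurv n N α - L.cochainCurv n N β - L.cochainDiff (n + 1) (α - β) ∈
      L.cochainFil (n + 1) (p + 1) := by
  have h1 := L.integrationMap_mem_cochainFil
    (L.quadSum_sub_mem N hp (L.morSum_sub_mem N hp hα hβ h (by omega)))
  have h2 := L.cochainFil_antitone (by omega : p + 1 ≤ N + 2)
    (Submodule.sub_mem _ (L.cochainCurv_eq N hα) (L.cochainCurv_eq N hβ))
  rw [map_sub] at h1 ⊢
  convert Submodule.add_mem _ h1 h2 using 1
  abel

lemma cochainOps_mem (m : ℕ) {α : Face (n + 1) → V} (hα : α ∈ L.cochains (n + 1) 1) :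
    ((m + 1).factorial : 𝕜)⁻¹ • L.cochainOps n (m + 1) (fun _ => 0) (fun _ => α) ∈
        L.cochainFil (n + 1) (m + 1) ∧
      ((m + 1).factorial : 𝕜)⁻¹ • L.cochainOps n (m + 1) (fun _ => 0) (fun _ => α) ∈
        L.cochains (n + 1) 2 := by
  rcases m with _ | m
  · refine ⟨L.mem_cochainFil_one _, Submodule.smul_mem _ _ ?_⟩
    have h1 : L.cochainOps n (0 + 1) (fun _ => 0) (fun _ => α) = L.cochainDiff (n + 1) α := by
      rw [cochainOps, transferOps]
    rw [h1]
    exact L.cochainDiff_mem_cochains hα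
  · rw [L.cochainOps_succ_succ (Nat.lt_succ_self m)]
    have := L.quadTerm_mem (n := n) (m + 1) (m := m + 2) fun m' _ => L.morTerm_mem m' hα
    exact ⟨L.integrationMap_mem_cochainFil this.1, L.integrationMap_mem_cochains this.2⟩

lemma cochainCurv_mem_cochains (N : ℕ) {α : Face (n + 1) → V} (hα : α ∈ L.cochains (n + 1) 1) :
    L.cochainCurv n N α ∈ L.cochains (n + 1) 2 :=
  Submodule.sum_mem _ fun m _ => (L.cochainOps_mem m hα).2

lemma cochainCurv_add_sub_mem (N k : ℕ) {α : Face (n + 1) → V}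
    (hα : α ∈ L.cochains (n + 1) 1) :
    L.cochainCurv n (N + k) α - L.cochainCurv n N α ∈ L.cochainFil (n + 1) (N + 2) := by
  induction k with
  | zero => rw [add_zero, sub_self]; exact Submodule.zero_mem _
  | succ k ih =>
    have h := L.cochainFil_antitone (by omega : N + 2 ≤ N + k + 1 + 1)
      (L.cochainOps_mem (N + k + 1) hα).1
    convert Submodule.add_mem _ ih h using 1
    rw [← add_assoc, cochainCurv, Finset.sum_range_succ, ← cochainCurv]
    abel

lemma vertexValue_morSum (i : Fin (n + 1)) (N : ℕ) (α : Face (n + 1) → V) :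
    vertexValue i (L.morSum n N α) = α (vertexFace i) := by
  rw [morSum, Finset.sum_range_succ', Finset.sum_range_succ', morTerm_zero, morTerm_one, add_zero,
    Finset.sum_congr rfl fun m hm => L.morTerm_succ_succ (Finset.mem_range.1 hm) α, map_add,
    map_sum, vertexValue_whitneyMap, Finset.sum_eq_zero fun m _ => vertexValue_dupont i _,
    zero_add]

/-- The curvature of a cochain at a vertex is the curvature of its value at this vertex. -/
lemma cochainCurv_vertexFace (i : Fin (n + 1)) (N : ℕ) {α : Face (n + 1) → V}
    (hα : α ∈ L.cochains (n + 1) 1) :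
    L.cochainCurv n N α (vertexFace i) - ∑ m ∈ Finset.range (N + 1),
      ((m + 1).factorial : 𝕜)⁻¹ • L.q (m + 1) (fun _ => α (vertexFace i)) ∈ L.fil (N + 2) := by
  have h := L.mem_cochainFil.1 (L.cochainCurv_eq N hα) (vertexFace i)
  convert h using 1
  have h1 : L.cochainDiff (n + 1) α (vertexFace i) = L.q₁ (α (vertexFace i)) := by
    rw [← cochainValue_face (L.cochainDiff (n + 1) α), cochainDiff_apply, cochainValue_face]
    simp [vertexFace, cochainValue_empty]
  rw [Pi.sub_apply, Pi.add_apply, h1, integrationMap_vertexFace, quadSum, map_sum,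
    Finset.sum_range_succ']
  simp only [curvTerm, map_smul, L.vertexValue_coeffOps, L.vertexValue_morSum]
  rw [q₁_apply, zero_add, Nat.factorial_one, Nat.cast_one, inv_one, one_smul]
  abel

end CompleteLInftyAlgebra
end Curvature

/-! ### Maurer-Cartan cochains and the open star of a vertex -/

section Convergence

variable {𝕜 V : Type*} [Field 𝕜] [AddCommGroup V] [Module 𝕜 V] {n m : ℕ}

/-- Convergence to zero of a series whose terms have increasing filtration. -/
lemma hasFilSum_zero_iff {fil : ℕ → Submodule 𝕜 V} (hf : Antitone fil) {a : ℕ → V}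
    (ha : ∀ m, a m ∈ fil (m + 1)) :
    HasFilSum fil a 0 ↔ ∀ N, ∑ m ∈ Finset.range (N + 1), a m ∈ fil (N + 2) := by
  simp only [HasFilSum, sub_zero]
  constructor
  · intro h N
    obtain ⟨M, hM⟩ := h (N + 2)
    have h1 := hM (N + 1 + M) (by omega)
    rw [Finset.sum_range_add] at h1
    refine (Submodule.add_mem_iff_left _ (Submodule.sum_mem _ fun k _ => ?_)).1 h1
    exact hf (by omega) (ha (N + 1 + k))
  · intro h p
    refine ⟨p + 1, fun m hm => ?_⟩
    obtain ⟨N, rfl⟩ : ∃ N, m = N + 1 := ⟨m - 1, by omega⟩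
    exact hf (by omega) (h N)

namespace CompleteLInftyAlgebra

variable (L : CompleteLInftyAlgebra 𝕜 V)

/-- The filtration of a complete algebra is separated. -/
lemma eq_zero_of_mem_fil {k : ℤ} {v : V} (hv : v ∈ L.gr k) (h : ∀ p, v ∈ L.fil p) : v = 0 :=
  (L.complete k (fun _ => 0) (fun _ => Submodule.zero_mem _)
    (fun _ => by rw [sub_zero]; exact Submodule.zero_mem _)).unique
    ⟨hv, fun p => by rw [sub_zero]; exact h p⟩
    ⟨Submodule.zero_mem _, fun _ => by rw [sub_zero]; exact Submodule.zero_mem _⟩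

lemma mem_MC_iff {v : V} : v ∈ L.MC ↔ v ∈ L.gr 1 ∧ ∀ N, ∑ m ∈ Finset.range (N + 1),
    ((m + 1).factorial : 𝕜)⁻¹ • L.q (m + 1) (fun _ => v) ∈ L.fil (N + 2) := by
  refine and_congr_right fun _ => hasFilSum_zero_iff L.fil_antitone fun m => ?_
  refine Submodule.smul_mem _ _ ?_
  have := L.q_continuous (m + 1) (fun _ => 1) (fun _ => v) (by omega) (fun _ => le_rfl)
    fun _ => by rw [L.fil_one]; trivial
  simpa using this

variable [CharZero 𝕜]

lemma mem_Del_iff {α : Face (n + 1) → V} : α ∈ L.Del n ↔ α ∈ L.cochains (n + 1) 1 ∧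
    ∀ N, L.cochainCurv n N α ∈ L.cochainFil (n + 1) (N + 2) :=
  and_congr_right fun hα => hasFilSum_zero_iff L.cochainFil_antitone fun m =>
    (L.cochainOps_mem m hα).1

omit [CharZero 𝕜] in
/-- On cochains which vanish on the open star of the vertex `i`, the operator `- hⁱ r₁` is the
identity. -/
lemma cochainHomotopy_cochainDiff (i : Fin m) {δ : Face m → V} (h : ∀ σ, i ∈ σ.1 → δ σ = 0) :
    cochainHomotopy i (L.cochainDiff m δ) = -δ := by
  funext σ
  have h0 : cochainHomotopy i δ = 0 := by
    funext σ
    rw [cochainHomotopy, h _ (Finset.mem_insert_self i σ.1), smul_zero, ite_self]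
    rfl
  have := L.cochainDiff_cochainHomotopy i δ σ
  rw [h0, map_zero, h (vertexFace i) (Finset.mem_singleton_self i), ite_self, zero_sub,
    Pi.zero_apply, zero_add] at this
  exact this

/-- A Maurer-Cartan cochain is determined by its values on the open star of a vertex. -/
lemma eq_of_mem_Del (i : Fin (n + 1)) {α β : Face (n + 1) → V} (hα : α ∈ L.Del n)
    (hβ : β ∈ L.Del n) (h : ∀ σ, i ∈ σ.1 → α σ = β σ) : α = β := by
  rw [mem_Del_iff] at hα hβ
  have hstar := L.cochainHomotopy_cochainDiff i (δ := α - β) fun σ hσ => by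
    rw [Pi.sub_apply, h σ hσ, sub_self]
  have key : ∀ p, 1 ≤ p → α - β ∈ L.cochainFil (n + 1) p := by
    intro p hp
    induction p, hp using Nat.le_induction with
    | base => exact L.mem_cochainFil_one _
    | succ p hp ih =>
      have h1 := L.cochainCurv_sub_mem p hp (by omega) hα.1 hβ.1 ih
      have h2 := L.cochainFil_antitone (by omega : p + 1 ≤ p + 2)
        (Submodule.sub_mem _ (hα.2 p) (hβ.2 p))
      have h3 := L.cochainHomotopy_mem_cochainFil i (Submodule.sub_mem _ h2 h1)
      rw [sub_sub_cancel, hstar] at h3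
      exact neg_mem_iff.1 h3
  funext σ
  rw [← sub_eq_zero]
  refine L.eq_zero_of_mem_fil (k := 1 - ((σ.1.card : ℤ) - 1))
    (Submodule.sub_mem _ (L.mem_cochains.1 hα.1 σ) (L.mem_cochains.1 hβ.1 σ)) fun p => ?_
  exact L.fil_antitone (Nat.le_succ p) (L.mem_cochainFil.1 (key (p + 1) (by omega)) σ)

/-- The iteration `α ↦ α + hⁱ R(α)`, with better and better approximations of the curvature `R`. -/
def starIterate (i : Fin (n + 1)) (α : Face (n + 1) → V) : ℕ → Face (n + 1) → V
  | 0 => α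
  | j + 1 => starIterate i α j + cochainHomotopy i (L.cochainCurv n j (starIterate i α j))

lemma starIterate_mem_cochains (i : Fin (n + 1)) {α : Face (n + 1) → V}
    (hα : α ∈ L.cochains (n + 1) 1) (j : ℕ) : L.starIterate i α j ∈ L.cochains (n + 1) 1 := by
  induction j with
  | zero => exact hα
  | succ j ih =>
    exact Submodule.add_mem _ ih
      (L.cochainHomotopy_mem_cochains i (by simpa using L.cochainCurv_mem_cochains j ih))

omit [CharZero 𝕜] in
lemma starIterate_apply (i : Fin (n + 1)) (α : Face (n + 1) → V) (j : ℕ) {σ : Face (n + 1)}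
    (hσ : i ∈ σ.1) : L.starIterate i α j σ = α σ := by
  induction j with
  | zero => rfl
  | succ j ih => rw [starIterate, Pi.add_apply, ih, cochainHomotopy, if_pos hσ, add_zero]

/-- Each correction step gains one filtration degree, because the curvature is the
differential to first order and `hⁱ` contracts the complex off the vertex `i`. -/
lemma cochainHomotopy_starIterate_mem (i : Fin (n + 1)) {α : Face (n + 1) → V}
    (hα : α ∈ L.cochains (n + 1) 1) (j : ℕ) :
    cochainHomotopy i (L.cochainCurv n j (L.starIterate i α j)) ∈
      L.cochainFil (n + 1) (j + 1) := by
  induction j with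
  | zero => exact L.mem_cochainFil_one _
  | succ j ih =>
    have hs : L.starIterate i α (j + 1) - L.starIterate i α j =
        cochainHomotopy i (L.cochainCurv n j (L.starIterate i α j)) := add_sub_cancel_left _ _
    have hstar := L.cochainHomotopy_cochainDiff i
      (δ := L.starIterate i α (j + 1) - L.starIterate i α j) fun σ hσ => by
        rw [Pi.sub_apply, L.starIterate_apply i α _ hσ, L.starIterate_apply i α _ hσ, sub_self]
    have h1 := L.cochainCurv_sub_mem (j + 1) (p := j + 1) (by omega) (by omega)
      (L.starIterate_mem_cochains i hα (j + 1)) (L.starIterate_mem_cochains i hα j)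
      (hs.symm ▸ ih)
    have h2 := L.cochainCurv_add_sub_mem j 1 (L.starIterate_mem_cochains i hα j)
    have h3 := L.cochainHomotopy_mem_cochainFil i (Submodule.add_mem _ h1 h2)
    rw [cochainHomotopy_add, cochainHomotopy_sub, cochainHomotopy_sub, cochainHomotopy_sub, hstar,
      hs] at h3
    convert h3 using 1
    abel

/-- Maurer-Cartan cochains with prescribed values on the open star of a vertex exist. -/
lemma exists_mem_Del (i : Fin (n + 1)) {α : Face (n + 1) → V} (hα : α ∈ L.cochains (n + 1) 1)
    (hi : α (vertexFace i) ∈ L.MC) : ∃ β ∈ L.Del n, ∀ σ, i ∈ σ.1 → β σ = α σ := by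
  have hlim : ∀ σ : Face (n + 1), ∃ y, y ∈ L.gr (1 - ((σ.1.card : ℤ) - 1)) ∧
      ∀ p, y - L.starIterate i α p σ ∈ L.fil p := fun σ =>
    (L.complete _ (fun p => L.starIterate i α p σ)
      (fun p => L.mem_cochains.1 (L.starIterate_mem_cochains i hα p) σ) fun p => by
        rw [← Pi.sub_apply, starIterate, add_sub_cancel_left]
        exact L.fil_antitone (Nat.le_succ p)
          (L.mem_cochainFil.1 (L.cochainHomotopy_starIterate_mem i hα p) σ)).exists
  choose β hβ hlim using hlim
  have hβ1 : β ∈ L.cochains (n + 1) 1 := L.mem_cochains.2 hβ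
  have hβα : ∀ σ : Face (n + 1), i ∈ σ.1 → β σ = α σ := fun σ hσ => by
    rw [← sub_eq_zero]
    refine L.eq_zero_of_mem_fil (Submodule.sub_mem _ (hβ σ) (L.mem_cochains.1 hα σ)) fun p => ?_
    rw [← L.starIterate_apply i α p hσ]
    exact hlim σ p
  refine ⟨β, (L.mem_Del_iff).2 ⟨hβ1, fun N => L.cochainCurv_mem i N hβ1 ?_ ?_⟩, hβα⟩
  · have hN : β - L.starIterate i α (N + 2) ∈ L.cochainFil (n + 1) (N + 2) :=
      L.mem_cochainFil.2 fun σ => hlim σ (N + 2)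
    have h1 := L.cochainCurv_sub_mem N (p := N + 1) (by omega) le_rfl hβ1
      (L.starIterate_mem_cochains i hα (N + 2)) (L.cochainFil_antitone (by omega) hN)
    have h2 := L.cochainDiff_mem_cochainFil (by omega) hN
    have h3 := L.cochainCurv_add_sub_mem N 2 (L.starIterate_mem_cochains i hα (N + 2))
    have h4 := L.cochainHomotopy_mem_cochainFil i
      (Submodule.sub_mem _ (Submodule.add_mem _ h1 h2) h3)
    have h5 := Submodule.add_mem _ h4 (L.cochainFil_antitone (by omega : N + 2 ≤ N + 2 + 1)
      (L.cochainHomotopy_starIterate_mem i hα (N + 2)))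
    rw [← cochainHomotopy_add] at h5
    convert h5 using 2
    abel
  · have h1 := L.cochainCurv_vertexFace i N hβ1
    rw [hβα _ (Finset.mem_singleton_self i)] at h1
    have := Submodule.add_mem _ h1 (((L.mem_MC_iff).1 hi).2 N)
    rwa [sub_add_cancel] at this

/-- Maurer-Cartan cochains are freely determined by their values on the open star of a vertex. -/
lemma bijOn_star (i : Fin (n + 1)) :
    Set.BijOn (fun (α : Face (n + 1) → V) (σ : {σ : Face (n + 1) // i ∈ σ.1}) => α σ.1) (L.Del n)
      {a | a ⟨vertexFace i, Finset.mem_singleton_self i⟩ ∈ L.MC ∧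
        ∀ σ, a σ ∈ L.gr (1 - ((σ.1.1.card : ℤ) - 1))} := by
  refine ⟨fun α hα => ?_, fun α hα β hβ h => ?_, fun a ha => ?_⟩
  · rw [mem_Del_iff] at hα
    refine ⟨(L.mem_MC_iff).2 ⟨by simpa [vertexFace] using L.mem_cochains.1 hα.1 (vertexFace i),
      fun N => ?_⟩, fun σ => L.mem_cochains.1 hα.1 σ.1⟩
    have := Submodule.sub_mem _ (L.mem_cochainFil.1 (hα.2 N) (vertexFace i))
      (L.cochainCurv_vertexFace i N hα.1)
    rwa [sub_sub_cancel] at this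
  · exact L.eq_of_mem_Del i hα hβ fun σ hσ => congrFun h ⟨σ, hσ⟩
  · classical
    obtain ⟨β, hβ, h⟩ := L.exists_mem_Del i
      (α := fun σ => if h : i ∈ σ.1 then a ⟨σ, h⟩ else 0)
      (L.mem_cochains.2 fun σ => by
        split_ifs with h
        · exact ha.2 ⟨σ, h⟩
        · exact Submodule.zero_mem _)
      (by
        rw [dif_pos (show i ∈ (vertexFace i).1 from Finset.mem_singleton_self i)]
        exact ha.1)
    refine ⟨β, hβ, funext fun σ => ?_⟩
    dsimp only
    rw [h σ.1 σ.2, dif_pos σ.2]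

end CompleteLInftyAlgebra
end Convergence

section Link

variable {V : Type*} [AddCommGroup V] {n : ℕ}

/-- The link of the vertex `i` in a simplex, as a subset of the opposite face. -/
def link (i : Fin (n + 1)) (S : Finset (Fin (n + 1))) : Finset (Fin n) :=
  Finset.univ.filter fun a => i.succAbove a ∈ S

lemma map_link (i : Fin (n + 1)) (S : Finset (Fin (n + 1))) :
    (link i S).map i.succAboveEmb = S.erase i := by
  ext a
  simp only [link, Finset.mem_map, Finset.mem_filter, Finset.mem_univ, true_and,
    Fin.coe_succAboveEmb, Finset.mem_erase]
  constructor
  · rintro ⟨b, hb, rfl⟩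
    exact ⟨i.succAbove_ne b, hb⟩
  · rintro ⟨hai, ha⟩
    obtain ⟨b, rfl⟩ := Fin.exists_succAbove_eq hai
    exact ⟨b, ha, rfl⟩

lemma notMem_map_succAbove (i : Fin (n + 1)) (T : Finset (Fin n)) :
    i ∉ T.map i.succAboveEmb := by
  simp [Fin.succAbove_ne]

lemma link_insert_map (i : Fin (n + 1)) (T : Finset (Fin n)) :
    link i (insert i (T.map i.succAboveEmb)) = T := by
  apply Finset.map_injective i.succAboveEmb
  rw [map_link, Finset.erase_insert (notMem_map_succAbove i T)]

lemma faceRestrict_cochainHomotopy (i : Fin (n + 1)) (α : Face (n + 1) → V) (τ : Face n) :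
    faceRestrict i (cochainHomotopy i α) τ = (-1 : ℤ) ^ posIn (τ.1.map i.succAboveEmb) i •
      α ⟨insert i (τ.1.map i.succAboveEmb), Finset.insert_nonempty _ _⟩ := by
  rw [faceRestrict, cochainHomotopy, if_neg (notMem_map_succAbove i τ.1)]
  rfl

end Link

/-- Cochains on the open star of the vertex `i` are pairs of a value at `i` and a cochain on the
opposite face. -/
lemma CompleteLInftyAlgebra.bijOn_link {𝕜 V : Type*} [Field 𝕜] [AddCommGroup V] [Module 𝕜 V]
    (L : CompleteLInftyAlgebra 𝕜 V) {n : ℕ} (i : Fin (n + 1)) :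
    Set.BijOn (fun (a : {σ : Face (n + 1) // i ∈ σ.1} → V) =>
        (a ⟨vertexFace i, Finset.mem_singleton_self i⟩, fun τ : Face n =>
          (-1 : ℤ) ^ posIn (τ.1.map i.succAboveEmb) i •
            a ⟨⟨insert i (τ.1.map i.succAboveEmb), Finset.insert_nonempty _ _⟩,
              Finset.mem_insert_self _ _⟩))
      {a | a ⟨vertexFace i, Finset.mem_singleton_self i⟩ ∈ L.MC ∧
        ∀ σ, a σ ∈ L.gr (1 - ((σ.1.1.card : ℤ) - 1))}
      (L.MC ×ˢ (L.cochains n 0 : Set (Face n → V))) := by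
  have hsign : ∀ (k : ℕ) (v : V), (-1 : ℤ) ^ k • (-1 : ℤ) ^ k • v = v := fun k v => by
    rw [smul_smul, ← mul_pow, neg_one_mul, neg_neg, one_pow, one_smul]
  have hlink : ∀ σ : {σ : Face (n + 1) // i ∈ σ.1}, σ.1 ≠ vertexFace i →
      (link i σ.1.1).Nonempty ∧ insert i ((link i σ.1.1).map i.succAboveEmb) = σ.1.1 := by
    intro σ hσ
    have h1 : insert i ((link i σ.1.1).map i.succAboveEmb) = σ.1.1 := by
      rw [map_link, Finset.insert_erase σ.2]
    refine ⟨Finset.nonempty_iff_ne_empty.2 fun h => hσ (Subtype.ext ?_), h1⟩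
    rw [← h1, h]
    rfl
  refine ⟨fun a ha => ⟨ha.1, L.mem_cochains.2 fun τ => zsmul_mem ?_ _⟩, fun a _ b _ h => ?_,
    fun b hb => ?_⟩
  · have := ha.2 ⟨⟨insert i (τ.1.map i.succAboveEmb), Finset.insert_nonempty _ _⟩,
      Finset.mem_insert_self _ _⟩
    convert this using 2
    rw [Finset.card_insert_of_notMem (notMem_map_succAbove i τ.1), Finset.card_map]
    push_cast
    ring
  · funext σ
    by_cases hσ : σ.1 = vertexFace i
    · obtain ⟨σ, hi⟩ := σ
      subst hσ
      exact congrArg Prod.fst h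
    · obtain ⟨h1, h2⟩ := hlink σ hσ
      have h3 := congrArg (fun v => (-1 : ℤ) ^ posIn ((link i σ.1.1).map i.succAboveEmb) i • v)
        (congrFun (congrArg Prod.snd h) ⟨link i σ.1.1, h1⟩)
      simp only [hsign, h2] at h3
      exact h3
  · refine ⟨fun σ => if h : (link i σ.1.1).Nonempty then
      (-1 : ℤ) ^ posIn ((link i σ.1.1).map i.succAboveEmb) i • b.2 ⟨link i σ.1.1, h⟩ else b.1,
      ⟨?_, fun σ => ?_⟩, ?_⟩
    · have : link i (vertexFace i).1 = ∅ := by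
        rw [← Finset.map_eq_empty (f := i.succAboveEmb), map_link]; simp [vertexFace]
      simp only [this, Finset.not_nonempty_empty, dif_neg, not_false_eq_true]
      exact hb.1
    · dsimp only
      split_ifs with h
      · refine zsmul_mem ?_ _
        convert L.mem_cochains.1 hb.2 ⟨link i σ.1.1, h⟩ using 2
        rw [← Finset.card_map i.succAboveEmb, map_link, ← Finset.card_erase_add_one σ.2]
        push_cast
        ring
      · have h1 : σ.1 = vertexFace i := by
          by_contra h'
          exact h (hlink σ h').1
        rw [h1]
        simpa [vertexFace] using ((L.mem_MC_iff).1 hb.1).1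
    · refine Prod.ext ?_ (funext fun τ => ?_)
      · have : link i (vertexFace i).1 = ∅ := by
          rw [← Finset.map_eq_empty (f := i.succAboveEmb), map_link]; simp [vertexFace]
        simp only [this, Finset.not_nonempty_empty, dif_neg, not_false_eq_true]
      · simp only [link_insert_map, τ.2, dif_pos, hsign]

end

end DelGetzler

theorem proposition2p7 {𝕜 V : Type*} [Field 𝕜] [CharZero 𝕜] [AddCommGroup V] [Module 𝕜 V]
    (L : DelGetzler.CompleteLInftyAlgebra 𝕜 V) (n : ℕ) (i : Fin (n + 1)) :
    Set.BijOn
      (fun α : DelGetzler.Face (n + 1) → V =>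
        (DelGetzler.evalVertex i α,
          DelGetzler.faceRestrict i (DelGetzler.cochainHomotopy i α)))
      (L.Del n)
      (L.MC ×ˢ (L.cochains n 0 : Set (DelGetzler.Face n → V))) ∧
    Set.BijOn
      (fun (α : DelGetzler.Face (n + 1) → V) (σ : {σ : DelGetzler.Face (n + 1) // i ∈ σ.1}) =>
        α σ.1)
      (L.Del n)
      {a | a ⟨DelGetzler.vertexFace i, Finset.mem_singleton_self i⟩ ∈ L.MC ∧
        ∀ σ, a σ ∈ L.gr (1 - ((σ.1.1.card : ℤ) - 1))} := by
  refine ⟨?_, L.bijOn_star i⟩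
  convert (L.bijOn_link i).comp (L.bijOn_star i) using 1
  funext α
  exact Prod.ext rfl (funext fun τ => DelGetzler.faceRestrict_cochainHomotopy i α τ)
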